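/- There is a universal constant $C$ with the following property. Let $S$ be the set of $n\ge 2$ edges of a connected planar subdivision: a connected graph drawn in $\mathbb{R}^2$ with distinct points as vertices and straight line segments as edges, where two edges intersect only in common endpoints (vertical edges and vertices with equal coordinates are allowed), stored with the list of edges at each vertex. Insert the segments of $S$, in uniformly random order, into a trapezoidal search DAG (TSD): its nodes are the faces (trapezoids) of all trapezoidations that occur during the incremental construction, its root is the whole plane, and each face created by an insertion is a child of those faces destroyed by that insertion whose interior it intersects. Abscissae are compared lexicographically, i.e. the symbolic shear $(x,y)\mapsto(x+\varepsilon y,y)$ is applied. Build a second TSD, in an independent uniformly random order, on the segments rotated by $90$ degrees. Let $W=[x_0,x_1]\times[y_0,y_1]$ with $x_0\le x_1$, $y_0\le y_1$ be a query window, and let $k$ be the number of edges that intersect $W$. The window query first runs, for each of the four sides of $W$, a depth-first search in the corresponding TSD which descends, once per node, only from nodes whose region intersects the side, and which checks the top and bottom boundary edges of every leaf reached. It then runs a breadth-first search on the subdivision from the edges found and from one arbitrary fixed edge: an edge is reported when it intersects $W$ and has not yet been reported, and the search continues at its endpoints inside $W$. For all insertion orders this algorithm terminates and reports each edge that intersects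 $W$ exactly once and no other edge. Its expected running time over the two insertion orders, counted in elementary steps (pointer, mark, queue and output operations and constant-size geometric predicates), is at most $C\,(k+\log n)$. -/

import Mathlib

open scoped BigOperators

noncomputable section

namespace WindowQuery

/-! ### Straight-line planar subdivisions -/

/-- Points of the plane. -/
abbrev Pt : Type := ℝ × ℝ

/-- `m` vertices placed in the plane and `n` straight-line edges between them. -/
structure Drawing (m n : ℕ) where
  pos : Fin m → Pt
  ends : Fin n → Fin m × Fin m

namespace Drawing

variable {m n : ℕ} (G : Drawing m n)

/-- The edge `e` as a closed line segment. -/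
def seg (e : Fin n) : Set Pt := segment ℝ (G.pos (G.ends e).1) (G.pos (G.ends e).2)

/-- `v` is an endpoint of `e`. -/
def Incident (v : Fin m) (e : Fin n) : Prop := v = (G.ends e).1 ∨ v = (G.ends e).2

/-- The underlying abstract graph. -/
def graph : SimpleGraph (Fin m) := SimpleGraph.fromRel fun u v => ∃ e, G.ends e = (u, v)

/-- The drawing is a connected planar subdivision: vertices are distinct points, edges are
nondegenerate, two edges meet only in common endpoints, an edge contains no vertices besides its
endpoints, and the underlying graph is connected. -/
structure IsConnectedPlanarSubdivision : Prop where
  pos_injective : Function.Injective G.pos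
  ends_ne : ∀ e, (G.ends e).1 ≠ (G.ends e).2
  noncrossing : ∀ e f, e ≠ f → ∀ p ∈ G.seg e ∩ G.seg f,
    ∃ v, G.Incident v e ∧ G.Incident v f ∧ G.pos v = p
  vertex_on_edge : ∀ v e, G.pos v ∈ G.seg e → G.Incident v e
  connected : G.graph.Connected

/-- Rotation of the plane by 90 degrees. -/
def rot (p : Pt) : Pt := (-p.2, p.1)

/-- The drawing rotated by 90 degrees. -/
def rotate : Drawing m n where
  pos v := rot (G.pos v)
  ends := G.ends

open Classical in
/-- The list of edges at the vertex `v`, stored with the subdivision. -/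
def incidenceList (v : Fin m) : List (Fin n) := (Finset.univ.filter fun e => G.Incident v e).toList

/-! ### Trapezoidations

Vertices with equal abscissa and vertical edges are treated by the usual symbolic shear
`(x, y) ↦ (x + ε y, y)` with infinitesimal `ε > 0`: abscissae are compared lexicographically, and
the side of a line on which a point lies is unaffected. -/

/-- Sheared abscissae, with `⊥` and `⊤` for the left and the right wall at infinity. -/
abbrev Absc : Type := WithBot (WithTop (ℝ ×ₗ ℝ))

/-- The sheared abscissa of a point. -/
def absc (p : Pt) : Absc := (((toLex p : ℝ ×ₗ ℝ) : WithTop (ℝ ×ₗ ℝ)) : Absc)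

/-- The left endpoint of an edge. -/
def lo (e : Fin n) : Pt :=
  ofLex (min (toLex (G.pos (G.ends e).1)) (toLex (G.pos (G.ends e).2)))

/-- The right endpoint of an edge. -/
def hi (e : Fin n) : Pt :=
  ofLex (max (toLex (G.pos (G.ends e).1)) (toLex (G.pos (G.ends e).2)))

/-- Orientation test: positive if `p` is above the line through `e`, negative if it is below,
zero if it is on the line. -/
def side (e : Fin n) (p : Pt) : ℝ :=
  ((G.hi e).1 - (G.lo e).1) * (p.2 - (G.lo e).2) - ((G.hi e).2 - (G.lo e).2) * (p.1 - (G.lo e).1)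

/-- `p` is in the vertical slab spanned by `e`. -/
def InSlab (e : Fin n) (p : Pt) : Prop := absc (G.lo e) ≤ absc p ∧ absc p ≤ absc (G.hi e)

/-- Among edges that share at most endpoints: `d` is below `e`, that is, in the common slab there
is a point of `e` above `d` or a point of `d` below `e`. -/
def Below (d e : Fin n) : Prop :=
  (∃ p ∈ G.seg e, G.InSlab d p ∧ 0 < G.side d p) ∨
  (∃ p ∈ G.seg d, G.InSlab e p ∧ G.side e p < 0)

end Drawing

/-- A trapezoid is described by the edges that carry its bottom and top boundaries and the vertices
that define its left and right walls; `none` is a boundary at infinity. -/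
structure Trapezoid (m n : ℕ) where
  bottom : Option (Fin n)
  top : Option (Fin n)
  left : Option (Fin m)
  right : Option (Fin m)
deriving DecidableEq, Fintype

namespace Drawing

variable {m n : ℕ} (G : Drawing m n)

/-- The position of the left wall. -/
def leftWall (Δ : Trapezoid m n) : Absc := Δ.left.elim ⊥ fun v => absc (G.pos v)

/-- The position of the right wall. -/
def rightWall (Δ : Trapezoid m n) : Absc := Δ.right.elim ⊤ fun v => absc (G.pos v)

/-- The lower boundary `b` is below the upper boundary `t`, where `none` is a bottom, respectively a
top, at infinity. -/
def BelowOpt (b t : Option (Fin n)) : Prop := ∀ d ∈ b, ∀ e ∈ t, G.Below d e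

/-- `p` is neither below the bottom nor above the top of `Δ`. -/
def InStrip (Δ : Trapezoid m n) (p : Pt) : Prop :=
  (∀ e ∈ Δ.bottom, 0 ≤ G.side e p) ∧ (∀ e ∈ Δ.top, G.side e p ≤ 0)

/-- The closed region of a trapezoid. -/
def region (Δ : Trapezoid m n) : Set Pt :=
  {p | G.leftWall Δ ≤ absc p ∧ absc p ≤ G.rightWall Δ ∧ G.InStrip Δ p}

/-- The edge `e` spans the whole slab between the two walls of `Δ`. -/
def Spans (e : Fin n) (Δ : Trapezoid m n) : Prop :=
  absc (G.lo e) ≤ G.leftWall Δ ∧ G.rightWall Δ ≤ absc (G.hi e)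

/-- `e` passes through the interior of `Δ`. -/
def Cuts (e : Fin n) (Δ : Trapezoid m n) : Prop :=
  max (G.leftWall Δ) (absc (G.lo e)) < min (G.rightWall Δ) (absc (G.hi e)) ∧
    G.BelowOpt Δ.bottom (some e) ∧ G.BelowOpt (some e) Δ.top

/-- `Δ` is a face of the trapezoidation of the edge set `R`, obtained by drawing vertical walls from
every endpoint up and down until they meet an edge: its bottom and top are edges of `R` that span
it, its walls emanate from endpoints of edges of `R` on its boundary, and no edge of `R` passes
through it. -/
structure IsFace (R : Finset (Fin n)) (Δ : Trapezoid m n) : Prop where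
  walls : G.leftWall Δ < G.rightWall Δ
  bottom : ∀ e ∈ Δ.bottom, e ∈ R ∧ G.Spans e Δ
  top : ∀ e ∈ Δ.top, e ∈ R ∧ G.Spans e Δ
  bottom_below_top : G.BelowOpt Δ.bottom Δ.top
  left : ∀ v ∈ Δ.left, (∃ e ∈ R, G.Incident v e) ∧ G.InStrip Δ (G.pos v)
  right : ∀ v ∈ Δ.right, (∃ e ∈ R, G.Incident v e) ∧ G.InStrip Δ (G.pos v)
  empty : ∀ e ∈ R, ¬ G.Cuts e Δ

open Classical in
/-- The trapezoidation of the edge set `R`. -/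
def trapezoidation (R : Finset (Fin n)) : Finset (Trapezoid m n) :=
  Finset.univ.filter fun Δ => G.IsFace R Δ

/-- The interiors of two trapezoids, with boundaries among noncrossing edges, intersect. -/
def Overlap (Δ Δ' : Trapezoid m n) : Prop :=
  max (G.leftWall Δ) (G.leftWall Δ') < min (G.rightWall Δ) (G.rightWall Δ') ∧
    G.BelowOpt Δ.bottom Δ'.top ∧ G.BelowOpt Δ'.bottom Δ.top

/-! ### The trapezoidal search DAG -/

/-- The faces that disappear when `e` is inserted into the trapezoidation of `R`. -/
def destroyed (R : Finset (Fin n)) (e : Fin n) : Finset (Trapezoid m n) :=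
  G.trapezoidation R \ G.trapezoidation (insert e R)

/-- The faces that appear when `e` is inserted into the trapezoidation of `R`. -/
def created (R : Finset (Fin n)) (e : Fin n) : Finset (Trapezoid m n) :=
  G.trapezoidation (insert e R) \ G.trapezoidation R

end Drawing

/-- The edges inserted before `e` if the edges are inserted by increasing priority `π`. -/
def insertedBefore {n : ℕ} (π : Equiv.Perm (Fin n)) (e : Fin n) : Finset (Fin n) :=
  Finset.univ.filter fun f => π f < π e

/-- A search DAG over trapezoids: every node stores the list of pointers to its children and its
region. A node is named by its trapezoid. -/
structure SearchDag (m n : ℕ) where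
  root : Trapezoid m n
  children : Trapezoid m n → List (Trapezoid m n)
  region : Trapezoid m n → Set Pt

open Classical in
/-- The trapezoidal search DAG for the insertion order `π`. The root is the whole plane. When `e` is
inserted, each created face becomes a child of all those faces destroyed by `e` whose interiors it
intersects. -/
def Drawing.tsd {m n : ℕ} (G : Drawing m n) (π : Equiv.Perm (Fin n)) : SearchDag m n where
  root := ⟨none, none, none, none⟩
  children Δ := (Finset.univ.filter fun Δ' => ∃ e,
    Δ ∈ G.destroyed (insertedBefore π e) e ∧ Δ' ∈ G.created (insertedBefore π e) e ∧
      G.Overlap Δ Δ').toList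
  region := G.region

/-! ### Windows -/

/-- A closed axis-aligned query window `[x₀, x₁] × [y₀, y₁]`. -/
structure Window where
  x₀ : ℝ
  x₁ : ℝ
  y₀ : ℝ
  y₁ : ℝ
  x_le : x₀ ≤ x₁
  y_le : y₀ ≤ y₁

/-- The four sides of a window. -/
inductive Side
  | left
  | right
  | bottom
  | top
deriving DecidableEq

namespace Window

variable (W : Window)

/-- The window as a set of points. -/
def toSet : Set Pt := Set.Icc W.x₀ W.x₁ ×ˢ Set.Icc W.y₀ W.y₁

/-- The vertical query segment for a side of the window. The horizontal sides become vertical by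
rotation by 90 degrees. -/
def query : Side → Set Pt
  | Side.left => {W.x₀} ×ˢ Set.Icc W.y₀ W.y₁
  | Side.right => {W.x₁} ×ˢ Set.Icc W.y₀ W.y₁
  | Side.bottom => Drawing.rot '' (Set.Icc W.x₀ W.x₁ ×ˢ {W.y₀})
  | Side.top => Drawing.rot '' (Set.Icc W.x₀ W.x₁ ×ˢ {W.y₁})

end Window

/-- The edge `e` intersects the window. -/
def Meets {m n : ℕ} (G : Drawing m n) (W : Window) (e : Fin n) : Prop :=
  (G.seg e ∩ W.toSet).Nonempty

/-! ### The query algorithm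

The algorithm is a transition system. One transition is a bounded number of elementary operations:
following or storing a pointer, appending to a queue or to the output, reading or setting a mark,
and evaluating a geometric predicate on a constant number of coordinates. The running time is the
number of transitions. -/

/-- The memory of the query algorithm. -/
structure State (m n : ℕ) where
  /-- The depth-first search stack. An entry is the rest of a list of children of a node. -/
  stack : List (Side × List (Trapezoid m n))
  /-- The marked nodes of the search DAGs, for each of the four queries. -/
  nodeMarks : Finset (Side × Trapezoid m n)
  /-- The edges still to be checked by the breadth-first search at the current vertex. -/
  scan : List (Fin n)
  /-- The queue of vertices of the breadth-first search. -/
  queue : List (Fin m)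
  /-- The marked vertices, which have been put into the queue. -/
  vertexMarks : Finset (Fin m)
  /-- The marked edges, which have been reported. -/
  edgeMarks : Finset (Fin n)
  /-- The list of reported edges. -/
  output : List (Fin n)

namespace State

variable {m n : ℕ} (G : Drawing m n) (W : Window)

open Classical in
/-- Put the vertex `v` into the queue if it is inside the window and not marked. -/
def enqueue (v : Fin m) (s : State m n) : State m n :=
  if G.pos v ∈ W.toSet ∧ v ∉ s.vertexMarks then
    { s with queue := s.queue ++ [v], vertexMarks := insert v s.vertexMarks }
  else s

open Classical in
/-- Report the edge `e` if it meets the window and is not marked, and then put its endpoints inside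
the window into the queue. -/
def checkEdge (e : Fin n) (s : State m n) : State m n :=
  if Meets G W e ∧ e ∉ s.edgeMarks then
    enqueue G W (G.ends e).2 (enqueue G W (G.ends e).1
      { s with edgeMarks := insert e s.edgeMarks, output := e :: s.output })
  else s

/-- Check the edge on a boundary of a trapezoid, if there is one. -/
def checkBoundary (o : Option (Fin n)) (s : State m n) : State m n :=
  o.elim s fun e => checkEdge G W e s

variable (D : Side → SearchDag m n)

open Classical in
/-- Visit the node `Δ` in the query for the side `σ` of the window: do nothing if it is marked or its
region does not intersect the query segment; at a leaf check the edges on the boundary; at an inner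
node descend. -/
def visitNode (σ : Side) (Δ : Trapezoid m n) (s : State m n) : State m n :=
  if (σ, Δ) ∉ s.nodeMarks ∧ ((D σ).region Δ ∩ W.query σ).Nonempty then
    let s' := { s with nodeMarks := insert (σ, Δ) s.nodeMarks }
    match (D σ).children Δ with
    | [] => checkBoundary G W Δ.top (checkBoundary G W Δ.bottom s')
    | c :: cs => { s' with stack := (σ, c :: cs) :: s'.stack }
  else s

/-- One transition. The depth-first searches come first; then the breadth-first search runs on the
edges of the subdivision inside the window. -/
def step (s : State m n) : State m n :=
  match s.stack, s.scan, s.queue with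
  | (σ, Δ :: rest) :: st, _, _ => visitNode G W D σ Δ { s with stack := (σ, rest) :: st }
  | (_, []) :: st, _, _ => { s with stack := st }
  | [], e :: es, _ => checkEdge G W e { s with scan := es }
  | [], [], v :: vs => { s with scan := G.incidenceList v, queue := vs }
  | [], [], [] => s

/-- The algorithm has stopped: all work lists are empty. -/
def Halted (s : State m n) : Prop := s.stack = [] ∧ s.scan = [] ∧ s.queue = []

/-- The initial state: the four segment queries start at the roots of the search DAGs. The
breadth-first search also checks one fixed edge `e₀`, for the case that all edges are in the interior
of the window. -/
def init (e₀ : Fin n) : State m n where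
  stack := [(Side.left, [(D Side.left).root]), (Side.right, [(D Side.right).root]),
    (Side.bottom, [(D Side.bottom).root]), (Side.top, [(D Side.top).root])]
  nodeMarks := ∅
  scan := [e₀]
  queue := []
  vertexMarks := ∅
  edgeMarks := ∅
  output := []

end State

/-- The two search DAGs: one on the edges, built in the order `π`, for the left and the right side,
and one on the edges rotated by 90 degrees, built in the order `π'`, for the other two sides. -/
def dags {m n : ℕ} (G : Drawing m n) (π π' : Equiv.Perm (Fin n)) : Side → SearchDag m n
  | Side.left => G.tsd π
  | Side.right => G.tsd π
  | Side.bottom => G.rotate.tsd π'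
  | Side.top => G.rotate.tsd π'

/-- The state of the window query algorithm after `t` transitions. -/
def run {m n : ℕ} (G : Drawing m n) (W : Window) (e₀ : Fin n) (π π' : Equiv.Perm (Fin n)) (t : ℕ) :
    State m n :=
  (State.step G W (dags G π π'))^[t] (State.init (dags G π π') e₀)

/-- The running time: the number of transitions until the algorithm stops. -/
def runTime {m n : ℕ} (G : Drawing m n) (W : Window) (e₀ : Fin n) (π π' : Equiv.Perm (Fin n)) : ℕ :=
  sInf {t | (run G W e₀ π π' t).Halted}

end WindowQuery

end

/-! The running time is first bounded for fixed insertion orders by a potential. A depth-first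
search enters each search node meeting its side at most once, and a node has at most seven children
(`length_children_le`), so it costs a constant per such node. The breadth-first search scans the
edges at each marked vertex once; all of them meet the window, and an edge has two ends, so it costs
O(k). This gives `runTime_le`, and it remains to bound the expected number of search nodes that meet
a vertical segment q.

This is backwards analysis. If r edges have been inserted and k_r of them meet q, at most 1 + 14 k_r
current faces meet q (`Drawing.card_zone_le`), and each depends on at most five edges
(`card_defining_le`). The last edge is uniform among the r edges, so the expected number of faces
meeting q that it creates is at most (5 + 70 E k_r) / r. Since E k_r = r k(q) / n, where k(q) counts
all edges that meet q, summation over r gives 5 H_n + 70 k(q) (`sum_perm_cost_le`,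
`sum_card_history_le`), and k(q) ≤ k for a side of the window.

For correctness, every point of a created face lies in an overlapping destroyed face
(`exists_destroyed`). Hence every final face meeting a side is reached along parents that contain
one fixed point of that side. An edge crossing the side at p is the top of a final face through p,
so it is found. Suppose now that an edge inside the window without side crossings is missed. Then
its ends are unmarked vertices inside the window, and this property spreads along all edges of the
connected graph: an edge leaving the window would cross a side, be reported and mark its ends. The
property thus reaches an end of the fixed edge, which was checked and must have marked that end
(`handled_of_halted`).

Degenerate positions are removed by a real shear with a small parameter δ > 0 that induces the
lexicographic order on finitely many relevant points (`exists_isShear`). The sheared drawing is an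
`Arrangement`: vertex abscissae are distinct, edges are graphs of affine functions, and faces can be
studied through interior points. A vertical query becomes the slanted segment of points (a + δ y,
y), which passes the abscissa of a vertex only by passing through that vertex. -/

noncomputable section

namespace WindowQuery

open Classical Set Filter Topology

/-! ### Arrangements in general position and the vertical order of their edges. -/

/-- Vertices with distinct abscissae and noncrossing edges that are graphs of affine functions. -/
structure Arrangement (m n : ℕ) where
  X : Fin m → ℝ
  Y : Fin m → ℝ
  lo : Fin n → Fin m
  hi : Fin n → Fin m
  slope : Fin n → ℝ
  X_injective : Function.Injective X
  lo_lt_hi : ∀ e, X (lo e) < X (hi e)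
  Y_hi : ∀ e, Y (hi e) = Y (lo e) + slope e * (X (hi e) - X (lo e))
  noncrossing : ∀ d e x, d ≠ e → x ∈ Icc (X (lo d)) (X (hi d)) → x ∈ Icc (X (lo e)) (X (hi e)) →
    Y (lo d) + slope d * (x - X (lo d)) = Y (lo e) + slope e * (x - X (lo e)) →
      x = X (lo d) ∨ x = X (hi d)
  vertex_on_edge : ∀ v e, X v ∈ Icc (X (lo e)) (X (hi e)) →
    Y (lo e) + slope e * (X v - X (lo e)) = Y v → v = lo e ∨ v = hi e

namespace Arrangement

variable {m n : ℕ} (A : Arrangement m n)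

/-- The ordinate of the line through `e` at the abscissa `x`. -/
def height (e : Fin n) (x : ℝ) : ℝ := A.Y (A.lo e) + A.slope e * (x - A.X (A.lo e))

/-- `x` is strictly between the walls of `Δ`. -/
def OpenSlab (Δ : Trapezoid m n) (x : ℝ) : Prop :=
  (∀ v ∈ Δ.left, A.X v < x) ∧ ∀ v ∈ Δ.right, x < A.X v

/-- `x` is weakly between the walls of `Δ`. -/
def ClosedSlab (Δ : Trapezoid m n) (x : ℝ) : Prop :=
  (∀ v ∈ Δ.left, A.X v ≤ x) ∧ ∀ v ∈ Δ.right, x ≤ A.X v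

/-- `(x, y)` is strictly between the boundary lines of `Δ`. -/
def Between (Δ : Trapezoid m n) (x y : ℝ) : Prop :=
  (∀ b ∈ Δ.bottom, A.height b x < y) ∧ ∀ t ∈ Δ.top, y < A.height t x

/-- `(x, y)` is weakly between the boundary lines of `Δ`. -/
def Strip (Δ : Trapezoid m n) (x y : ℝ) : Prop :=
  (∀ b ∈ Δ.bottom, A.height b x ≤ y) ∧ ∀ t ∈ Δ.top, y ≤ A.height t x

/-- `(x, y)` is in the interior of `Δ`. -/
def Interior (Δ : Trapezoid m n) (x y : ℝ) : Prop := A.OpenSlab Δ x ∧ A.Between Δ x y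

/-- `(x, y)` is in the closed trapezoid `Δ`. -/
def Region (Δ : Trapezoid m n) (x y : ℝ) : Prop := A.ClosedSlab Δ x ∧ A.Strip Δ x y

/-- `e` spans the slab of `Δ`. -/
def Spans (e : Fin n) (Δ : Trapezoid m n) : Prop :=
  (∃ v ∈ Δ.left, A.X (A.lo e) ≤ A.X v) ∧ ∃ v ∈ Δ.right, A.X v ≤ A.X (A.hi e)

/-- `e` passes through the interior of `Δ`. -/
def Cuts (e : Fin n) (Δ : Trapezoid m n) : Prop :=
  ∃ x ∈ Ioo (A.X (A.lo e)) (A.X (A.hi e)), A.OpenSlab Δ x ∧ A.Between Δ x (A.height e x)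

/-- `Δ` is a face of the trapezoidation of `R`. -/
structure IsFace (R : Finset (Fin n)) (Δ : Trapezoid m n) : Prop where
  interior : ∃ x y, A.Interior Δ x y
  bottom : ∀ e ∈ Δ.bottom, e ∈ R ∧ A.Spans e Δ
  top : ∀ e ∈ Δ.top, e ∈ R ∧ A.Spans e Δ
  left : ∀ v ∈ Δ.left, (∃ e ∈ R, v = A.lo e ∨ v = A.hi e) ∧ A.Strip Δ (A.X v) (A.Y v)
  right : ∀ v ∈ Δ.right, (∃ e ∈ R, v = A.lo e ∨ v = A.hi e) ∧ A.Strip Δ (A.X v) (A.Y v)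
  empty : ∀ e ∈ R, ¬ A.Cuts e Δ

variable {A}

theorem height_lo (e : Fin n) : A.height e (A.X (A.lo e)) = A.Y (A.lo e) := by simp [height]

theorem height_hi (e : Fin n) : A.height e (A.X (A.hi e)) = A.Y (A.hi e) := by
  simp [height, A.Y_hi e]

theorem continuous_height (e : Fin n) : Continuous (A.height e) := by
  unfold height; fun_prop

theorem height_vertex {v : Fin m} {e : Fin n} (h : v = A.lo e ∨ v = A.hi e) :
    A.height e (A.X v) = A.Y v := by
  rcases h with rfl | rfl
  · exact height_lo e
  · exact height_hi e

theorem eq_of_height_eq {d e : Fin n} {x : ℝ} (hd : x ∈ Ioo (A.X (A.lo d)) (A.X (A.hi d)))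
    (he : x ∈ Icc (A.X (A.lo e)) (A.X (A.hi e))) (h : A.height d x = A.height e x) : d = e := by
  by_contra hne
  rcases A.noncrossing d e x hne ⟨hd.1.le, hd.2.le⟩ he h with h | h
  · exact hd.1.ne' h
  · exact hd.2.ne h

/-- If the order failed at `x`, the intermediate value theorem would give a common point at an
abscissa other than `x₀`. As `x` is interior to both slabs, so is that abscissa, and noncrossing
forbids it. -/
theorem height_lt_of_lt {d e : Fin n} {x₀ x : ℝ}
    (hd₀ : x₀ ∈ Icc (A.X (A.lo d)) (A.X (A.hi d))) (he₀ : x₀ ∈ Icc (A.X (A.lo e)) (A.X (A.hi e)))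
    (h : A.height d x₀ < A.height e x₀) (hd : x ∈ Ioo (A.X (A.lo d)) (A.X (A.hi d)))
    (he : x ∈ Ioo (A.X (A.lo e)) (A.X (A.hi e))) : A.height d x < A.height e x := by
  by_contra! hx
  have hc : ContinuousOn (fun t => A.height e t - A.height d t) (uIcc x x₀) :=
    ((continuous_height e).sub (continuous_height d)).continuousOn
  have h0 : (0 : ℝ) ∈ uIcc (A.height e x - A.height d x) (A.height e x₀ - A.height d x₀) :=
    mem_uIcc.2 (Or.inl ⟨by linarith, by linarith⟩)
  obtain ⟨z, hz, hz0⟩ := intermediate_value_uIcc hc h0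
  have hzx : z ≠ x₀ := by
    rintro rfl
    simp only at hz0
    linarith
  have key : ∀ e : Fin n, x₀ ∈ Icc (A.X (A.lo e)) (A.X (A.hi e)) →
      x ∈ Ioo (A.X (A.lo e)) (A.X (A.hi e)) → z ∈ Ioo (A.X (A.lo e)) (A.X (A.hi e)) := by
    rintro e ⟨h1, h2⟩ ⟨h3, h4⟩
    rcases mem_uIcc.1 hz with ⟨h5, h6⟩ | ⟨h5, h6⟩
    · exact ⟨by linarith, (lt_of_le_of_ne h6 hzx).trans_le h2⟩
    · exact ⟨h1.trans_lt (lt_of_le_of_ne h5 hzx.symm), by linarith⟩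
  have hde : d = e := by
    refine eq_of_height_eq (key d hd₀ hd) (Ioo_subset_Icc_self (key e he₀ he)) ?_
    simp only at hz0
    linarith
  subst hde
  exact lt_irrefl _ h

/-- At the ends of the slabs edges may touch. A strict reversal there would contradict
`height_lt_of_lt` at the midpoint, which is interior to both slabs. -/
theorem height_le_of_lt {d e : Fin n} {x₀ x : ℝ}
    (hd₀ : x₀ ∈ Icc (A.X (A.lo d)) (A.X (A.hi d))) (he₀ : x₀ ∈ Icc (A.X (A.lo e)) (A.X (A.hi e)))
    (h : A.height d x₀ < A.height e x₀) (hd : x ∈ Icc (A.X (A.lo d)) (A.X (A.hi d)))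
    (he : x ∈ Icc (A.X (A.lo e)) (A.X (A.hi e))) : A.height d x ≤ A.height e x := by
  by_contra! hx
  have hne : x ≠ x₀ := by
    rintro rfl
    exact lt_asymm h hx
  have key : ∀ e : Fin n, x₀ ∈ Icc (A.X (A.lo e)) (A.X (A.hi e)) →
      x ∈ Icc (A.X (A.lo e)) (A.X (A.hi e)) →
        (x + x₀) / 2 ∈ Ioo (A.X (A.lo e)) (A.X (A.hi e)) := by
    rintro e ⟨h1, h2⟩ ⟨h3, h4⟩
    rcases lt_or_gt_of_ne hne with h5 | h5 <;> constructor <;> linarith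
  exact lt_asymm (height_lt_of_lt hd₀ he₀ h (key d hd₀ hd) (key e he₀ he))
    (height_lt_of_lt he hd hx (key e he₀ he) (key d hd₀ hd))

theorem isOpen_forall_mem_option {α β : Type*} [TopologicalSpace β] (o : Option α)
    {P : α → β → Prop} (h : ∀ a, IsOpen {p | P a p}) : IsOpen {p | ∀ a ∈ o, P a p} := by
  cases o with
  | none => simp
  | some a => simpa using h a

theorem isClosed_forall_mem_option {α β : Type*} [TopologicalSpace β] (o : Option α)
    {P : α → β → Prop} (h : ∀ a, IsClosed {p | P a p}) : IsClosed {p | ∀ a ∈ o, P a p} := by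
  cases o with
  | none => simp
  | some a => simpa using h a

theorem isOpen_openSlab (Δ : Trapezoid m n) : IsOpen {x | A.OpenSlab Δ x} :=
  (isOpen_forall_mem_option _ fun _ => isOpen_lt continuous_const continuous_id).inter
    (isOpen_forall_mem_option _ fun _ => isOpen_lt continuous_id continuous_const)

theorem isOpen_interior (Δ : Trapezoid m n) : IsOpen {p : ℝ × ℝ | A.Interior Δ p.1 p.2} :=
  ((isOpen_openSlab Δ).preimage continuous_fst).inter
    ((isOpen_forall_mem_option _ fun b =>
      isOpen_lt ((continuous_height b).comp continuous_fst) continuous_snd).inter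
    (isOpen_forall_mem_option _ fun t =>
      isOpen_lt continuous_snd ((continuous_height t).comp continuous_fst)))

theorem isClosed_region (Δ : Trapezoid m n) : IsClosed {p : ℝ × ℝ | A.Region Δ p.1 p.2} :=
  ((isClosed_forall_mem_option _ fun _ => isClosed_le continuous_const continuous_fst).inter
    (isClosed_forall_mem_option _ fun _ => isClosed_le continuous_fst continuous_const)).inter
    ((isClosed_forall_mem_option _ fun b =>
      isClosed_le ((continuous_height b).comp continuous_fst) continuous_snd).inter
    (isClosed_forall_mem_option _ fun t =>
      isClosed_le continuous_snd ((continuous_height t).comp continuous_fst)))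

theorem OpenSlab.closed {Δ : Trapezoid m n} {x : ℝ} (h : A.OpenSlab Δ x) : A.ClosedSlab Δ x :=
  ⟨fun v hv => (h.1 v hv).le, fun v hv => (h.2 v hv).le⟩

theorem Between.strip {Δ : Trapezoid m n} {x y : ℝ} (h : A.Between Δ x y) : A.Strip Δ x y :=
  ⟨fun v hv => (h.1 v hv).le, fun v hv => (h.2 v hv).le⟩

theorem Interior.region {Δ : Trapezoid m n} {x y : ℝ} (h : A.Interior Δ x y) : A.Region Δ x y :=
  ⟨h.1.closed, h.2.strip⟩

theorem Spans.mem_Ioo {Δ : Trapezoid m n} {e : Fin n} {x : ℝ} (h : A.Spans e Δ)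
    (hx : A.OpenSlab Δ x) : x ∈ Ioo (A.X (A.lo e)) (A.X (A.hi e)) := by
  obtain ⟨⟨v, hv, h1⟩, w, hw, h2⟩ := h
  exact ⟨h1.trans_lt (hx.1 v hv), (hx.2 w hw).trans_le h2⟩

theorem Spans.mem_Icc {Δ : Trapezoid m n} {e : Fin n} {x : ℝ} (h : A.Spans e Δ)
    (hx : A.ClosedSlab Δ x) : x ∈ Icc (A.X (A.lo e)) (A.X (A.hi e)) := by
  obtain ⟨⟨v, hv, h1⟩, w, hw, h2⟩ := h
  exact ⟨h1.trans (hx.1 v hv), (hx.2 w hw).trans h2⟩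

theorem OpenSlab.of_le_of_le {Δ : Trapezoid m n} {x y z : ℝ} (hx : A.OpenSlab Δ x)
    (hz : A.OpenSlab Δ z) (h1 : x ≤ y) (h2 : y ≤ z) : A.OpenSlab Δ y :=
  ⟨fun v hv => (hx.1 v hv).trans_le h1, fun v hv => h2.trans_lt (hz.2 v hv)⟩

/-! ### Faces are determined by their interior points. -/

namespace IsFace

variable {R : Finset (Fin n)} {Δ Δ' : Trapezoid m n}

theorem bottom_lt_top (h : A.IsFace R Δ) {x : ℝ} (hx : A.OpenSlab Δ x) {b t : Fin n}
    (hb : b ∈ Δ.bottom) (ht : t ∈ Δ.top) : A.height b x < A.height t x := by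
  obtain ⟨x₀, y₀, h1, h2⟩ := h.interior
  have hb' := (h.bottom b hb).2
  have ht' := (h.top t ht).2
  exact height_lt_of_lt (Ioo_subset_Icc_self (hb'.mem_Ioo h1)) (Ioo_subset_Icc_self (ht'.mem_Ioo h1))
    ((h2.1 b hb).trans (h2.2 t ht)) (hb'.mem_Ioo hx) (ht'.mem_Ioo hx)

theorem left_closed (h : A.IsFace R Δ) {v : Fin m} (hv : v ∈ Δ.left) : A.ClosedSlab Δ (A.X v) := by
  obtain ⟨x₀, y₀, h1, -⟩ := h.interior
  refine ⟨fun w hw => ?_, fun w hw => ((h1.1 v hv).trans (h1.2 w hw)).le⟩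
  rw [Option.mem_unique hv hw]

theorem right_closed (h : A.IsFace R Δ) {v : Fin m} (hv : v ∈ Δ.right) :
    A.ClosedSlab Δ (A.X v) := by
  obtain ⟨x₀, y₀, h1, -⟩ := h.interior
  refine ⟨fun w hw => ((h1.1 w hw).trans (h1.2 v hv)).le, fun w hw => ?_⟩
  rw [Option.mem_unique hv hw]

theorem between_of_not_incident (h : A.IsFace R Δ) {v : Fin m} (hs : A.ClosedSlab Δ (A.X v))
    (hv : A.Strip Δ (A.X v) (A.Y v))
    (hb : ∀ b ∈ Δ.bottom, ¬ (v = A.lo b ∨ v = A.hi b))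
    (ht : ∀ t ∈ Δ.top, ¬ (v = A.lo t ∨ v = A.hi t)) : A.Between Δ (A.X v) (A.Y v) :=
  ⟨fun b hb' => lt_of_le_of_ne (hv.1 b hb') fun h0 =>
      hb b hb' (A.vertex_on_edge v b ((h.bottom b hb').2.mem_Icc hs) h0),
    fun t ht' => lt_of_le_of_ne (hv.2 t ht') fun h0 =>
      ht t ht' (A.vertex_on_edge v t ((h.top t ht').2.mem_Icc hs) h0.symm)⟩

/-- No vertex of `R` lies in the strip of a face strictly between its walls. -/
theorem no_vertex (h : A.IsFace R Δ) {v : Fin m} {g : Fin n} (hg : g ∈ R)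
    (hvg : v = A.lo g ∨ v = A.hi g) (hs : A.OpenSlab Δ (A.X v))
    (hv : A.Strip Δ (A.X v) (A.Y v)) : False := by
  have not_inc : ∀ b : Fin n, A.Spans b Δ → ¬ (v = A.lo b ∨ v = A.hi b) := by
    rintro b hb (rfl | rfl)
    · exact lt_irrefl _ (hb.mem_Ioo hs).1
    · exact lt_irrefl _ (hb.mem_Ioo hs).2
  have hI : A.Interior Δ (A.X v) (A.height g (A.X v)) := by
    rw [height_vertex hvg]
    exact ⟨hs, h.between_of_not_incident hs.closed hv (fun b hb => not_inc b (h.bottom b hb).2)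
      fun t ht => not_inc t (h.top t ht).2⟩
  -- The interior is open, so `g` stays in it when it leaves `v` into its own slab; then `g` cuts
  -- the face.
  have hev : ∀ᶠ x in 𝓝 (A.X v), A.Interior Δ x (A.height g x) :=
    ((isOpen_interior Δ).preimage (continuous_id.prodMk (continuous_height g))).mem_nhds hI
  have hlt := A.lo_lt_hi g
  obtain ⟨x, hx, hx'⟩ : ∃ x, x ∈ Ioo (A.X (A.lo g)) (A.X (A.hi g)) ∧
      A.Interior Δ x (A.height g x) := by
    rcases hvg with rfl | rfl
    · exact (Filter.Eventually.and (Ioo_mem_nhdsGT hlt) (nhdsWithin_le_nhds hev)).exists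
    · exact (Filter.Eventually.and (Ioo_mem_nhdsLT hlt) (nhdsWithin_le_nhds hev)).exists
  exact h.empty g hg ⟨x, hx, hx'⟩

/-- Otherwise `b` would pass between the bottom of `Δ'` and an interior point and cut `Δ'`. Thus the
bottom of a face is the highest edge of `R` below any of its interior points. -/
theorem bottom_le_bottom (h' : A.IsFace R Δ') {b : Fin n}
    (hb : b ∈ R) {x y : ℝ} (hbx : x ∈ Ioo (A.X (A.lo b)) (A.X (A.hi b)))
    (hx : A.Interior Δ' x y) (hy : A.height b x < y) :
    ∃ b' ∈ Δ'.bottom, A.height b x ≤ A.height b' x := by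
  by_contra! hc
  exact h'.empty b hb ⟨x, hbx, hx.1, hc, fun t ht => hy.trans (hx.2.2 t ht)⟩

theorem top_le_top (h' : A.IsFace R Δ') {b : Fin n}
    (hb : b ∈ R) {x y : ℝ} (hbx : x ∈ Ioo (A.X (A.lo b)) (A.X (A.hi b)))
    (hx : A.Interior Δ' x y) (hy : y < A.height b x) :
    ∃ b' ∈ Δ'.top, A.height b' x ≤ A.height b x := by
  by_contra! hc
  exact h'.empty b hb ⟨x, hbx, hx.1, fun t ht => (hx.2.1 t ht).trans hy, hc⟩

theorem bottom_subset (h : A.IsFace R Δ) (h' : A.IsFace R Δ') {x y : ℝ} (hx : A.Interior Δ x y)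
    (hx' : A.Interior Δ' x y) {b : Fin n} (hb : b ∈ Δ.bottom) : b ∈ Δ'.bottom := by
  have hbx := (h.bottom b hb).2.mem_Ioo hx.1
  obtain ⟨b', hb', hle⟩ := h'.bottom_le_bottom (h.bottom b hb).1 hbx hx' (hx.2.1 b hb)
  have hbx' := (h'.bottom b' hb').2.mem_Ioo hx'.1
  obtain ⟨b'', hb'', hle'⟩ := h.bottom_le_bottom (h'.bottom b' hb').1 hbx' hx (hx'.2.1 b' hb')
  rw [Option.mem_unique hb'' hb] at hle'
  rwa [eq_of_height_eq hbx (Ioo_subset_Icc_self hbx') (le_antisymm hle hle')]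

theorem top_subset (h : A.IsFace R Δ) (h' : A.IsFace R Δ') {x y : ℝ} (hx : A.Interior Δ x y)
    (hx' : A.Interior Δ' x y) {b : Fin n} (hb : b ∈ Δ.top) : b ∈ Δ'.top := by
  have hbx := (h.top b hb).2.mem_Ioo hx.1
  obtain ⟨b', hb', hle⟩ := h'.top_le_top (h.top b hb).1 hbx hx' (hx.2.2 b hb)
  have hbx' := (h'.top b' hb').2.mem_Ioo hx'.1
  obtain ⟨b'', hb'', hle'⟩ := h.top_le_top (h'.top b' hb').1 hbx' hx (hx'.2.2 b' hb')
  rw [Option.mem_unique hb'' hb] at hle'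
  rwa [eq_of_height_eq hbx (Ioo_subset_Icc_self hbx') (le_antisymm hle' hle)]

/-- A left wall of `Δ` to the right of that of `Δ'` would put a vertex of `R` strictly between the
walls of `Δ'`, against `no_vertex`; the common floors make the two strips equal. -/
theorem left_subset (h : A.IsFace R Δ) (h' : A.IsFace R Δ') {x y : ℝ} (hx : A.Interior Δ x y)
    (hx' : A.Interior Δ' x y) (hb : Δ.bottom = Δ'.bottom) (ht : Δ.top = Δ'.top)
    {v : Fin m} (hv : v ∈ Δ.left) : ∃ w ∈ Δ'.left, A.X v ≤ A.X w := by
  by_contra! hc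
  obtain ⟨⟨g, hg, hvg⟩, hs⟩ := h.left v hv
  refine h'.no_vertex hg hvg ⟨hc, fun w hw => (hx.1.1 v hv).trans (hx'.1.2 w hw)⟩ ?_
  unfold Strip at hs ⊢
  rwa [← hb, ← ht]

theorem right_subset (h : A.IsFace R Δ) (h' : A.IsFace R Δ') {x y : ℝ} (hx : A.Interior Δ x y)
    (hx' : A.Interior Δ' x y) (hb : Δ.bottom = Δ'.bottom) (ht : Δ.top = Δ'.top)
    {v : Fin m} (hv : v ∈ Δ.right) : ∃ w ∈ Δ'.right, A.X w ≤ A.X v := by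
  by_contra! hc
  obtain ⟨⟨g, hg, hvg⟩, hs⟩ := h.right v hv
  refine h'.no_vertex hg hvg ⟨fun w hw => (hx'.1.1 w hw).trans (hx.1.2 v hv), hc⟩ ?_
  unfold Strip at hs ⊢
  rwa [← hb, ← ht]

/-- Two faces whose interiors intersect are equal. -/
theorem eq_of_interior (h : A.IsFace R Δ) (h' : A.IsFace R Δ') {x y : ℝ} (hx : A.Interior Δ x y)
    (hx' : A.Interior Δ' x y) : Δ = Δ' := by
  have hb : Δ.bottom = Δ'.bottom :=
    Option.ext fun b => ⟨h.bottom_subset h' hx hx', h'.bottom_subset h hx' hx⟩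
  have ht : Δ.top = Δ'.top :=
    Option.ext fun b => ⟨h.top_subset h' hx hx', h'.top_subset h hx' hx⟩
  have aux : ∀ {o o' : Option (Fin m)}, (∀ v ∈ o, ∃ w ∈ o', A.X v ≤ A.X w) →
      (∀ v ∈ o', ∃ w ∈ o, A.X v ≤ A.X w) → ∀ v ∈ o, v ∈ o' := by
    intro o o' h1 h2 v hv
    obtain ⟨w, hw, hvw⟩ := h1 v hv
    obtain ⟨u, hu, hwu⟩ := h2 w hw
    rw [Option.mem_unique hu hv] at hwu
    rwa [A.X_injective (le_antisymm hvw hwu)]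
  have aux' : ∀ {o o' : Option (Fin m)}, (∀ v ∈ o, ∃ w ∈ o', A.X w ≤ A.X v) →
      (∀ v ∈ o', ∃ w ∈ o, A.X w ≤ A.X v) → ∀ v ∈ o, v ∈ o' := by
    intro o o' h1 h2 v hv
    obtain ⟨w, hw, hvw⟩ := h1 v hv
    obtain ⟨u, hu, hwu⟩ := h2 w hw
    rw [Option.mem_unique hu hv] at hwu
    rwa [A.X_injective (le_antisymm hwu hvw)]
  have hl1 := fun v hv => h.left_subset h' hx hx' hb ht (v := v) hv
  have hl2 := fun v hv => h'.left_subset h hx' hx hb.symm ht.symm (v := v) hv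
  have hr1 := fun v hv => h.right_subset h' hx hx' hb ht (v := v) hv
  have hr2 := fun v hv => h'.right_subset h hx' hx hb.symm ht.symm (v := v) hv
  have hl : Δ.left = Δ'.left := Option.ext fun v => ⟨aux hl1 hl2 v, aux hl2 hl1 v⟩
  have hr : Δ.right = Δ'.right := Option.ext fun v => ⟨aux' hr1 hr2 v, aux' hr2 hr1 v⟩
  cases Δ
  cases Δ'
  rw [Trapezoid.mk.injEq]
  exact ⟨hb, ht, hl, hr⟩

/-- A point slightly above `b` is below both tops and hence interior to both faces. -/
theorem eq_of_bottom_eq (h : A.IsFace R Δ) (h' : A.IsFace R Δ') {x : ℝ} (hx : A.OpenSlab Δ x)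
    (hx' : A.OpenSlab Δ' x) {b : Fin n} (hb : b ∈ Δ.bottom) (hb' : b ∈ Δ'.bottom) : Δ = Δ' := by
  obtain ⟨y, hy, hy'⟩ := Order.exists_between_finsets {A.height b x}
    ((Δ.top.toFinset ∪ Δ'.top.toFinset).image fun t => A.height t x) (by
      simp only [Finset.mem_singleton, Finset.mem_image, Finset.mem_union, Option.mem_toFinset]
      rintro _ rfl _ ⟨t, ht | ht, rfl⟩
      · exact h.bottom_lt_top hx hb ht
      · exact h'.bottom_lt_top hx' hb' ht)
  simp only [Finset.mem_singleton, Finset.mem_image, Finset.mem_union, Option.mem_toFinset] at hy hy'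
  refine h.eq_of_interior h' (x := x) (y := y) ⟨hx, fun c hc => ?_, fun t ht => hy' _ ⟨t, .inl ht, rfl⟩⟩
    ⟨hx', fun c hc => ?_, fun t ht => hy' _ ⟨t, .inr ht, rfl⟩⟩
  · rw [Option.mem_unique hc hb]
    exact hy _ rfl
  · rw [Option.mem_unique hc hb']
    exact hy _ rfl

theorem eq_of_top_eq (h : A.IsFace R Δ) (h' : A.IsFace R Δ') {x : ℝ} (hx : A.OpenSlab Δ x)
    (hx' : A.OpenSlab Δ' x) {b : Fin n} (hb : b ∈ Δ.top) (hb' : b ∈ Δ'.top) : Δ = Δ' := by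
  obtain ⟨y, hy', hy⟩ := Order.exists_between_finsets
    ((Δ.bottom.toFinset ∪ Δ'.bottom.toFinset).image fun t => A.height t x) {A.height b x} (by
      simp only [Finset.mem_singleton, Finset.mem_image, Finset.mem_union, Option.mem_toFinset]
      rintro _ ⟨t, ht | ht, rfl⟩ _ rfl
      · exact h.bottom_lt_top hx ht hb
      · exact h'.bottom_lt_top hx' ht hb')
  simp only [Finset.mem_singleton, Finset.mem_image, Finset.mem_union, Option.mem_toFinset] at hy hy'
  refine h.eq_of_interior h' (x := x) (y := y) ⟨hx, fun t ht => hy' _ ⟨t, .inl ht, rfl⟩, fun c hc => ?_⟩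
    ⟨hx', fun t ht => hy' _ ⟨t, .inr ht, rfl⟩, fun c hc => ?_⟩
  · rw [Option.mem_unique hc hb]
    exact hy _ rfl
  · rw [Option.mem_unique hc hb']
    exact hy _ rfl

end IsFace

end Arrangement

/-! ### Existence of faces at generic points, and at all points by passing to the closure. -/

namespace Arrangement

variable {m n : ℕ} {A : Arrangement m n}

/-- The option allows for a missing extremum, which becomes a boundary at infinity in `exists_face`.
-/
theorem exists_option_max {α : Type*} (s : Finset α) (g : α → ℝ) :
    ∃ o : Option α, (∀ a ∈ o, a ∈ s) ∧ ∀ a ∈ s, ∃ b ∈ o, g a ≤ g b := by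
  rcases s.eq_empty_or_nonempty with rfl | hs
  · exact ⟨none, by simp, by simp⟩
  · obtain ⟨b, hb, h⟩ := s.exists_max_image g hs
    exact ⟨some b, by simpa using hb, fun a ha => ⟨b, rfl, h a ha⟩⟩

theorem exists_option_min {α : Type*} (s : Finset α) (g : α → ℝ) :
    ∃ o : Option α, (∀ a ∈ o, a ∈ s) ∧ ∀ a ∈ s, ∃ b ∈ o, g b ≤ g a := by
  obtain ⟨o, h1, h2⟩ := exists_option_max s fun a => -g a
  refine ⟨o, h1, fun a ha => ?_⟩
  obtain ⟨b, hb, h⟩ := h2 a ha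
  exact ⟨b, hb, neg_le_neg_iff.1 h⟩

/-- Every point in general position lies in the interior of a face. -/
theorem exists_face (R : Finset (Fin n)) {x y : ℝ} (hx : ∀ v, A.X v ≠ x)
    (hy : ∀ e, A.height e x ≠ y) : ∃ Δ, A.IsFace R Δ ∧ A.Interior Δ x y := by
  obtain ⟨ob, hbo, hbo'⟩ := exists_option_max
    (R.filter fun e => x ∈ Ioo (A.X (A.lo e)) (A.X (A.hi e)) ∧ A.height e x < y)
    fun e => A.height e x
  obtain ⟨ot, hto, hto'⟩ := exists_option_min
    (R.filter fun e => x ∈ Ioo (A.X (A.lo e)) (A.X (A.hi e)) ∧ y < A.height e x)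
    fun e => A.height e x
  simp only [Finset.mem_filter, and_imp] at hbo hbo' hto hto'
  -- Only vertices not left of the left ends of the chosen floors compete. The rightmost of these
  -- left ends is itself a competitor, which makes the floors reach the wall (`hL`).
  obtain ⟨le, hle, hle'⟩ := exists_option_max
    (Finset.univ.filter fun v => (∃ g ∈ R, v = A.lo g ∨ v = A.hi g) ∧ A.X v < x ∧
      (∀ b ∈ ob, A.X (A.lo b) ≤ A.X v ∧ A.height b (A.X v) ≤ A.Y v) ∧
      (∀ t ∈ ot, A.X (A.lo t) ≤ A.X v ∧ A.Y v ≤ A.height t (A.X v))) A.X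
  obtain ⟨ri, hri, hri'⟩ := exists_option_min
    (Finset.univ.filter fun v => (∃ g ∈ R, v = A.lo g ∨ v = A.hi g) ∧ x < A.X v ∧
      (∀ b ∈ ob, A.X v ≤ A.X (A.hi b) ∧ A.height b (A.X v) ≤ A.Y v) ∧
      (∀ t ∈ ot, A.X v ≤ A.X (A.hi t) ∧ A.Y v ≤ A.height t (A.X v))) A.X
  simp only [Finset.mem_filter, Finset.mem_univ, true_and] at hle hle' hri hri'
  have hbt : ∀ b ∈ ob, ∀ t ∈ ot, ∀ z, z ∈ Icc (A.X (A.lo b)) (A.X (A.hi b)) →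
      z ∈ Icc (A.X (A.lo t)) (A.X (A.hi t)) → A.height b z ≤ A.height t z := by
    intro b hb t ht z hzb hzt
    obtain ⟨-, h1, h2⟩ := hbo b hb
    obtain ⟨-, h3, h4⟩ := hto t ht
    exact height_le_of_lt (Ioo_subset_Icc_self h1) (Ioo_subset_Icc_self h3) (h2.trans h4) hzb hzt
  have hact : ∀ e, e ∈ ob ∨ e ∈ ot → e ∈ R ∧ x ∈ Ioo (A.X (A.lo e)) (A.X (A.hi e)) := by
    rintro e (h | h)
    · exact ⟨(hbo e h).1, (hbo e h).2.1⟩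
    · exact ⟨(hto e h).1, (hto e h).2.1⟩
  have hL : ∀ e, e ∈ ob ∨ e ∈ ot → ∃ v ∈ le, A.X (A.lo e) ≤ A.X v := by
    intro e he
    obtain ⟨c, hc, hmax⟩ := (ob.toFinset ∪ ot.toFinset).exists_max_image (fun e => A.X (A.lo e))
      ⟨e, by simpa using he⟩
    simp only [Finset.mem_union, Option.mem_toFinset] at hc hmax
    obtain ⟨hcR, hcx⟩ := hact c hc
    obtain ⟨w, hw, hcw⟩ : ∃ w ∈ le, A.X (A.lo c) ≤ A.X w := by
      refine hle' (A.lo c) ⟨⟨c, hcR, .inl rfl⟩, hcx.1, fun b hb => ⟨hmax b (.inl hb), ?_⟩,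
        fun t ht => ⟨hmax t (.inr ht), ?_⟩⟩
      · rcases hc with hc | hc
        · rw [Option.mem_unique hb hc, height_lo]
        · rw [← height_lo]
          exact hbt b hb c hc _ ⟨hmax b (.inl hb), (hcx.1.trans (hact b (.inl hb)).2.2).le⟩
            ⟨le_rfl, (A.lo_lt_hi c).le⟩
      · rcases hc with hc | hc
        · rw [← height_lo]
          exact hbt c hc t ht _ ⟨le_rfl, (A.lo_lt_hi c).le⟩
            ⟨hmax t (.inr ht), (hcx.1.trans (hact t (.inr ht)).2.2).le⟩
        · rw [Option.mem_unique ht hc, height_lo]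
    exact ⟨w, hw, (hmax e he).trans hcw⟩
  have hRi : ∀ e, e ∈ ob ∨ e ∈ ot → ∃ v ∈ ri, A.X v ≤ A.X (A.hi e) := by
    intro e he
    obtain ⟨c, hc, hmax⟩ := (ob.toFinset ∪ ot.toFinset).exists_min_image (fun e => A.X (A.hi e))
      ⟨e, by simpa using he⟩
    simp only [Finset.mem_union, Option.mem_toFinset] at hc hmax
    obtain ⟨hcR, hcx⟩ := hact c hc
    obtain ⟨w, hw, hcw⟩ : ∃ w ∈ ri, A.X w ≤ A.X (A.hi c) := by
      refine hri' (A.hi c) ⟨⟨c, hcR, .inr rfl⟩, hcx.2, fun b hb => ⟨hmax b (.inl hb), ?_⟩,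
        fun t ht => ⟨hmax t (.inr ht), ?_⟩⟩
      · rcases hc with hc | hc
        · rw [Option.mem_unique hb hc, height_hi]
        · rw [← height_hi]
          exact hbt b hb c hc _ ⟨((hact b (.inl hb)).2.1.trans hcx.2).le, hmax b (.inl hb)⟩
            ⟨(A.lo_lt_hi c).le, le_rfl⟩
      · rcases hc with hc | hc
        · rw [← height_hi]
          exact hbt c hc t ht _ ⟨(A.lo_lt_hi c).le, le_rfl⟩
            ⟨((hact t (.inr ht)).2.1.trans hcx.2).le, hmax t (.inr ht)⟩
        · rw [Option.mem_unique ht hc, height_hi]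
    exact ⟨w, hw, hcw.trans (hmax e he)⟩
  have hI : A.Interior ⟨ob, ot, le, ri⟩ x y :=
    ⟨⟨fun v hv => (hle v hv).2.1, fun v hv => (hri v hv).2.1⟩,
      fun b hb => (hbo b hb).2.2, fun t ht => (hto t ht).2.2⟩
  have hsp : ∀ e, e ∈ ob ∨ e ∈ ot → A.Spans e ⟨ob, ot, le, ri⟩ := fun e he => ⟨hL e he, hRi e he⟩
  refine ⟨⟨ob, ot, le, ri⟩, ⟨⟨x, y, hI⟩, fun e he => ⟨(hbo e he).1, hsp e (.inl he)⟩,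
    fun e he => ⟨(hto e he).1, hsp e (.inr he)⟩, fun v hv => ?_, fun v hv => ?_, ?_⟩, hI⟩
  · obtain ⟨h1, -, h2, h3⟩ := hle v hv
    exact ⟨h1, fun b hb => (h2 b hb).2, fun t ht => (h3 t ht).2⟩
  · obtain ⟨h1, -, h2, h3⟩ := hri v hv
    exact ⟨h1, fun b hb => (h2 b hb).2, fun t ht => (h3 t ht).2⟩
  · rintro e he ⟨z, hze, hz, hzb⟩
    have hb : ∀ b ∈ ob, z ∈ Ioo (A.X (A.lo b)) (A.X (A.hi b)) := fun b hb =>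
      (hsp b (.inl hb)).mem_Ioo hz
    have ht : ∀ t ∈ ot, z ∈ Ioo (A.X (A.lo t)) (A.X (A.hi t)) := fun t ht =>
      (hsp t (.inr ht)).mem_Ioo hz
    have hxb := fun b hb => (hact b (.inl hb)).2
    have hxt := fun t ht => (hact t (.inr ht)).2
    -- If a cutting edge ends between `z` and `x`, its endpoint competes for a wall and the wall
    -- would exclude `z`. Otherwise the edge passes over `x` between the chosen floors, against
    -- their extremality.
    rcases lt_or_gt_of_ne (hx (A.hi e)) with h1 | h1
    · obtain ⟨w, hw, hew⟩ : ∃ w ∈ le, A.X (A.hi e) ≤ A.X w := by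
        refine hle' (A.hi e) ⟨⟨e, he, .inr rfl⟩, h1, fun b hb' => ⟨?_, ?_⟩,
          fun t ht' => ⟨?_, ?_⟩⟩
        · exact ((hb b hb').1.trans hze.2).le
        · rw [← height_hi]
          exact height_le_of_lt (Ioo_subset_Icc_self (hb b hb')) (Ioo_subset_Icc_self hze)
            (hzb.1 b hb') ⟨((hb b hb').1.trans hze.2).le, (h1.trans (hxb b hb').2).le⟩
            ⟨(A.lo_lt_hi e).le, le_rfl⟩
        · exact ((ht t ht').1.trans hze.2).le
        · rw [← height_hi]
          exact height_le_of_lt (Ioo_subset_Icc_self hze) (Ioo_subset_Icc_self (ht t ht'))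
            (hzb.2 t ht') ⟨(A.lo_lt_hi e).le, le_rfl⟩
            ⟨((ht t ht').1.trans hze.2).le, (h1.trans (hxt t ht').2).le⟩
      exact absurd (hz.1 w hw) (not_lt.2 (hze.2.le.trans hew))
    rcases lt_or_gt_of_ne (hx (A.lo e)) with h2 | h2
    · rcases lt_or_gt_of_ne (hy e) with h3 | h3
      · obtain ⟨b, hb', hbe⟩ := hbo' e he ⟨h2, h1⟩ h3
        exact not_lt.2 hbe (height_lt_of_lt (Ioo_subset_Icc_self (hb b hb'))
          (Ioo_subset_Icc_self hze) (hzb.1 b hb') (hxb b hb') ⟨h2, h1⟩)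
      · obtain ⟨b, hb', hbe⟩ := hto' e he ⟨h2, h1⟩ h3
        exact not_lt.2 hbe (height_lt_of_lt (Ioo_subset_Icc_self hze)
          (Ioo_subset_Icc_self (ht b hb')) (hzb.2 b hb') ⟨h2, h1⟩ (hxt b hb'))
    · obtain ⟨w, hw, hew⟩ : ∃ w ∈ ri, A.X w ≤ A.X (A.lo e) := by
        refine hri' (A.lo e) ⟨⟨e, he, .inl rfl⟩, h2, fun b hb' => ⟨?_, ?_⟩,
          fun t ht' => ⟨?_, ?_⟩⟩
        · exact (hze.1.trans (hb b hb').2).le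
        · rw [← height_lo]
          exact height_le_of_lt (Ioo_subset_Icc_self (hb b hb')) (Ioo_subset_Icc_self hze)
            (hzb.1 b hb') ⟨((hxb b hb').1.trans h2).le, (hze.1.trans (hb b hb').2).le⟩
            ⟨le_rfl, (A.lo_lt_hi e).le⟩
        · exact (hze.1.trans (ht t ht').2).le
        · rw [← height_lo]
          exact height_le_of_lt (Ioo_subset_Icc_self hze) (Ioo_subset_Icc_self (ht t ht'))
            (hzb.2 t ht') ⟨le_rfl, (A.lo_lt_hi e).le⟩
            ⟨((hxt t ht').1.trans h2).le, (hze.1.trans (ht t ht').2).le⟩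
      exact absurd (hz.2 w hw) (not_lt.2 (hew.trans hze.1.le))

variable (A) in
/-- Points off all vertex abscissae and off all lines carrying edges. -/
def generic : Set (ℝ × ℝ) := {p | (∀ v, A.X v ≠ p.1) ∧ ∀ e, A.height e p.1 ≠ p.2}

theorem dense_generic : Dense A.generic := by
  have h : A.generic = ⋂ i : Fin m ⊕ Fin n,
      i.elim (fun v => {p | A.X v ≠ p.1}) fun e => {p | A.height e p.1 ≠ p.2} := by
    ext p
    simp [generic, Set.mem_iInter]
  rw [h]
  refine dense_iInter_of_isOpen ?_ ?_
  · rintro (v | e)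
    · exact isOpen_ne_fun continuous_const continuous_fst
    · exact isOpen_ne_fun ((continuous_height e).comp continuous_fst) continuous_snd
  · rintro (v | e)
    · intro p
      by_cases hp : A.X v = p.1
      · have ht : Tendsto (fun t : ℝ => (p.1 + t, p.2)) (𝓝[>] 0) (𝓝 p) := by
          have : Tendsto (fun t : ℝ => (p.1 + t, p.2)) (𝓝 0) (𝓝 (p.1 + 0, p.2)) :=
            Continuous.tendsto (by fun_prop) 0
          rw [add_zero] at this
          exact this.mono_left nhdsWithin_le_nhds
        refine mem_closure_of_tendsto ht (eventually_nhdsWithin_of_forall fun t ht0 => ?_)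
        have : 0 < t := ht0
        simp only [Sum.elim_inl, mem_ofPred_eq]
        linarith
      · exact subset_closure hp
    · intro p
      by_cases hp : A.height e p.1 = p.2
      · have ht : Tendsto (fun t : ℝ => (p.1, p.2 + t)) (𝓝[>] 0) (𝓝 p) := by
          have : Tendsto (fun t : ℝ => (p.1, p.2 + t)) (𝓝 0) (𝓝 (p.1, p.2 + 0)) :=
            Continuous.tendsto (by fun_prop) 0
          rw [add_zero] at this
          exact this.mono_left nhdsWithin_le_nhds
        refine mem_closure_of_tendsto ht (eventually_nhdsWithin_of_forall fun t ht0 => ?_)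
        have : 0 < t := ht0
        simp only [Sum.elim_inr, mem_ofPred_eq]
        linarith
      · exact subset_closure hp

theorem height_comb (e : Fin n) (t x c : ℝ) :
    A.height e ((1 - t) * x + t * c) = (1 - t) * A.height e x + t * A.height e c := by
  unfold height
  ring

/-- On the way from the given point to an interior point all defining inequalities, being affine,
are strict at once. -/
theorem Region.mem_closure_interior {Δ : Trapezoid m n} {x y : ℝ} (hΔ : ∃ x y, A.Interior Δ x y)
    (h : A.Region Δ x y) : (x, y) ∈ closure {p : ℝ × ℝ | A.Interior Δ p.1 p.2} := by
  obtain ⟨a, b, hab⟩ := hΔ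
  have ht : Tendsto (fun t : ℝ => ((1 - t) * x + t * a, (1 - t) * y + t * b)) (𝓝[>] 0)
      (𝓝 (x, y)) := by
    have : Tendsto (fun t : ℝ => ((1 - t) * x + t * a, (1 - t) * y + t * b)) (𝓝 0)
        (𝓝 ((1 - 0) * x + 0 * a, (1 - 0) * y + 0 * b)) :=
      Continuous.tendsto (by fun_prop) 0
    simp only [sub_zero, one_mul, zero_mul, add_zero] at this
    exact this.mono_left nhdsWithin_le_nhds
  refine mem_closure_of_tendsto ht (Filter.mem_of_superset (Ioo_mem_nhdsGT one_pos) ?_)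
  rintro t ⟨h0, h1⟩
  have comb : ∀ {p q r s : ℝ}, p ≤ q → r < s → (1 - t) * p + t * r < (1 - t) * q + t * s := by
    intro p q r s h2 h3
    have := mul_le_mul_of_nonneg_left h2 (sub_nonneg.2 h1.le)
    have := mul_lt_mul_of_pos_left h3 h0
    linarith
  have same : ∀ p : ℝ, (1 - t) * p + t * p = p := fun p => by ring
  refine ⟨⟨fun v hv => ?_, fun v hv => ?_⟩, fun e he => ?_, fun e he => ?_⟩
  · simpa only [same] using comb (h.1.1 v hv) (hab.1.1 v hv)
  · simpa only [same] using comb (h.1.2 v hv) (hab.1.2 v hv)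
  · simpa only [height_comb] using comb (h.2.1 e he) (hab.2.1 e he)
  · simpa only [height_comb] using comb (h.2.2 e he) (hab.2.2 e he)

/-- Every point of a trapezoid lies in a face whose interior intersects the trapezoid. -/
theorem Region.exists_face {Δ : Trapezoid m n} {x y : ℝ} (hΔ : ∃ x y, A.Interior Δ x y)
    (h : A.Region Δ x y) (R : Finset (Fin n)) :
    ∃ Δ', A.IsFace R Δ' ∧ (∃ x y, A.Interior Δ x y ∧ A.Interior Δ' x y) ∧ A.Region Δ' x y := by
  have h1 := h.mem_closure_interior hΔ
  have h2 := closure_minimal (dense_generic (A := A).open_subset_closure_inter (isOpen_interior Δ))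
    isClosed_closure h1
  have h3 : {p : ℝ × ℝ | A.Interior Δ p.1 p.2} ∩ A.generic ⊆
      ⋃ Δ' ∈ {Δ' | A.IsFace R Δ'}, {p : ℝ × ℝ | A.Interior Δ p.1 p.2 ∧ A.Interior Δ' p.1 p.2} := by
    rintro p ⟨hp, hg⟩
    obtain ⟨Δ', hf, hi⟩ := Arrangement.exists_face R hg.1 hg.2
    exact mem_biUnion (show Δ' ∈ {Δ' | A.IsFace R Δ'} from hf) ⟨hp, hi⟩
  have h4 := closure_mono h3 h2
  -- There are finitely many trapezoids, so closure commutes with the union and a single face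
  -- accumulates at the point.
  rw [(Set.toFinite _).closure_biUnion, mem_iUnion₂] at h4
  obtain ⟨Δ', hf, hc⟩ := h4
  refine ⟨Δ', hf, ?_, ?_⟩
  · obtain ⟨p, hp⟩ := closure_nonempty_iff.1 ⟨_, hc⟩
    exact ⟨p.1, p.2, hp⟩
  · exact closure_minimal (fun p hp => hp.2.region) (isClosed_region Δ') hc

/-- Every point of an edge lies on the top boundary of a face. -/
theorem exists_face_top {R : Finset (Fin n)} {e : Fin n} (he : e ∈ R) {x : ℝ}
    (hx : x ∈ Icc (A.X (A.lo e)) (A.X (A.hi e))) :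
    ∃ Δ, A.IsFace R Δ ∧ e ∈ Δ.top ∧ A.Region Δ x (A.height e x) := by
  have hd : Dense (Set.range A.X)ᶜ := (Set.finite_range A.X).countable.dense_compl ℝ
  have h1 := hd.open_subset_closure_inter (isOpen_Ioo (a := A.X (A.lo e)) (b := A.X (A.hi e)))
  rw [← closure_Ioo (A.lo_lt_hi e).ne] at hx
  have h2 := closure_minimal h1 isClosed_closure hx
  have h3 : Ioo (A.X (A.lo e)) (A.X (A.hi e)) ∩ (Set.range A.X)ᶜ ⊆
      ⋃ Δ ∈ {Δ | A.IsFace R Δ ∧ e ∈ Δ.top}, {z | A.OpenSlab Δ z} := by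
    rintro z ⟨hz, hz'⟩
    -- The ordinate is so close below `e` that no line is in between; the face at this point must
    -- have `e` as its top.
    obtain ⟨y, hy, hy'⟩ := Order.exists_between_finsets
      ((Finset.univ.filter fun d => A.height d z < A.height e z).image fun d => A.height d z)
      {A.height e z} (by simp)
    simp only [Finset.mem_image, Finset.mem_filter, Finset.mem_univ, true_and,
      Finset.mem_singleton, forall_exists_index, and_imp, forall_apply_eq_imp_iff₂,
      forall_eq] at hy hy'
    obtain ⟨Δ, hf, hI⟩ := exists_face (A := A) R (x := z) (y := y) (fun v hv => hz' ⟨v, hv⟩) (by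
      intro d hd
      rcases lt_or_ge (A.height d z) (A.height e z) with h | h
      · exact (hy d h).ne hd
      · exact absurd (h.trans hd.le) (not_le.2 hy'))
    obtain ⟨t, ht, hte⟩ := hf.top_le_top he hz hI hy'
    have htz := (hf.top t ht).2.mem_Ioo hI.1
    have : A.height t z = A.height e z := by
      refine hte.antisymm (not_lt.1 fun hlt => ?_)
      exact lt_asymm (hy t hlt) (hI.2.2 t ht)
    rw [eq_of_height_eq htz (Ioo_subset_Icc_self hz) this] at ht
    exact mem_biUnion (show Δ ∈ {Δ | A.IsFace R Δ ∧ e ∈ Δ.top} from ⟨hf, ht⟩) hI.1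
  have h4 := closure_mono h3 h2
  rw [(Set.toFinite _).closure_biUnion, mem_iUnion₂] at h4
  obtain ⟨Δ, ⟨hf, ht⟩, hc⟩ := h4
  refine ⟨Δ, hf, ht, ?_⟩
  have hcl : IsClosed {z | A.Region Δ z (A.height e z)} :=
    (isClosed_region Δ).preimage (continuous_id.prodMk (continuous_height e))
  refine closure_minimal (fun z hz => ?_) hcl hc
  exact ⟨OpenSlab.closed hz, fun b hb => (hf.bottom_lt_top hz hb ht).le,
    fun t ht' => by rw [Option.mem_unique ht ht']⟩

end Arrangement

/-! ### Charging arguments: the children of a node and the zone of a query segment. -/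

/-- Every element is charged to the exceptional label or to a pair of a kind and an object of `E`,
and each label is charged at most once. The combinatorial constants 7, 14 and 5 come from lists of
kinds. -/
theorem card_le_of_kinds {α β κ : Type*} [Fintype κ] (F : Finset α) (E : Finset β)
    (P₀ : α → Prop) (P : κ → β → α → Prop)
    (h₀ : ∀ x ∈ F, ∀ y ∈ F, P₀ x → P₀ y → x = y)
    (h : ∀ k b, ∀ x ∈ F, ∀ y ∈ F, P k b x → P k b y → x = y)
    (hF : ∀ x ∈ F, P₀ x ∨ ∃ k, ∃ b ∈ E, P k b x) :
    F.card ≤ 1 + Fintype.card κ * E.card := by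
  have hsub : F ⊆ F.filter P₀ ∪
      (Finset.univ ×ˢ E : Finset (κ × β)).biUnion fun i => F.filter (P i.1 i.2) := by
    intro x hx
    simp only [Finset.mem_union, Finset.mem_filter, Finset.mem_biUnion, Finset.mem_product,
      Finset.mem_univ, true_and, Prod.exists]
    rcases hF x hx with h1 | ⟨k, b, hb, h1⟩
    · exact .inl ⟨hx, h1⟩
    · exact .inr ⟨k, b, hb, hx, h1⟩
  refine (Finset.card_le_card hsub).trans ((Finset.card_union_le _ _).trans (add_le_add ?_ ?_))
  · refine Finset.card_le_one.2 fun x hx y hy => ?_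
    rw [Finset.mem_filter] at hx hy
    exact h₀ x hx.1 y hy.1 hx.2 hy.2
  · refine Finset.card_biUnion_le.trans ?_
    refine (Finset.sum_le_card_nsmul _ _ 1 fun i _ => ?_).trans ?_
    · refine Finset.card_le_one.2 fun x hx y hy => ?_
      rw [Finset.mem_filter] at hx hy
      exact h i.1 i.2 x hx.1 y hy.1 hx.2 hy.2
    · simp [Finset.card_product]

/-- The vertex defining the left (`false`) or right (`true`) wall. -/
def Trapezoid.wall {m n : ℕ} (Δ : Trapezoid m n) : Bool → Option (Fin m)
  | false => Δ.left
  | true => Δ.right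

/-- The edge carrying the bottom (`false`) or top (`true`) boundary. -/
def Trapezoid.floor {m n : ℕ} (Δ : Trapezoid m n) : Bool → Option (Fin n)
  | false => Δ.bottom
  | true => Δ.top

namespace Arrangement

variable {m n : ℕ} {A : Arrangement m n}

variable (A) in
/-- The endpoints of an edge. -/
def vertex (e : Fin n) : Bool → Fin m
  | false => A.lo e
  | true => A.hi e

theorem incident_iff {v : Fin m} {e : Fin n} :
    (v = A.lo e ∨ v = A.hi e) ↔ ∃ u, A.vertex e u = v := by
  simp [vertex, eq_comm]

namespace IsFace

variable {R : Finset (Fin n)} {Δ Δ' : Trapezoid m n}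

theorem openSlab_right_of_left (h : A.IsFace R Δ) {v : Fin m} (hv : v ∈ Δ.left) :
    ∀ᶠ x in 𝓝[>] A.X v, A.OpenSlab Δ x := by
  obtain ⟨x₀, y₀, h1, -⟩ := h.interior
  filter_upwards [Ioo_mem_nhdsGT (h1.1 v hv)] with x hx
  refine ⟨fun w hw => ?_, fun w hw => hx.2.trans (h1.2 w hw)⟩
  rw [Option.mem_unique hw hv]
  exact hx.1

theorem openSlab_left_of_right (h : A.IsFace R Δ) {v : Fin m} (hv : v ∈ Δ.right) :
    ∀ᶠ x in 𝓝[<] A.X v, A.OpenSlab Δ x := by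
  obtain ⟨x₀, y₀, h1, -⟩ := h.interior
  filter_upwards [Ioo_mem_nhdsLT (h1.2 v hv)] with x hx
  refine ⟨fun w hw => (h1.1 w hw).trans hx.1, fun w hw => ?_⟩
  rw [Option.mem_unique hw hv]
  exact hx.2

/-- Faces on the same side of a common wall vertex share abscissae arbitrarily near it, so a
condition that is open at the vertex can be imposed as well. -/
theorem openSlab_near_wall (h : A.IsFace R Δ) (h' : A.IsFace R Δ') {s : Bool} {v : Fin m}
    (hv : v ∈ Δ.wall s) (hv' : v ∈ Δ'.wall s) {p : ℝ → Prop} (hp : ∀ᶠ x in 𝓝 (A.X v), p x) :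
    ∃ x, A.OpenSlab Δ x ∧ A.OpenSlab Δ' x ∧ p x := by
  cases s
  · exact ((h.openSlab_right_of_left hv).and
      ((h'.openSlab_right_of_left hv').and (nhdsWithin_le_nhds hp))).exists
  · exact ((h.openSlab_left_of_right hv).and
      ((h'.openSlab_left_of_right hv').and (nhdsWithin_le_nhds hp))).exists

theorem eq_of_floor_eq (h : A.IsFace R Δ) (h' : A.IsFace R Δ') {x : ℝ} (hx : A.OpenSlab Δ x)
    (hx' : A.OpenSlab Δ' x) {b : Fin n} {u : Bool} (hb : b ∈ Δ.floor u) (hb' : b ∈ Δ'.floor u) :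
    Δ = Δ' := by
  cases u
  · exact h.eq_of_bottom_eq h' hx hx' hb hb'
  · exact h.eq_of_top_eq h' hx hx' hb hb'

theorem wall_spec (h : A.IsFace R Δ) {s : Bool} {v : Fin m} (hv : v ∈ Δ.wall s) :
    (∃ e ∈ R, v = A.lo e ∨ v = A.hi e) ∧ A.Region Δ (A.X v) (A.Y v) := by
  cases s
  · exact ⟨(h.left v hv).1, h.left_closed hv, (h.left v hv).2⟩
  · exact ⟨(h.right v hv).1, h.right_closed hv, (h.right v hv).2⟩

theorem floor_spec (h : A.IsFace R Δ) {u : Bool} {e : Fin n} (he : e ∈ Δ.floor u) :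
    e ∈ R ∧ A.Spans e Δ := by
  cases u
  · exact h.bottom e he
  · exact h.top e he

theorem eq_of_wall_eq_of_floor_eq (h : A.IsFace R Δ) (h' : A.IsFace R Δ') {s u : Bool} {v : Fin m}
    (hv : v ∈ Δ.wall s) (hv' : v ∈ Δ'.wall s) {b : Fin n} (hb : b ∈ Δ.floor u)
    (hb' : b ∈ Δ'.floor u) : Δ = Δ' := by
  obtain ⟨x, hx, hx', -⟩ := h.openSlab_near_wall h' hv hv' (p := fun _ => True) (by simp)
  exact h.eq_of_floor_eq h' hx hx' hb hb'

theorem isOpen_between (Δ : Trapezoid m n) (y : ℝ) : IsOpen {x | A.Between Δ x y} :=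
  (isOpen_forall_mem_option _ fun b => isOpen_lt (continuous_height b) continuous_const).inter
    (isOpen_forall_mem_option _ fun t => isOpen_lt continuous_const (continuous_height t))

theorem eq_of_wall_eq_of_between (h : A.IsFace R Δ) (h' : A.IsFace R Δ') {s : Bool} {v : Fin m}
    (hv : v ∈ Δ.wall s) (hv' : v ∈ Δ'.wall s) (hb : A.Between Δ (A.X v) (A.Y v))
    (hb' : A.Between Δ' (A.X v) (A.Y v)) : Δ = Δ' := by
  obtain ⟨x, hx, hx', h1, h2⟩ := h.openSlab_near_wall h' hv hv'
    (Filter.Eventually.and ((isOpen_between Δ (A.Y v)).mem_nhds hb)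
      ((isOpen_between Δ' (A.Y v)).mem_nhds hb'))
  exact h.eq_of_interior h' ⟨hx, h1⟩ ⟨hx', h2⟩

theorem between_of_wall (h : A.IsFace R Δ) {s : Bool} {v : Fin m} (hv : v ∈ Δ.wall s)
    (hn : ∀ u, ∀ b ∈ Δ.floor u, ¬ (v = A.lo b ∨ v = A.hi b)) :
    A.Between Δ (A.X v) (A.Y v) :=
  h.between_of_not_incident (h.wall_spec hv).2.1 (h.wall_spec hv).2.2 (hn false) (hn true)

/-- A face created by the insertion of `e` has `e` or an endpoint of `e` on its boundary. -/
theorem created_cases {e : Fin n} (h : A.IsFace (insert e R) Δ) (h' : ¬ A.IsFace R Δ) :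
    (∃ u, e ∈ Δ.floor u) ∨
      ∃ s u, A.vertex e u ∈ Δ.wall s ∧ A.Between Δ (A.X (A.vertex e u)) (A.Y (A.vertex e u)) := by
  by_contra! hc
  obtain ⟨h1, h2⟩ := hc
  have hf : ∀ u, ∀ b ∈ Δ.floor u, b ∈ R := fun u b hb =>
    (Finset.mem_insert.1 (h.floor_spec hb).1).resolve_left fun h0 => h1 u (h0 ▸ hb)
  have hw : ∀ s, ∀ v ∈ Δ.wall s, ∃ g ∈ R, v = A.lo g ∨ v = A.hi g := by
    intro s v hv
    by_contra! hn
    obtain ⟨g, hg, hvg⟩ := (h.wall_spec hv).1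
    rcases Finset.mem_insert.1 hg with rfl | hg
    · obtain ⟨u, rfl⟩ := incident_iff.1 hvg
      -- No edge of `R` ends at this vertex, while the floors belong to `R`; so the vertex lies on
      -- neither floor.
      refine h2 s u hv (h.between_of_wall hv fun u' b hb hb' => ?_)
      have := hn b (hf u' b hb)
      tauto
    · have := hn g hg
      tauto
  exact h' ⟨h.interior, fun b hb => ⟨hf false b hb, (h.bottom b hb).2⟩,
    fun b hb => ⟨hf true b hb, (h.top b hb).2⟩, fun v hv => ⟨hw false v hv, (h.left v hv).2⟩,
    fun v hv => ⟨hw true v hv, (h.right v hv).2⟩,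
    fun g hg => h.empty g (Finset.mem_insert_of_mem hg)⟩

/-- If two faces resting on `e` were separated, the right wall of the first would come from a vertex
of `R` above `e` and below the top of `Δ`, at an abscissa inside the slab of `Δ₀`. That top is no
higher than the top of `Δ₀`, so the vertex would lie in `Δ₀`, against `no_vertex`. -/
theorem eq_of_bottom_of_le {e : Fin n} {Δ₀ : Trapezoid m n} (h₀ : A.IsFace R Δ₀)
    (hcut : A.Cuts e Δ₀) (h : A.IsFace (insert e R) Δ) (h' : A.IsFace (insert e R) Δ')
    (hb : e ∈ Δ.bottom) (hb' : e ∈ Δ'.bottom) {x y x' : ℝ} (hI₀ : A.Interior Δ₀ x y)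
    (hI : A.Interior Δ x y) (hs₀ : A.OpenSlab Δ₀ x') (hs' : A.OpenSlab Δ' x') (hxx' : x ≤ x') :
    Δ = Δ' := by
  by_contra hne
  have hn : ¬ A.OpenSlab Δ x' := fun hx => hne (h.eq_of_bottom_eq h' hx hs' hb hb')
  obtain ⟨v, hv, hvx'⟩ : ∃ v ∈ Δ.right, A.X v ≤ x' := by
    by_contra! hc
    exact hn ⟨fun v hv => (hI.1.1 v hv).trans_le hxx', hc⟩
  have hxv : x < A.X v := hI.1.2 v hv
  obtain ⟨⟨g, hg, hvg⟩, hst⟩ := h.right v hv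
  have hve : A.X v ∈ Ioo (A.X (A.lo e)) (A.X (A.hi e)) :=
    ⟨((h.bottom e hb).2.mem_Ioo hI.1).1.trans hxv,
      hvx'.trans_lt ((h'.bottom e hb').2.mem_Ioo hs').2⟩
  have hvne : ¬ (v = A.lo e ∨ v = A.hi e) := by
    rintro (h0 | h0)
    · exact hve.1.ne' (congrArg A.X h0)
    · exact hve.2.ne (congrArg A.X h0)
  have hgR : g ∈ R := (Finset.mem_insert.1 hg).resolve_left fun h0 => hvne (h0 ▸ hvg)
  have hs₀v : A.OpenSlab Δ₀ (A.X v) := OpenSlab.of_le_of_le hI₀.1 hs₀ hxv.le hvx'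
  obtain ⟨z, hze, hz, hzb⟩ := hcut
  refine h₀.no_vertex hgR hvg hs₀v ⟨fun b hb₀ => ?_, fun t ht₀ => ?_⟩
  · have hspan := (h₀.bottom b hb₀).2
    exact (height_lt_of_lt (Ioo_subset_Icc_self (hspan.mem_Ioo hz)) (Ioo_subset_Icc_self hze)
      (hzb.1 b hb₀) (hspan.mem_Ioo hs₀v) hve).le.trans (hst.1 e hb)
  · have hspan := (h₀.top t ht₀).2
    obtain ⟨t', ht', hle⟩ := h.top_le_top (Finset.mem_insert_of_mem (h₀.top t ht₀).1)
      (hspan.mem_Ioo hI₀.1) hI (hI₀.2.2 t ht₀)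
    have hspan' := (h.top t' ht').2
    refine (hst.2 t' ht').trans ?_
    rcases hle.lt_or_eq with hlt | heq
    · exact height_le_of_lt (Ioo_subset_Icc_self (hspan'.mem_Ioo hI.1))
        (Ioo_subset_Icc_self (hspan.mem_Ioo hI₀.1)) hlt (hspan'.mem_Icc (h.right_closed hv))
        (Ioo_subset_Icc_self (hspan.mem_Ioo hs₀v))
    · rw [eq_of_height_eq (hspan'.mem_Ioo hI.1) (Ioo_subset_Icc_self (hspan.mem_Ioo hI₀.1)) heq]

theorem eq_of_top_of_le {e : Fin n} {Δ₀ : Trapezoid m n} (h₀ : A.IsFace R Δ₀)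
    (hcut : A.Cuts e Δ₀) (h : A.IsFace (insert e R) Δ) (h' : A.IsFace (insert e R) Δ')
    (hb : e ∈ Δ.top) (hb' : e ∈ Δ'.top) {x y x' : ℝ} (hI₀ : A.Interior Δ₀ x y)
    (hI : A.Interior Δ x y) (hs₀ : A.OpenSlab Δ₀ x') (hs' : A.OpenSlab Δ' x') (hxx' : x ≤ x') :
    Δ = Δ' := by
  by_contra hne
  have hn : ¬ A.OpenSlab Δ x' := fun hx => hne (h.eq_of_top_eq h' hx hs' hb hb')
  obtain ⟨v, hv, hvx'⟩ : ∃ v ∈ Δ.right, A.X v ≤ x' := by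
    by_contra! hc
    exact hn ⟨fun v hv => (hI.1.1 v hv).trans_le hxx', hc⟩
  have hxv : x < A.X v := hI.1.2 v hv
  obtain ⟨⟨g, hg, hvg⟩, hst⟩ := h.right v hv
  have hve : A.X v ∈ Ioo (A.X (A.lo e)) (A.X (A.hi e)) :=
    ⟨((h.top e hb).2.mem_Ioo hI.1).1.trans hxv,
      hvx'.trans_lt ((h'.top e hb').2.mem_Ioo hs').2⟩
  have hvne : ¬ (v = A.lo e ∨ v = A.hi e) := by
    rintro (h0 | h0)
    · exact hve.1.ne' (congrArg A.X h0)
    · exact hve.2.ne (congrArg A.X h0)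
  have hgR : g ∈ R := (Finset.mem_insert.1 hg).resolve_left fun h0 => hvne (h0 ▸ hvg)
  have hs₀v : A.OpenSlab Δ₀ (A.X v) := OpenSlab.of_le_of_le hI₀.1 hs₀ hxv.le hvx'
  obtain ⟨z, hze, hz, hzb⟩ := hcut
  refine h₀.no_vertex hgR hvg hs₀v ⟨fun t ht₀ => ?_, fun b hb₀ => ?_⟩
  · have hspan := (h₀.bottom t ht₀).2
    obtain ⟨t', ht', hle⟩ := h.bottom_le_bottom (Finset.mem_insert_of_mem (h₀.bottom t ht₀).1)
      (hspan.mem_Ioo hI₀.1) hI (hI₀.2.1 t ht₀)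
    have hspan' := (h.bottom t' ht').2
    refine le_trans ?_ (hst.1 t' ht')
    rcases hle.lt_or_eq with hlt | heq
    · exact height_le_of_lt (Ioo_subset_Icc_self (hspan.mem_Ioo hI₀.1))
        (Ioo_subset_Icc_self (hspan'.mem_Ioo hI.1)) hlt
        (Ioo_subset_Icc_self (hspan.mem_Ioo hs₀v)) (hspan'.mem_Icc (h.right_closed hv))
    · rw [eq_of_height_eq (hspan.mem_Ioo hI₀.1) (Ioo_subset_Icc_self (hspan'.mem_Ioo hI.1)) heq]
  · have hspan := (h₀.top b hb₀).2
    exact (hst.2 e hb).trans (height_lt_of_lt (Ioo_subset_Icc_self hze)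
      (Ioo_subset_Icc_self (hspan.mem_Ioo hz)) (hzb.2 b hb₀) hve (hspan.mem_Ioo hs₀v)).le

theorem eq_of_floor_of_overlap {e : Fin n} {Δ₀ : Trapezoid m n} (h₀ : A.IsFace R Δ₀)
    (hcut : A.Cuts e Δ₀) (h : A.IsFace (insert e R) Δ) (h' : A.IsFace (insert e R) Δ') {u : Bool}
    (hb : e ∈ Δ.floor u) (hb' : e ∈ Δ'.floor u)
    (hI : ∃ x y, A.Interior Δ₀ x y ∧ A.Interior Δ x y)
    (hI' : ∃ x y, A.Interior Δ₀ x y ∧ A.Interior Δ' x y) : Δ = Δ' := by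
  obtain ⟨x, y, h1, h2⟩ := hI
  obtain ⟨x', y', h1', h2'⟩ := hI'
  cases u <;> rcases le_total x x' with hx | hx
  · exact eq_of_bottom_of_le h₀ hcut h h' hb hb' h1 h2 h1'.1 h2'.1 hx
  · exact (eq_of_bottom_of_le h₀ hcut h' h hb' hb h1' h2' h1.1 h2.1 hx).symm
  · exact eq_of_top_of_le h₀ hcut h h' hb hb' h1 h2 h1'.1 h2'.1 hx
  · exact (eq_of_top_of_le h₀ hcut h' h hb' hb h1' h2' h1.1 h2.1 hx).symm

/-- A destroyed face overlaps a bounded number of created faces. -/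
theorem card_created_le {e : Fin n} {Δ₀ : Trapezoid m n} (h₀ : A.IsFace R Δ₀)
    (hcut : A.Cuts e Δ₀) (F : Finset (Trapezoid m n))
    (hF : ∀ Δ ∈ F, A.IsFace (insert e R) Δ ∧ ¬ A.IsFace R Δ ∧
      ∃ x y, A.Interior Δ₀ x y ∧ A.Interior Δ x y) : F.card ≤ 7 := by
  -- Six kinds: an end of `e` defines a wall (2 · 2), or `e` is a floor (2). The exceptional label
  -- is empty; its summand makes the bound seven.
  refine card_le_of_kinds (κ := (Bool × Bool) ⊕ Bool) F ({()} : Finset Unit) (fun _ => False)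
    (fun k _ Δ => match k with
      | .inl (s, u) => A.vertex e u ∈ Δ.wall s ∧
          A.Between Δ (A.X (A.vertex e u)) (A.Y (A.vertex e u))
      | .inr u => e ∈ Δ.floor u) (by simp) ?_ ?_
  · rintro (⟨s, u⟩ | u) - Δ hΔ Δ' hΔ' hk hk'
    · exact (hF Δ hΔ).1.eq_of_wall_eq_of_between (hF Δ' hΔ').1 hk.1 hk'.1 hk.2 hk'.2
    · exact eq_of_floor_of_overlap h₀ hcut (hF Δ hΔ).1 (hF Δ' hΔ').1 hk hk' (hF Δ hΔ).2.2
        (hF Δ' hΔ').2.2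
  · intro Δ hΔ
    refine .inr ?_
    rcases (hF Δ hΔ).1.created_cases (hF Δ hΔ).2.1 with ⟨u, hu⟩ | ⟨s, u, hu⟩
    · exact ⟨.inr u, (), by simp, hu⟩
    · exact ⟨.inl (s, u), (), by simp, hu⟩

end IsFace

/-- The edge `e` meets the segment `{(a + δ y, y) | b ≤ y ≤ c}`. -/
def MeetsQuery (A : Arrangement m n) (a δ b c : ℝ) (e : Fin n) : Prop :=
  ∃ y ∈ Icc b c, a + δ * y ∈ Icc (A.X (A.lo e)) (A.X (A.hi e)) ∧ A.height e (a + δ * y) = y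

/-- The difficult case is an edge overlapping the query. A wall vertex separating the two faces
would be on the query by `hq`, hence on `e`, hence an end of `e`; but its abscissa is interior to
the slab of `e`. -/
theorem eq_of_floor_of_query {R : Finset (Fin n)} {Δ Δ' : Trapezoid m n} {a δ b c : ℝ}
    (hδ : 0 < δ) (hq : ∀ v, ∀ y ∈ Icc b c, A.X v = a + δ * y → A.Y v = y)
    (h : A.IsFace R Δ) (h' : A.IsFace R Δ') {u : Bool} {e : Fin n} (he : e ∈ Δ.floor u)
    (he' : e ∈ Δ'.floor u) {y y' : ℝ} (hy : y ∈ Icc b c) (hy' : y' ∈ Icc b c)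
    (hs : A.OpenSlab Δ (a + δ * y)) (hs' : A.OpenSlab Δ' (a + δ * y'))
    (hye : A.height e (a + δ * y) = y) (hye' : A.height e (a + δ * y') = y') (hyy' : y ≤ y') :
    Δ = Δ' := by
  by_contra hne
  have hn : ¬ A.OpenSlab Δ (a + δ * y') := fun hx => hne (h.eq_of_floor_eq h' hx hs' he he')
  have hxx' : a + δ * y ≤ a + δ * y' := by nlinarith
  obtain ⟨v, hv, hvx'⟩ : ∃ v ∈ Δ.right, A.X v ≤ a + δ * y' := by
    by_contra! hc
    exact hn ⟨fun v hv => (hs.1 v hv).trans_le hxx', hc⟩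
  have hxv := hs.2 v hv
  have hve : A.X v ∈ Ioo (A.X (A.lo e)) (A.X (A.hi e)) :=
    ⟨((h.floor_spec he).2.mem_Ioo hs).1.trans hxv,
      hvx'.trans_lt ((h'.floor_spec he').2.mem_Ioo hs').2⟩
  have hz : A.X v = a + δ * ((A.X v - a) / δ) := by field_simp; ring
  have hz1 : y < (A.X v - a) / δ := by
    rw [lt_div_iff₀ hδ]
    linarith
  have hz2 : (A.X v - a) / δ ≤ y' := by
    rw [div_le_iff₀ hδ]
    linarith
  have hYv := hq v _ ⟨hy.1.trans hz1.le, hz2.trans hy'.2⟩ hz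
  have hmem : v = A.lo e ∨ v = A.hi e := by
    refine A.vertex_on_edge v e (Ioo_subset_Icc_self hve) ?_
    change A.height e (A.X v) = A.Y v
    rw [hYv]
    generalize (A.X v - a) / δ = z at *
    rw [hz]
    unfold height at *
    -- Either the two meeting points coincide or `e` and the query lie on the same line.
    have : (y' - y) * (A.slope e * δ - 1) = 0 := by linear_combination hye' - hye
    rcases mul_eq_zero.1 this with h0 | h0
    · linarith
    · linear_combination hye + (z - y) * h0
  rcases hmem with h0 | h0
  · exact hve.1.ne' (congrArg A.X h0)
  · exact hve.2.ne (congrArg A.X h0)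

/-- A query segment which passes vertices only by containing them meets few faces. -/
theorem card_zone_le {R : Finset (Fin n)} {a δ b c : ℝ} (hδ : 0 < δ) (hbc : b ≤ c)
    (hq : ∀ v, ∀ y ∈ Icc b c, A.X v = a + δ * y → A.Y v = y) (F : Finset (Trapezoid m n))
    (hF : ∀ Δ ∈ F, A.IsFace R Δ ∧ ∃ y ∈ Icc b c, A.Region Δ (a + δ * y) y) :
    F.card ≤ 1 + 14 * (R.filter (A.MeetsQuery a δ b c)).card := by
  -- A face with a wall vertex on the query is charged to an edge ending there, preferably one of
  -- its floors: 2 · 2 · 3 kinds. Failing that, it is charged to a floor met by the query over the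
  -- face: 2 kinds. Any other face contains the whole query in its interior, in particular its lower
  -- end, which is the exceptional label.
  refine card_le_of_kinds (κ := (Bool × Bool × Option Bool) ⊕ Bool) F
    (R.filter (A.MeetsQuery a δ b c)) (fun Δ => A.Interior Δ (a + δ * b) b)
    (fun k e Δ => match k with
      | .inl (s, u, none) => A.vertex e u ∈ Δ.wall s ∧
          A.Between Δ (A.X (A.vertex e u)) (A.Y (A.vertex e u))
      | .inl (s, u, some w) => A.vertex e u ∈ Δ.wall s ∧ e ∈ Δ.floor w
      | .inr u => e ∈ Δ.floor u ∧ ∃ y ∈ Icc b c, A.OpenSlab Δ (a + δ * y) ∧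
          A.height e (a + δ * y) = y) ?_ ?_ ?_
  · intro Δ hΔ Δ' hΔ' h1 h2
    exact (hF Δ hΔ).1.eq_of_interior (hF Δ' hΔ').1 h1 h2
  · rintro (⟨s, u, _ | w⟩ | u) e Δ hΔ Δ' hΔ' hk hk'
    · exact (hF Δ hΔ).1.eq_of_wall_eq_of_between (hF Δ' hΔ').1 hk.1 hk'.1 hk.2 hk'.2
    · exact (hF Δ hΔ).1.eq_of_wall_eq_of_floor_eq (hF Δ' hΔ').1 hk.1 hk'.1 hk.2 hk'.2
    · obtain ⟨h1, y, hy, h2, h3⟩ := hk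
      obtain ⟨h1', y', hy', h2', h3'⟩ := hk'
      rcases le_total y y' with hyy | hyy
      · exact eq_of_floor_of_query hδ hq (hF Δ hΔ).1 (hF Δ' hΔ').1 h1 h1' hy hy' h2 h2' h3 h3' hyy
      · exact (eq_of_floor_of_query hδ hq (hF Δ' hΔ').1 (hF Δ hΔ).1 h1' h1 hy' hy h2' h2 h3' h3
          hyy).symm
  · intro Δ hΔ
    obtain ⟨hf, y₀, hy₀, hr₀⟩ := hF Δ hΔ
    by_cases hw : ∃ s, ∃ v ∈ Δ.wall s, ∃ y ∈ Icc b c, A.X v = a + δ * y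
    · obtain ⟨s, v, hv, y, hy, hvy⟩ := hw
      have hmeet : ∀ e : Fin n, v = A.lo e ∨ v = A.hi e → A.MeetsQuery a δ b c e := by
        intro e he
        have hYv := hq v y hy hvy
        refine ⟨y, hy, ?_, ?_⟩
        · rw [← hvy]
          have := A.lo_lt_hi e
          rcases he with rfl | rfl
          · exact ⟨le_rfl, this.le⟩
          · exact ⟨this.le, le_rfl⟩
        · rw [← hvy, height_vertex he, hYv]
      refine .inr ?_
      by_cases hfl : ∃ w, ∃ e ∈ Δ.floor w, v = A.lo e ∨ v = A.hi e
      · obtain ⟨w, e, he, hve⟩ := hfl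
        obtain ⟨u, rfl⟩ := incident_iff.1 hve
        exact ⟨.inl (s, u, some w), e,
          Finset.mem_filter.2 ⟨(hf.floor_spec he).1, hmeet e hve⟩, hv, he⟩
      · obtain ⟨⟨g, hg, hvg⟩, -⟩ := hf.wall_spec hv
        have hbet := hf.between_of_wall hv fun w b hb hvb => hfl ⟨w, b, hb, hvb⟩
        obtain ⟨u, rfl⟩ := incident_iff.1 hvg
        exact ⟨.inl (s, u, none), g, Finset.mem_filter.2 ⟨hg, hmeet g hvg⟩, hv, hbet⟩
    have hopen : ∀ y ∈ Icc b c, A.ClosedSlab Δ (a + δ * y) → A.OpenSlab Δ (a + δ * y) :=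
      fun y hy hs => ⟨fun v hv => lt_of_le_of_ne (hs.1 v hv) fun h0 => hw ⟨false, v, hv, y, hy, h0⟩,
        fun v hv => lt_of_le_of_ne (hs.2 v hv) fun h0 => hw ⟨true, v, hv, y, hy, h0.symm⟩⟩
    by_cases hfl : ∃ u, ∃ e ∈ Δ.floor u, ∃ y ∈ Icc b c, A.ClosedSlab Δ (a + δ * y) ∧
        A.height e (a + δ * y) = y
    · obtain ⟨u, e, he, y, hy, hs, hey⟩ := hfl
      refine .inr ⟨.inr u, e, Finset.mem_filter.2 ⟨(hf.floor_spec he).1, y, hy, ?_, hey⟩, he, y, hy,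
        hopen y hy hs, hey⟩
      exact (hf.floor_spec he).2.mem_Icc hs
    have hint : ∀ y ∈ Icc b c, A.Region Δ (a + δ * y) y → A.Interior Δ (a + δ * y) y := by
      rintro y hy ⟨h1, h2⟩
      exact ⟨hopen y hy h1,
        fun e he => lt_of_le_of_ne (h2.1 e he) fun h0 => hfl ⟨false, e, he, y, hy, h1, h0⟩,
        fun e he => lt_of_le_of_ne (h2.2 e he) fun h0 => hfl ⟨true, e, he, y, hy, h1, h0.symm⟩⟩
    left
    have hc : Continuous fun y : ℝ => (a + δ * y, y) := by fun_prop
    -- The query never touches the boundary of the face, so by connectedness it stays in the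
    -- interior.
    have hsub := isPreconnected_Icc.subset_left_of_subset_union (s := Icc b c)
      ((isOpen_interior (A := A) Δ).preimage hc) ((isClosed_region (A := A) Δ).preimage hc).isOpen_compl
      (disjoint_left.2 fun y h1 h2 => h2 (Interior.region h1))
      (fun y hy => by
        by_cases hr : A.Region Δ (a + δ * y) y
        · exact .inl (hint y hy hr)
        · exact .inr hr)
      ⟨y₀, hy₀, hint y₀ hy₀ hr₀⟩
    exact hsub (left_mem_Icc.2 hbc)

end Arrangement

/-! ### Realizing the symbolic shear by a real parameter. -/

/-- Two edges share an abscissa at which `d` is strictly below `e`. -/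
def Arrangement.Below {m n : ℕ} (A : Arrangement m n) (d e : Fin n) : Prop :=
  ∃ x ∈ Icc (A.X (A.lo d)) (A.X (A.hi d)) ∩ Icc (A.X (A.lo e)) (A.X (A.hi e)),
    A.height d x < A.height e x

theorem Arrangement.below_iff {m n : ℕ} {A : Arrangement m n} {d e : Fin n} {x : ℝ}
    (hd : x ∈ Ioo (A.X (A.lo d)) (A.X (A.hi d))) (he : x ∈ Ioo (A.X (A.lo e)) (A.X (A.hi e))) :
    A.Below d e ↔ A.height d x < A.height e x := by
  constructor
  · rintro ⟨z, ⟨hz, hz'⟩, hlt⟩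
    exact height_lt_of_lt hz hz' hlt hd he
  · intro h
    exact ⟨x, ⟨Ioo_subset_Icc_self hd, Ioo_subset_Icc_self he⟩, h⟩

/-- The sheared abscissa for a real shear parameter. -/
def shearX (δ : ℝ) (p : Pt) : ℝ := p.1 + δ * p.2

/-- For different first coordinates the orders agree for all small `δ` by continuity, for equal ones
for every `δ > 0`; a finite set admits a common `δ`. -/
theorem exists_shear (P : Finset Pt) : ∃ δ : ℝ, 0 < δ ∧
    ∀ p ∈ P, ∀ p' ∈ P, toLex p < toLex p' ↔ shearX δ p < shearX δ p' := by
  have key : ∀ p p' : Pt, p.1 < p'.1 → ∀ᶠ δ in 𝓝[>] (0 : ℝ), shearX δ p < shearX δ p' := by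
    intro p p' h
    have ht : ∀ q : Pt, Tendsto (fun δ => shearX δ q) (𝓝[>] (0 : ℝ)) (𝓝 q.1) := by
      intro q
      have : Tendsto (fun δ => shearX δ q) (𝓝 (0 : ℝ)) (𝓝 (shearX 0 q)) :=
        Continuous.tendsto (by unfold shearX; fun_prop) 0
      rw [show shearX 0 q = q.1 by simp [shearX]] at this
      exact this.mono_left nhdsWithin_le_nhds
    exact (ht p).eventually_lt (ht p') h
  have h : ∀ᶠ δ in 𝓝[>] (0 : ℝ), ∀ p ∈ P, ∀ p' ∈ P,
      toLex p < toLex p' ↔ shearX δ p < shearX δ p' := by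
    refine (Filter.eventually_all_finset P).2 fun p _ => (Filter.eventually_all_finset P).2
      fun p' _ => ?_
    rcases lt_trichotomy p.1 p'.1 with h | h | h
    · filter_upwards [key p p' h] with δ hδ
      simp [Prod.Lex.toLex_lt_toLex, h, hδ]
    · filter_upwards [self_mem_nhdsWithin] with δ hδ
      have hδ' : 0 < δ := hδ
      simp [Prod.Lex.toLex_lt_toLex, h, shearX, hδ']
    · filter_upwards [key p' p h] with δ hδ
      simp [Prod.Lex.toLex_lt_toLex, h.not_gt, h.ne', hδ.le]
  obtain ⟨δ, h1, h2⟩ := (h.and self_mem_nhdsWithin).exists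
  exact ⟨δ, h2, h1⟩

theorem mem_segment_iff_shear {δ : ℝ} {P Q p : Pt} (h : shearX δ P < shearX δ Q) :
    p ∈ segment ℝ P Q ↔ shearX δ p ∈ Icc (shearX δ P) (shearX δ Q) ∧
      P.2 + (Q.2 - P.2) / (shearX δ Q - shearX δ P) * (shearX δ p - shearX δ P) = p.2 := by
  have hpos : 0 < shearX δ Q - shearX δ P := sub_pos.2 h
  rw [segment_eq_image]
  constructor
  · rintro ⟨t, ⟨h0, h1⟩, rfl⟩
    have hX : shearX δ ((1 - t) • P + t • Q) = shearX δ P + t * (shearX δ Q - shearX δ P) := by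
      simp only [shearX, Prod.fst_add, Prod.smul_fst, smul_eq_mul, Prod.snd_add, Prod.smul_snd]
      ring
    simp only [hX]
    refine ⟨⟨by nlinarith, by nlinarith⟩, ?_⟩
    simp only [Prod.snd_add, Prod.smul_snd, smul_eq_mul]
    field_simp
    ring
  · rintro ⟨⟨h1, h2⟩, h3⟩
    refine ⟨(shearX δ p - shearX δ P) / (shearX δ Q - shearX δ P), ⟨by
      apply div_nonneg <;> linarith, by rw [div_le_one hpos]; linarith⟩, ?_⟩
    set t := (shearX δ p - shearX δ P) / (shearX δ Q - shearX δ P) with ht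
    have h4 : t * (shearX δ Q - shearX δ P) = shearX δ p - shearX δ P := by
      rw [ht]
      field_simp
    have h5 : P.2 + (Q.2 - P.2) * t = p.2 := by
      rw [← h3, ht]
      ring
    have h6 : (1 - t) * P.1 + t * Q.1 = p.1 := by
      unfold shearX at h4
      linear_combination h4 - δ * h5
    refine Prod.ext ?_ ?_
    · simpa using h6
    · simp only [Prod.snd_add, Prod.smul_snd, smul_eq_mul]
      linear_combination h5

namespace Drawing

variable {m n : ℕ} (G : Drawing m n)

/-- The left endpoint of an edge as a vertex. -/
def loVertex (e : Fin n) : Fin m :=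
  if toLex (G.pos (G.ends e).1) ≤ toLex (G.pos (G.ends e).2) then (G.ends e).1 else (G.ends e).2

/-- The right endpoint of an edge as a vertex. -/
def hiVertex (e : Fin n) : Fin m :=
  if toLex (G.pos (G.ends e).1) ≤ toLex (G.pos (G.ends e).2) then (G.ends e).2 else (G.ends e).1

variable {G}

theorem lo_eq (e : Fin n) : G.lo e = G.pos (G.loVertex e) := by
  unfold lo loVertex
  rw [min_def]
  split_ifs <;> rfl

theorem hi_eq (e : Fin n) : G.hi e = G.pos (G.hiVertex e) := by
  unfold hi hiVertex
  rw [max_def]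
  split_ifs <;> rfl

theorem incident_iff (v : Fin m) (e : Fin n) :
    G.Incident v e ↔ v = G.loVertex e ∨ v = G.hiVertex e := by
  unfold Incident loVertex hiVertex
  split_ifs
  · rfl
  · exact or_comm

theorem seg_eq (e : Fin n) : G.seg e = segment ℝ (G.lo e) (G.hi e) := by
  rw [lo_eq, hi_eq]
  unfold seg loVertex hiVertex
  split_ifs
  · rfl
  · exact segment_symm _ _ _

theorem lo_lt_hi (hG : G.IsConnectedPlanarSubdivision) (e : Fin n) :
    toLex (G.pos (G.loVertex e)) < toLex (G.pos (G.hiVertex e)) := by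
  have hne : toLex (G.pos (G.ends e).1) ≠ toLex (G.pos (G.ends e).2) := fun h =>
    hG.ends_ne e (hG.pos_injective (toLex.injective h))
  unfold loVertex hiVertex
  split_ifs with h
  · exact lt_of_le_of_ne h hne
  · exact not_le.1 h

theorem absc_le_absc {p q : Pt} : absc p ≤ absc q ↔ toLex p ≤ toLex q := by
  simp [absc]

theorem absc_lt_absc {p q : Pt} : absc p < absc q ↔ toLex p < toLex q := by
  simp [absc]

/-- The orientation determinant is invariant under shears, so its sign can be read off from heights
in the sheared drawing. -/
theorem side_eq {δ : ℝ} (e : Fin n) (h : shearX δ (G.lo e) < shearX δ (G.hi e)) (p : Pt) :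
    G.side e p = (shearX δ (G.hi e) - shearX δ (G.lo e)) *
      (p.2 - ((G.lo e).2 + ((G.hi e).2 - (G.lo e).2) / (shearX δ (G.hi e) - shearX δ (G.lo e)) *
        (shearX δ p - shearX δ (G.lo e)))) := by
  have : shearX δ (G.hi e) - shearX δ (G.lo e) ≠ 0 := (sub_pos.2 h).ne'
  have h2 : (shearX δ (G.hi e) - shearX δ (G.lo e)) *
      (((G.hi e).2 - (G.lo e).2) / (shearX δ (G.hi e) - shearX δ (G.lo e))) =
        (G.hi e).2 - (G.lo e).2 := by field_simp
  rw [mul_sub, mul_add, ← mul_assoc, h2]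
  unfold side shearX
  ring

/-- The arrangement obtained by a shear that realizes the lexicographic order of the vertices. -/
def shear (hG : G.IsConnectedPlanarSubdivision) (δ : ℝ)
    (hδ : ∀ u v, toLex (G.pos u) < toLex (G.pos v) ↔ shearX δ (G.pos u) < shearX δ (G.pos v)) :
    Arrangement m n where
  X v := shearX δ (G.pos v)
  Y v := (G.pos v).2
  lo := G.loVertex
  hi := G.hiVertex
  slope e := ((G.pos (G.hiVertex e)).2 - (G.pos (G.loVertex e)).2) /
    (shearX δ (G.pos (G.hiVertex e)) - shearX δ (G.pos (G.loVertex e)))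
  X_injective u v h := by
    simp only at h
    refine hG.pos_injective (toLex.injective (le_antisymm ?_ ?_))
    · exact not_lt.1 fun h' => ((hδ _ _).1 h').ne' h
    · exact not_lt.1 fun h' => ((hδ _ _).1 h').ne h
  lo_lt_hi e := (hδ _ _).1 (lo_lt_hi hG e)
  Y_hi e := by
    have := sub_pos.2 ((hδ _ _).1 (lo_lt_hi hG e))
    field_simp
    ring
  noncrossing d e x hde hd he h := by
    have hmem : ∀ f, (G.pos (G.loVertex d)).2 + ((G.pos (G.hiVertex d)).2 -
        (G.pos (G.loVertex d)).2) / (shearX δ (G.pos (G.hiVertex d)) -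
          shearX δ (G.pos (G.loVertex d))) * (x - shearX δ (G.pos (G.loVertex d))) =
        (G.pos (G.loVertex f)).2 + ((G.pos (G.hiVertex f)).2 -
        (G.pos (G.loVertex f)).2) / (shearX δ (G.pos (G.hiVertex f)) -
          shearX δ (G.pos (G.loVertex f))) * (x - shearX δ (G.pos (G.loVertex f))) →
        x ∈ Icc (shearX δ (G.pos (G.loVertex f))) (shearX δ (G.pos (G.hiVertex f))) →
        (x - δ * ((G.pos (G.loVertex d)).2 + ((G.pos (G.hiVertex d)).2 -
        (G.pos (G.loVertex d)).2) / (shearX δ (G.pos (G.hiVertex d)) -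
          shearX δ (G.pos (G.loVertex d))) * (x - shearX δ (G.pos (G.loVertex d)))),
        (G.pos (G.loVertex d)).2 + ((G.pos (G.hiVertex d)).2 -
        (G.pos (G.loVertex d)).2) / (shearX δ (G.pos (G.hiVertex d)) -
          shearX δ (G.pos (G.loVertex d))) * (x - shearX δ (G.pos (G.loVertex d)))) ∈ G.seg f := by
      intro f h1 h2
      rw [seg_eq, lo_eq, hi_eq, mem_segment_iff_shear ((hδ _ _).1 (lo_lt_hi hG f))]
      generalize (G.pos (G.loVertex d)).2 + _ = y at *
      have : shearX δ (x - δ * y, y) = x := by simp [shearX]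
      rw [this]
      exact ⟨h2, h1.symm⟩
    obtain ⟨v, hv, -, hp⟩ := hG.noncrossing d e hde _ ⟨hmem d rfl hd, hmem e h he⟩
    have hx : shearX δ (G.pos v) = x := by
      rw [hp]
      simp [shearX]
    rcases (incident_iff v d).1 hv with rfl | rfl
    · exact .inl hx.symm
    · exact .inr hx.symm
  vertex_on_edge v e hv h := by
    refine (incident_iff v e).1 (hG.vertex_on_edge v e ?_)
    rw [seg_eq, lo_eq, hi_eq, mem_segment_iff_shear ((hδ _ _).1 (lo_lt_hi hG e))]
    exact ⟨hv, h⟩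

/-- The abscissa of `p` relative to the vertices is the sheared one. -/
def Comparable (G : Drawing m n) (δ : ℝ) (p : Pt) : Prop :=
  ∀ v, (toLex (G.pos v) < toLex p ↔ shearX δ (G.pos v) < shearX δ p) ∧
    (toLex p < toLex (G.pos v) ↔ shearX δ p < shearX δ (G.pos v))

theorem Comparable.le_iff {δ : ℝ} {p : Pt} (h : G.Comparable δ p) (v : Fin m) :
    (toLex (G.pos v) ≤ toLex p ↔ shearX δ (G.pos v) ≤ shearX δ p) ∧
    (toLex p ≤ toLex (G.pos v) ↔ shearX δ p ≤ shearX δ (G.pos v)) := by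
  simp only [← not_lt]
  exact ⟨not_congr (h v).2, not_congr (h v).1⟩

/-- The arrangement `A` is the drawing `G` under the shear with parameter `δ`. -/
structure IsShear (G : Drawing m n) (A : Arrangement m n) (δ : ℝ) : Prop where
  X_eq : ∀ v, A.X v = shearX δ (G.pos v)
  Y_eq : ∀ v, A.Y v = (G.pos v).2
  lo_eq : ∀ e, G.lo e = G.pos (A.lo e)
  hi_eq : ∀ e, G.hi e = G.pos (A.hi e)
  lex : ∀ u v, toLex (G.pos u) < toLex (G.pos v) ↔ A.X u < A.X v
  incident : ∀ v e, G.Incident v e ↔ v = A.lo e ∨ v = A.hi e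
  mem_seg : ∀ p e, p ∈ G.seg e ↔
    shearX δ p ∈ Icc (A.X (A.lo e)) (A.X (A.hi e)) ∧ A.height e (shearX δ p) = p.2
  side_pos : ∀ p e, 0 < G.side e p ↔ A.height e (shearX δ p) < p.2
  side_neg : ∀ p e, G.side e p < 0 ↔ p.2 < A.height e (shearX δ p)
  below : ∀ d e, G.Below d e ↔ A.Below d e

/-- The order is realized on the vertices, on a witness for every true instance of `Below`, and on
the two ends of the query. The remaining query points follow from its ends by monotonicity in `y`.
-/
theorem exists_isShear (hG : G.IsConnectedPlanarSubdivision) (a b c : ℝ) :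
    ∃ A δ, 0 < δ ∧ G.IsShear A δ ∧ ∀ y ∈ Icc b c, G.Comparable δ (a, y) := by
  have hw : ∀ d e, ∃ p, G.Below d e → (p ∈ G.seg e ∧ G.InSlab d p ∧ 0 < G.side d p) ∨
      (p ∈ G.seg d ∧ G.InSlab e p ∧ G.side e p < 0) := by
    intro d e
    by_cases h : G.Below d e
    · rcases h with ⟨p, hp⟩ | ⟨p, hp⟩
      · exact ⟨p, fun _ => .inl hp⟩
      · exact ⟨p, fun _ => .inr hp⟩
    · exact ⟨(0, 0), fun h' => absurd h' h⟩
  choose w hw using hw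
  obtain ⟨δ, hδ, hP⟩ := exists_shear (Finset.univ.image G.pos ∪
    Finset.univ.image (fun i : Fin n × Fin n => w i.1 i.2) ∪ {(a, b), (a, c)})
  have hpos : ∀ v, G.pos v ∈ Finset.univ.image G.pos ∪
    Finset.univ.image (fun i : Fin n × Fin n => w i.1 i.2) ∪ {(a, b), (a, c)} := by simp
  have hwm : ∀ d e, w d e ∈ Finset.univ.image G.pos ∪
      Finset.univ.image (fun i : Fin n × Fin n => w i.1 i.2) ∪ {(a, b), (a, c)} := by
    intro d e
    simp only [Finset.mem_union, Finset.mem_image, Finset.mem_univ, true_and, Prod.exists]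
    exact .inl (.inr ⟨d, e, rfl⟩)
  have hlex : ∀ u v, toLex (G.pos u) < toLex (G.pos v) ↔
      shearX δ (G.pos u) < shearX δ (G.pos v) := fun u v => hP _ (hpos u) _ (hpos v)
  have hcv : ∀ v, G.Comparable δ (G.pos v) := fun v u => ⟨hlex u v, hlex v u⟩
  have hcw : ∀ d e, G.Comparable δ (w d e) := fun d e v =>
    ⟨hP _ (hpos v) _ (hwm d e), hP _ (hwm d e) _ (hpos v)⟩
  set A := shear hG δ hlex with hA
  have hmem : ∀ p e, p ∈ G.seg e ↔
      shearX δ p ∈ Icc (A.X (A.lo e)) (A.X (A.hi e)) ∧ A.height e (shearX δ p) = p.2 := by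
    intro p e
    rw [seg_eq, lo_eq, hi_eq, mem_segment_iff_shear ((hlex _ _).1 (lo_lt_hi hG e))]
    rfl
  have hside : ∀ p e, G.side e p = (A.X (A.hi e) - A.X (A.lo e)) *
      (p.2 - A.height e (shearX δ p)) := by
    intro p e
    have h := lo_lt_hi hG e
    rw [hlex, ← lo_eq, ← hi_eq] at h
    rw [side_eq e h, lo_eq, hi_eq]
    rfl
  have hside_pos : ∀ p e, 0 < G.side e p ↔ A.height e (shearX δ p) < p.2 := by
    intro p e
    rw [hside, mul_pos_iff_of_pos_left (sub_pos.2 (A.lo_lt_hi e)), sub_pos]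
  have hside_neg : ∀ p e, G.side e p < 0 ↔ p.2 < A.height e (shearX δ p) := by
    intro p e
    rw [hside, ← neg_pos, ← mul_neg, mul_pos_iff_of_pos_left (sub_pos.2 (A.lo_lt_hi e)), neg_sub,
      sub_pos]
  have hslab : ∀ p, G.Comparable δ p → ∀ e, G.InSlab e p ↔
      shearX δ p ∈ Icc (A.X (A.lo e)) (A.X (A.hi e)) := by
    intro p hp e
    unfold InSlab
    rw [absc_le_absc, absc_le_absc, lo_eq, hi_eq, (hp.le_iff _).1, (hp.le_iff _).2]
    rfl
  refine ⟨A, δ, hδ, ⟨fun _ => rfl, fun _ => rfl, lo_eq, hi_eq, hlex, incident_iff, hmem, hside_pos,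
    hside_neg, fun d e => ⟨fun h => ?_, ?_⟩⟩, ?_⟩
  · rcases hw d e h with ⟨h1, h2, h3⟩ | ⟨h1, h2, h3⟩
    · rw [hmem] at h1
      rw [hside_pos] at h3
      rw [hslab _ (hcw d e)] at h2
      exact ⟨_, ⟨h2, h1.1⟩, by rw [h1.2]; exact h3⟩
    · rw [hmem] at h1
      rw [hside_neg] at h3
      rw [hslab _ (hcw d e)] at h2
      exact ⟨_, ⟨h1.1, h2⟩, by rw [h1.2]; exact h3⟩
  · rintro ⟨x, ⟨hxd, hxe⟩, hlt⟩
    have hd := A.lo_lt_hi d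
    have he := A.lo_lt_hi e
    have viaE : ∀ v, v = A.lo e ∨ v = A.hi e → A.X v ∈ Icc (A.X (A.lo d)) (A.X (A.hi d)) →
        A.height d (A.X v) < A.height e (A.X v) → G.Below d e := by
      intro v hv hvd hlt
      refine .inl ⟨G.pos v, ?_, (hslab _ (hcv v) d).2 hvd, ?_⟩
      · rw [hmem]
        refine ⟨?_, Arrangement.height_vertex hv⟩
        rcases hv with rfl | rfl
        · exact ⟨le_rfl, he.le⟩
        · exact ⟨he.le, le_rfl⟩
      · rw [hside_pos]
        rwa [Arrangement.height_vertex hv] at hlt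
    have viaD : ∀ v, v = A.lo d ∨ v = A.hi d → A.X v ∈ Icc (A.X (A.lo e)) (A.X (A.hi e)) →
        A.height d (A.X v) < A.height e (A.X v) → G.Below d e := by
      intro v hv hvd hlt
      refine .inr ⟨G.pos v, ?_, (hslab _ (hcv v) e).2 hvd, ?_⟩
      · rw [hmem]
        refine ⟨?_, Arrangement.height_vertex hv⟩
        rcases hv with rfl | rfl
        · exact ⟨le_rfl, hd.le⟩
        · exact ⟨hd.le, le_rfl⟩
      · rw [hside_neg]
        rwa [Arrangement.height_vertex hv] at hlt
    have via : ∀ v, (v = A.lo e ∨ v = A.hi e) ∨ (v = A.lo d ∨ v = A.hi d) →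
        A.X v ∈ Icc (A.X (A.lo d)) (A.X (A.hi d)) → A.X v ∈ Icc (A.X (A.lo e)) (A.X (A.hi e)) →
        A.height d (A.X v) < A.height e (A.X v) → G.Below d e := by
      rintro v (hv | hv) h1 h2 h3
      · exact viaE v hv h1 h3
      · exact viaD v hv h2 h3
    -- The height difference is affine and positive at `x`, hence positive at an end of the common
    -- slab. Such an end is the abscissa of a vertex of `d` or `e`, a legitimate witness for
    -- `Below`.
    obtain ⟨l, hl, hld, hle, hlx⟩ : ∃ l, ((l = A.lo e ∨ l = A.hi e) ∨ (l = A.lo d ∨ l = A.hi d)) ∧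
        A.X l ∈ Icc (A.X (A.lo d)) (A.X (A.hi d)) ∧ A.X l ∈ Icc (A.X (A.lo e)) (A.X (A.hi e)) ∧
        A.X l ≤ x := by
      rcases le_total (A.X (A.lo d)) (A.X (A.lo e)) with h | h
      · exact ⟨A.lo e, by simp, ⟨h, hxe.1.trans hxd.2⟩, ⟨le_rfl, he.le⟩, hxe.1⟩
      · exact ⟨A.lo d, by simp, ⟨le_rfl, hd.le⟩, ⟨h, hxd.1.trans hxe.2⟩, hxd.1⟩
    obtain ⟨r, hr, hrd, hre, hxr⟩ : ∃ l, ((l = A.lo e ∨ l = A.hi e) ∨ (l = A.lo d ∨ l = A.hi d)) ∧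
        A.X l ∈ Icc (A.X (A.lo d)) (A.X (A.hi d)) ∧ A.X l ∈ Icc (A.X (A.lo e)) (A.X (A.hi e)) ∧
        x ≤ A.X l := by
      rcases le_total (A.X (A.hi d)) (A.X (A.hi e)) with h | h
      · exact ⟨A.hi d, by simp, ⟨hd.le, le_rfl⟩, ⟨hxe.1.trans hxd.2, h⟩, hxd.2⟩
      · exact ⟨A.hi e, by simp, ⟨hxd.1.trans hxe.2, h⟩, ⟨he.le, le_rfl⟩, hxe.2⟩
    rcases lt_or_ge (A.height d (A.X l)) (A.height e (A.X l)) with h1 | h1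
    · exact via l hl hld hle h1
    rcases lt_or_ge (A.height d (A.X r)) (A.height e (A.X r)) with h2 | h2
    · exact via r hr hrd hre h2
    exfalso
    unfold Arrangement.height at h1 h2 hlt
    rcases le_total (A.slope d) (A.slope e) with hs | hs
    · nlinarith
    · nlinarith
  · intro y hy v
    have hb := hP _ (hpos v) (a, b) (by simp)
    have hc := hP (a, c) (by simp) _ (hpos v)
    have h1 : δ * b ≤ δ * y := mul_le_mul_of_nonneg_left hy.1 hδ.le
    have h2 : δ * y ≤ δ * c := mul_le_mul_of_nonneg_left hy.2 hδ.le
    simp only [Prod.Lex.toLex_lt_toLex, shearX] at hb hc ⊢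
    rcases lt_trichotomy (G.pos v).1 a with h | h | h
    · have := hb.1 (.inl h)
      refine ⟨iff_of_true (.inl h) (by linarith), iff_of_false ?_ (by linarith)⟩
      rintro (h' | h')
      · exact lt_asymm h h'
      · exact h.ne' h'.1
    · simp [h, hδ]
    · have := hc.1 (.inl h)
      refine ⟨iff_of_false ?_ (by linarith), iff_of_true (.inl h) (by linarith)⟩
      rintro (h' | h')
      · exact lt_asymm h h'
      · exact h.ne' h'.1

/-! ### Translation of the predicates on trapezoids between a drawing and its shear. -/

namespace IsShear

variable {A : Arrangement m n} {δ : ℝ}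

theorem leftWall_lt_rightWall (h : G.IsShear A δ) (Δ Δ' : Trapezoid m n) :
    G.leftWall Δ < G.rightWall Δ' ↔ ∀ u ∈ Δ.left, ∀ v ∈ Δ'.right, A.X u < A.X v := by
  unfold leftWall rightWall
  rcases Δ.left with _ | u <;> rcases Δ'.right with _ | v
  · simp
  · simp [absc]
  · simp [absc, WithBot.coe_lt_coe, ← WithBot.coe_top]
  · simp [absc_lt_absc, h.lex]

theorem exists_openSlab (h : G.IsShear A δ) (Δ Δ' : Trapezoid m n) :
    max (G.leftWall Δ) (G.leftWall Δ') < min (G.rightWall Δ) (G.rightWall Δ') ↔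
      ∃ x, A.OpenSlab Δ x ∧ A.OpenSlab Δ' x := by
  rw [max_lt_iff, lt_min_iff, lt_min_iff]
  simp only [h.leftWall_lt_rightWall]
  constructor
  · rintro ⟨⟨h1, h2⟩, h3, h4⟩
    obtain ⟨x, hx, hx'⟩ := Order.exists_between_finsets
      ((Δ.left.toFinset ∪ Δ'.left.toFinset).image A.X)
      ((Δ.right.toFinset ∪ Δ'.right.toFinset).image A.X) (by
        simp only [Finset.mem_image, Finset.mem_union, Option.mem_toFinset]
        rintro _ ⟨u, hu | hu, rfl⟩ _ ⟨v, hv | hv, rfl⟩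
        exacts [h1 u hu v hv, h2 u hu v hv, h3 u hu v hv, h4 u hu v hv])
    simp only [Finset.mem_image, Finset.mem_union, Option.mem_toFinset] at hx hx'
    exact ⟨x, ⟨fun v hv => hx _ ⟨v, .inl hv, rfl⟩, fun v hv => hx' _ ⟨v, .inl hv, rfl⟩⟩,
      fun v hv => hx _ ⟨v, .inr hv, rfl⟩, fun v hv => hx' _ ⟨v, .inr hv, rfl⟩⟩
  · rintro ⟨x, h1, h2⟩
    exact ⟨⟨fun u hu v hv => (h1.1 u hu).trans (h1.2 v hv),
      fun u hu v hv => (h1.1 u hu).trans (h2.2 v hv)⟩,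
      fun u hu v hv => (h2.1 u hu).trans (h1.2 v hv),
      fun u hu v hv => (h2.1 u hu).trans (h2.2 v hv)⟩

theorem belowOpt_iff (h : G.IsShear A δ) (b t : Option (Fin n)) :
    G.BelowOpt b t ↔ ∀ d ∈ b, ∀ e ∈ t, A.Below d e := by
  simp only [BelowOpt, h.below]

theorem absc_le_leftWall (h : G.IsShear A δ) {p : Pt} (hp : G.Comparable δ p)
    (Δ : Trapezoid m n) : absc p ≤ G.leftWall Δ ↔ ∃ v ∈ Δ.left, shearX δ p ≤ A.X v := by
  unfold leftWall
  rcases Δ.left with _ | v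
  · simp [absc]
  · simp [absc_le_absc, (hp.le_iff v).2, h.X_eq]

theorem leftWall_le_absc (h : G.IsShear A δ) {p : Pt} (hp : G.Comparable δ p)
    (Δ : Trapezoid m n) : G.leftWall Δ ≤ absc p ↔ ∀ v ∈ Δ.left, A.X v ≤ shearX δ p := by
  unfold leftWall
  rcases Δ.left with _ | v
  · simp
  · simp [absc_le_absc, (hp.le_iff v).1, h.X_eq]

theorem rightWall_le_absc (h : G.IsShear A δ) {p : Pt} (hp : G.Comparable δ p)
    (Δ : Trapezoid m n) : G.rightWall Δ ≤ absc p ↔ ∃ v ∈ Δ.right, A.X v ≤ shearX δ p := by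
  unfold rightWall
  rcases Δ.right with _ | v
  · simp [absc, ← WithBot.coe_top]
  · simp [absc_le_absc, (hp.le_iff v).1, h.X_eq]

theorem absc_le_rightWall (h : G.IsShear A δ) {p : Pt} (hp : G.Comparable δ p)
    (Δ : Trapezoid m n) : absc p ≤ G.rightWall Δ ↔ ∀ v ∈ Δ.right, shearX δ p ≤ A.X v := by
  unfold rightWall
  rcases Δ.right with _ | v
  · simp
  · simp [absc_le_absc, (hp.le_iff v).2, h.X_eq]

theorem comparable_vertex (h : G.IsShear A δ) (v : Fin m) : G.Comparable δ (G.pos v) := fun u => by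
  rw [h.lex, h.lex, h.X_eq, h.X_eq]
  exact ⟨Iff.rfl, Iff.rfl⟩

theorem inStrip_iff (h : G.IsShear A δ) (Δ : Trapezoid m n) (p : Pt) :
    G.InStrip Δ p ↔ A.Strip Δ (shearX δ p) p.2 := by
  unfold InStrip Arrangement.Strip
  simp only [← not_lt, h.side_neg, h.side_pos]

theorem spans_iff (h : G.IsShear A δ) (e : Fin n) (Δ : Trapezoid m n) :
    G.Spans e Δ ↔ A.Spans e Δ := by
  unfold Spans Arrangement.Spans
  rw [h.lo_eq, h.hi_eq, h.absc_le_leftWall (h.comparable_vertex _),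
    h.rightWall_le_absc (h.comparable_vertex _), h.X_eq, h.X_eq]

theorem mem_region_iff (h : G.IsShear A δ) (Δ : Trapezoid m n) {p : Pt} (hp : G.Comparable δ p) :
    p ∈ G.region Δ ↔ A.Region Δ (shearX δ p) p.2 := by
  change _ ∧ _ ∧ _ ↔ _
  rw [h.leftWall_le_absc hp, h.absc_le_rightWall hp, h.inStrip_iff, ← and_assoc]
  rfl

theorem exists_openSlab_edge (h : G.IsShear A δ) (e : Fin n) (Δ : Trapezoid m n) :
    max (G.leftWall Δ) (absc (G.lo e)) < min (G.rightWall Δ) (absc (G.hi e)) ↔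
      ∃ x, A.OpenSlab Δ x ∧ x ∈ Ioo (A.X (A.lo e)) (A.X (A.hi e)) := by
  have := h.exists_openSlab Δ ⟨none, none, some (A.lo e), some (A.hi e)⟩
  rw [h.lo_eq, h.hi_eq]
  simpa [leftWall, rightWall, Arrangement.OpenSlab] using this

theorem cuts_iff (h : G.IsShear A δ) {Δ : Trapezoid m n} (hb : ∀ b ∈ Δ.bottom, A.Spans b Δ)
    (ht : ∀ t ∈ Δ.top, A.Spans t Δ) (e : Fin n) : G.Cuts e Δ ↔ A.Cuts e Δ := by
  unfold Cuts
  rw [h.exists_openSlab_edge, h.belowOpt_iff, h.belowOpt_iff]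
  constructor
  · rintro ⟨⟨x, hx, hxe⟩, h1, h2⟩
    exact ⟨x, hxe, hx, fun b hb' => (Arrangement.below_iff ((hb b hb').mem_Ioo hx) hxe).1
      (h1 b hb' e rfl), fun t ht' => (Arrangement.below_iff hxe ((ht t ht').mem_Ioo hx)).1
      (h2 e rfl t ht')⟩
  · rintro ⟨x, hxe, hx, h1, h2⟩
    refine ⟨⟨x, hx, hxe⟩, fun b hb' e' he' => ?_, fun e' he' t ht' => ?_⟩
    · cases he'
      exact (Arrangement.below_iff ((hb b hb').mem_Ioo hx) hxe).2 (h1 b hb')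
    · cases he'
      exact (Arrangement.below_iff hxe ((ht t ht').mem_Ioo hx)).2 (h2 t ht')

/-- Trapezoids whose floors are below each other's ceilings on a common slab overlap. -/
theorem overlap_aux (h : G.IsShear A δ) {Δ Δ' : Trapezoid m n}
    (hs : ∀ b, b ∈ Δ.bottom ∨ b ∈ Δ.top → A.Spans b Δ)
    (hs' : ∀ b, b ∈ Δ'.bottom ∨ b ∈ Δ'.top → A.Spans b Δ') :
    (max (G.leftWall Δ) (G.leftWall Δ') < min (G.rightWall Δ) (G.rightWall Δ') ∧
      (G.BelowOpt Δ.bottom Δ.top ∧ G.BelowOpt Δ'.bottom Δ'.top) ∧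
      G.BelowOpt Δ.bottom Δ'.top ∧ G.BelowOpt Δ'.bottom Δ.top) ↔
      ∃ x y, A.Interior Δ x y ∧ A.Interior Δ' x y := by
  rw [h.exists_openSlab]
  simp only [h.belowOpt_iff]
  constructor
  · rintro ⟨⟨x, hx, hx'⟩, ⟨h1, h2⟩, h3, h4⟩
    have m := fun b hb => (hs b hb).mem_Ioo hx
    have m' := fun b hb => (hs' b hb).mem_Ioo hx'
    obtain ⟨y, hy, hy'⟩ := Order.exists_between_finsets
      ((Δ.bottom.toFinset ∪ Δ'.bottom.toFinset).image fun e => A.height e x)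
      ((Δ.top.toFinset ∪ Δ'.top.toFinset).image fun e => A.height e x) (by
        simp only [Finset.mem_image, Finset.mem_union, Option.mem_toFinset]
        rintro _ ⟨u, hu | hu, rfl⟩ _ ⟨v, hv | hv, rfl⟩
        · exact (Arrangement.below_iff (m u (.inl hu)) (m v (.inr hv))).1 (h1 u hu v hv)
        · exact (Arrangement.below_iff (m u (.inl hu)) (m' v (.inr hv))).1 (h3 u hu v hv)
        · exact (Arrangement.below_iff (m' u (.inl hu)) (m v (.inr hv))).1 (h4 u hu v hv)
        · exact (Arrangement.below_iff (m' u (.inl hu)) (m' v (.inr hv))).1 (h2 u hu v hv))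
    simp only [Finset.mem_image, Finset.mem_union, Option.mem_toFinset] at hy hy'
    exact ⟨x, y, ⟨hx, fun v hv => hy _ ⟨v, .inl hv, rfl⟩, fun v hv => hy' _ ⟨v, .inl hv, rfl⟩⟩,
      hx', fun v hv => hy _ ⟨v, .inr hv, rfl⟩, fun v hv => hy' _ ⟨v, .inr hv, rfl⟩⟩
  · rintro ⟨x, y, ⟨hx, hb, ht⟩, hx', hb', ht'⟩
    have m := fun b hb => (hs b hb).mem_Ioo hx
    have m' := fun b hb => (hs' b hb).mem_Ioo hx'
    refine ⟨⟨x, hx, hx'⟩, ⟨fun d hd e he => ?_, fun d hd e he => ?_⟩, fun d hd e he => ?_,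
      fun d hd e he => ?_⟩
    · exact (Arrangement.below_iff (m d (.inl hd)) (m e (.inr he))).2 ((hb d hd).trans (ht e he))
    · exact (Arrangement.below_iff (m' d (.inl hd)) (m' e (.inr he))).2 ((hb' d hd).trans (ht' e he))
    · exact (Arrangement.below_iff (m d (.inl hd)) (m' e (.inr he))).2 ((hb d hd).trans (ht' e he))
    · exact (Arrangement.below_iff (m' d (.inl hd)) (m e (.inr he))).2 ((hb' d hd).trans (ht e he))

/-- Ordered walls and floors must be exchanged for an interior point; this is `overlap_aux` for `Δ`
and itself. -/
theorem isFace_iff (h : G.IsShear A δ) (R : Finset (Fin n)) (Δ : Trapezoid m n) :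
    G.IsFace R Δ ↔ A.IsFace R Δ := by
  have hstrip : ∀ v, G.InStrip Δ (G.pos v) ↔ A.Strip Δ (A.X v) (A.Y v) := fun v => by
    rw [h.inStrip_iff, h.X_eq, h.Y_eq]
  constructor
  · rintro ⟨h1, h2, h3, h4, h5, h6, h7⟩
    simp only [h.spans_iff] at h2 h3
    simp only [h.incident, hstrip] at h5 h6
    simp only [h.cuts_iff (fun b hb => (h2 b hb).2) fun b hb => (h3 b hb).2] at h7
    have hs : ∀ b, b ∈ Δ.bottom ∨ b ∈ Δ.top → A.Spans b Δ := fun b hb =>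
      hb.elim (fun hb => (h2 b hb).2) fun hb => (h3 b hb).2
    obtain ⟨x, y, hI, -⟩ := (h.overlap_aux hs hs).1 ⟨by simpa using h1, ⟨h4, h4⟩, h4, h4⟩
    exact ⟨⟨x, y, hI⟩, h2, h3, h5, h6, h7⟩
  · rintro ⟨⟨x, y, hI⟩, h2, h3, h5, h6, h7⟩
    have hs : ∀ b, b ∈ Δ.bottom ∨ b ∈ Δ.top → A.Spans b Δ := fun b hb =>
      hb.elim (fun hb => (h2 b hb).2) fun hb => (h3 b hb).2
    obtain ⟨h1, ⟨h4, -⟩, -⟩ := (h.overlap_aux hs hs).2 ⟨x, y, hI, hI⟩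
    simp only [← h.cuts_iff (fun b hb => (h2 b hb).2) fun b hb => (h3 b hb).2] at h7
    simp only [← h.spans_iff] at h2 h3
    simp only [← h.incident, ← hstrip] at h5 h6
    exact ⟨by simpa using h1, h2, h3, h4, h5, h6, h7⟩

theorem overlap_iff (h : G.IsShear A δ) {R R' : Finset (Fin n)} {Δ Δ' : Trapezoid m n}
    (hf : A.IsFace R Δ) (hf' : A.IsFace R' Δ') :
    G.Overlap Δ Δ' ↔ ∃ x y, A.Interior Δ x y ∧ A.Interior Δ' x y := by
  have aux : ∀ {R Δ}, A.IsFace R Δ → ∀ b, b ∈ Δ.bottom ∨ b ∈ Δ.top → A.Spans b Δ := fun hf b hb =>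
      hb.elim (fun hb => (hf.bottom b hb).2) fun hb => (hf.top b hb).2
  rw [← h.overlap_aux (aux hf) (aux hf')]
  have hg := (h.isFace_iff _ _).2 hf
  have hg' := (h.isFace_iff _ _).2 hf'
  exact ⟨fun ⟨h1, h2⟩ => ⟨h1, ⟨hg.bottom_below_top, hg'.bottom_below_top⟩, h2⟩,
    fun ⟨h1, _, h2⟩ => ⟨h1, h2⟩⟩

end IsShear

/-! ### Local changes of a trapezoidation, stated for drawings. -/

theorem mem_trapezoidation {R : Finset (Fin n)} {Δ : Trapezoid m n} :
    Δ ∈ G.trapezoidation R ↔ G.IsFace R Δ := by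
  simp [trapezoidation]

theorem mem_destroyed {R : Finset (Fin n)} {e : Fin n} {Δ : Trapezoid m n} :
    Δ ∈ G.destroyed R e ↔ G.IsFace R Δ ∧ ¬ G.IsFace (insert e R) Δ := by
  simp [destroyed, mem_trapezoidation]

theorem mem_created {R : Finset (Fin n)} {e : Fin n} {Δ : Trapezoid m n} :
    Δ ∈ G.created R e ↔ G.IsFace (insert e R) Δ ∧ ¬ G.IsFace R Δ := by
  simp [created, mem_trapezoidation]

/-- All clauses of `IsFace` except emptiness survive an insertion. -/
theorem cuts_of_mem_destroyed {R : Finset (Fin n)} {e : Fin n} {Δ : Trapezoid m n}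
    (h : Δ ∈ G.destroyed R e) : G.Cuts e Δ := by
  rw [mem_destroyed] at h
  obtain ⟨h, h'⟩ := h
  by_contra hc
  have aux : ∀ v, (∃ e ∈ R, G.Incident v e) → ∃ f ∈ insert e R, G.Incident v f :=
    fun v ⟨f, hf, hv⟩ => ⟨f, Finset.mem_insert_of_mem hf, hv⟩
  refine h' ⟨h.walls, fun f hf => ⟨Finset.mem_insert_of_mem (h.bottom f hf).1, (h.bottom f hf).2⟩,
    fun f hf => ⟨Finset.mem_insert_of_mem (h.top f hf).1, (h.top f hf).2⟩, h.bottom_below_top,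
    fun v hv => ⟨aux v (h.left v hv).1, (h.left v hv).2⟩,
    fun v hv => ⟨aux v (h.right v hv).1, (h.right v hv).2⟩, fun f hf => ?_⟩
  rcases Finset.mem_insert.1 hf with rfl | hf
  · exact hc
  · exact h.empty f hf

theorem card_created_overlap_le (hG : G.IsConnectedPlanarSubdivision) {R : Finset (Fin n)}
    {e : Fin n} {Δ : Trapezoid m n} (hΔ : Δ ∈ G.destroyed R e) :
    ((G.created R e).filter (G.Overlap Δ)).card ≤ 7 := by
  obtain ⟨A, δ, -, h, -⟩ := exists_isShear hG 0 0 0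
  have hf := (h.isFace_iff _ _).1 (mem_destroyed.1 hΔ).1
  have hcut := (h.cuts_iff (fun b hb => (hf.bottom b hb).2) (fun b hb => (hf.top b hb).2) e).1
    (cuts_of_mem_destroyed hΔ)
  refine hf.card_created_le hcut _ fun Δ' hΔ' => ?_
  rw [Finset.mem_filter, mem_created, h.isFace_iff, h.isFace_iff] at hΔ'
  exact ⟨hΔ'.1.1, hΔ'.1.2, (h.overlap_iff hf hΔ'.1.1).1 hΔ'.2⟩

/-- Every point of a created face lies in a destroyed face that overlaps it. -/
theorem exists_destroyed (hG : G.IsConnectedPlanarSubdivision) {R : Finset (Fin n)} {e : Fin n}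
    {Δ' : Trapezoid m n} (hΔ' : Δ' ∈ G.created R e) {p : Pt} (hp : p ∈ G.region Δ') :
    ∃ Δ ∈ G.destroyed R e, G.Overlap Δ Δ' ∧ p ∈ G.region Δ := by
  obtain ⟨A, δ, -, h, hc⟩ := exists_isShear hG p.1 p.2 p.2
  have hcp : G.Comparable δ p := hc p.2 (by simp)
  rw [mem_created, h.isFace_iff, h.isFace_iff] at hΔ'
  rw [h.mem_region_iff _ hcp] at hp
  obtain ⟨Δ, hf, ⟨x, y, hI', hI⟩, hr⟩ := hp.exists_face hΔ'.1.interior R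
  refine ⟨Δ, ?_, (h.overlap_iff hf hΔ'.1).2 ⟨x, y, hI, hI'⟩, (h.mem_region_iff _ hcp).2 hr⟩
  rw [mem_destroyed, h.isFace_iff, h.isFace_iff]
  refine ⟨hf, fun hf' => hΔ'.2 ?_⟩
  rwa [hΔ'.1.eq_of_interior hf' hI' hI]

theorem exists_face_of_mem_seg (hG : G.IsConnectedPlanarSubdivision) {R : Finset (Fin n)}
    {e : Fin n} (he : e ∈ R) {p : Pt} (hp : p ∈ G.seg e) :
    ∃ Δ, G.IsFace R Δ ∧ e ∈ Δ.top ∧ p ∈ G.region Δ := by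
  obtain ⟨A, δ, -, h, hc⟩ := exists_isShear hG p.1 p.2 p.2
  have hcp : G.Comparable δ p := hc p.2 (by simp)
  rw [h.mem_seg] at hp
  obtain ⟨Δ, hf, ht, hr⟩ := Arrangement.exists_face_top he hp.1
  rw [hp.2] at hr
  exact ⟨Δ, (h.isFace_iff _ _).2 hf, ht, (h.mem_region_iff _ hcp).2 hr⟩

/-- A vertical segment meets few faces of a trapezoidation, compared with the edges it meets. -/
theorem card_zone_le (hG : G.IsConnectedPlanarSubdivision) (R : Finset (Fin n)) {a b c : ℝ}
    (hbc : b ≤ c) :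
    ((G.trapezoidation R).filter fun Δ => (G.region Δ ∩ {a} ×ˢ Icc b c).Nonempty).card ≤
      1 + 14 * (R.filter fun e => (G.seg e ∩ {a} ×ˢ Icc b c).Nonempty).card := by
  obtain ⟨A, δ, hδ, h, hc⟩ := exists_isShear hG a b c
  have key := Arrangement.card_zone_le (A := A) (R := R) (a := a) hδ hbc (fun v y hy hvy => ?_)
    ((G.trapezoidation R).filter fun Δ => (G.region Δ ∩ {a} ×ˢ Icc b c).Nonempty) fun Δ hΔ => ?_
  · refine key.trans (add_le_add_right (Nat.mul_le_mul_left _ (Finset.card_le_card ?_)) _)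
    intro e he
    rw [Finset.mem_filter] at he ⊢
    obtain ⟨heR, y, hy, hs, hey⟩ := he
    refine ⟨heR, (a, y), ?_, by simp, hy⟩
    rw [h.mem_seg]
    exact ⟨hs, hey⟩
  -- Comparability excludes both strict inequalities between the vertex and the query point at its
  -- abscissa, so they coincide.
  · have hv := hc y hy v
    rw [h.X_eq] at hvy
    change shearX δ (G.pos v) = shearX δ (a, y) at hvy
    rw [hvy] at hv
    simp only [lt_irrefl, iff_false, not_lt] at hv
    have := toLex.injective (le_antisymm hv.2 hv.1)
    rw [h.Y_eq, this]
  · rw [Finset.mem_filter, mem_trapezoidation, h.isFace_iff] at hΔ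
    obtain ⟨hf, ⟨a', y⟩, hr, ha, hy⟩ := hΔ
    obtain rfl : a' = a := ha
    exact ⟨hf, y, hy, (h.mem_region_iff _ (hc y hy)).1 hr⟩

end Drawing

/-! ### Random permutations and backwards analysis. -/

theorem mem_insertedBefore {n : ℕ} {π : Equiv.Perm (Fin n)} {e f : Fin n} :
    f ∈ insertedBefore π e ↔ π f < π e := by
  simp [insertedBefore]

/-- The first `j + 1` elements of a permutation. -/
def insertedUpTo {n : ℕ} (π : Equiv.Perm (Fin n)) (j : Fin n) : Finset (Fin n) :=
  Finset.univ.filter fun f => π f ≤ j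

theorem mem_insertedUpTo {n : ℕ} {π : Equiv.Perm (Fin n)} {j f : Fin n} :
    f ∈ insertedUpTo π j ↔ π f ≤ j := by
  simp [insertedUpTo]

theorem insert_insertedBefore {n : ℕ} (π : Equiv.Perm (Fin n)) (e : Fin n) :
    insert e (insertedBefore π e) = insertedUpTo π (π e) := by
  ext f
  rw [Finset.mem_insert, mem_insertedBefore, mem_insertedUpTo, le_iff_lt_or_eq, or_comm,
    π.injective.eq_iff]

theorem insertedUpTo_swap {n : ℕ} (π : Equiv.Perm (Fin n)) {i j : Fin n} (h : i ≤ j) :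
    insertedUpTo (Equiv.swap i j * π) j = insertedUpTo π j := by
  ext f
  rw [mem_insertedUpTo, mem_insertedUpTo, Equiv.Perm.mul_apply, Equiv.swap_apply_def]
  split_ifs with h1 h2
  · simp [h1, h]
  · simp [h2, h]
  · rfl

theorem card_insertedUpTo {n : ℕ} (π : Equiv.Perm (Fin n)) (j : Fin n) :
    (insertedUpTo π j).card = j + 1 := by
  have : insertedUpTo π j = (Finset.Iic j).map π.symm.toEmbedding := by
    ext f
    simp [mem_insertedUpTo, Finset.mem_map_equiv]
  rw [this, Finset.card_map, Fin.card_Iic]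

/-- Each element of the prefix is equally likely to be its last one. -/
theorem sum_last_eq {n : ℕ} (g : Finset (Fin n) → Fin n → ℝ) (j : Fin n) :
    ((j : ℝ) + 1) * ∑ π : Equiv.Perm (Fin n), g (insertedUpTo π j) (π.symm j) =
      ∑ π : Equiv.Perm (Fin n), ∑ e ∈ insertedUpTo π j, g (insertedUpTo π j) e := by
  have h1 : ∀ i ∈ Finset.Iic j, ∑ π : Equiv.Perm (Fin n), g (insertedUpTo π j) (π.symm i) =
      ∑ π : Equiv.Perm (Fin n), g (insertedUpTo π j) (π.symm j) := by
    intro i hi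
    -- Exchanging two positions inside the prefix preserves it as a set and changes its last
    -- element.
    rw [← Equiv.sum_comp (Equiv.mulLeft (Equiv.swap i j))
      fun π : Equiv.Perm (Fin n) => g (insertedUpTo π j) (π.symm j)]
    refine Finset.sum_congr rfl fun π _ => ?_
    rw [Equiv.coe_mulLeft, insertedUpTo_swap π (Finset.mem_Iic.1 hi)]
    congr 1
    rw [← Equiv.Perm.inv_def, ← Equiv.Perm.inv_def, mul_inv_rev, Equiv.Perm.mul_apply,
      Equiv.swap_inv, Equiv.swap_apply_right]
  have h2 : ∀ π : Equiv.Perm (Fin n), ∑ e ∈ insertedUpTo π j, g (insertedUpTo π j) e =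
      ∑ i ∈ Finset.Iic j, g (insertedUpTo π j) (π.symm i) := by
    intro π
    have : insertedUpTo π j = (Finset.Iic j).map π.symm.toEmbedding := by
      ext f
      simp [mem_insertedUpTo, Finset.mem_map_equiv]
    conv_lhs => rw [this]
    rw [Finset.sum_map]
    simp only [← this]
    rfl
  simp only [h2]
  rw [Finset.sum_comm, Finset.sum_congr rfl h1, Finset.sum_const, Fin.card_Iic, nsmul_eq_mul]
  push_cast
  rfl

/-- By symmetry all elements are equally likely to be in the prefix of size `j + 1`; taking all of
`Fin n` for the set identifies the probability as `(j + 1) / n`. -/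
theorem sum_card_filter_insertedUpTo {n : ℕ} (K : Finset (Fin n)) (j : Fin n) :
    (n : ℝ) * ∑ π : Equiv.Perm (Fin n), (((insertedUpTo π j).filter (· ∈ K)).card : ℝ) =
      ((j : ℝ) + 1) * K.card * Fintype.card (Equiv.Perm (Fin n)) := by
  have hc : ∀ (L : Finset (Fin n)), ∑ π : Equiv.Perm (Fin n),
      (((insertedUpTo π j).filter (· ∈ L)).card : ℝ) =
        ∑ e ∈ L, ∑ π : Equiv.Perm (Fin n), if π e ≤ j then (1 : ℝ) else 0 := by
    intro L
    rw [Finset.sum_comm]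
    refine Finset.sum_congr rfl fun π _ => ?_
    rw [← Finset.sum_filter, Finset.sum_const, nsmul_eq_mul, mul_one]
    congr 2
    ext f
    simp [mem_insertedUpTo, and_comm]
  have hsymm : ∀ e e' : Fin n, (∑ π : Equiv.Perm (Fin n), if π e ≤ j then (1 : ℝ) else 0) =
      ∑ π : Equiv.Perm (Fin n), if π e' ≤ j then (1 : ℝ) else 0 := by
    intro e e'
    rw [← Equiv.sum_comp (Equiv.mulRight (Equiv.swap e e'))
      fun π : Equiv.Perm (Fin n) => if π e' ≤ j then (1 : ℝ) else 0]
    refine Finset.sum_congr rfl fun π _ => ?_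
    simp
  have hone : ∀ e : Fin n, (n : ℝ) * ∑ π : Equiv.Perm (Fin n), (if π e ≤ j then (1 : ℝ) else 0) =
      ((j : ℝ) + 1) * Fintype.card (Equiv.Perm (Fin n)) := by
    intro e
    have h1 := hc Finset.univ
    rw [Finset.sum_congr rfl fun e' _ => hsymm e' e] at h1
    simp only [Finset.mem_univ, Finset.filter_true, card_insertedUpTo, Finset.sum_const,
      nsmul_eq_mul, Finset.card_univ, Fintype.card_fin] at h1
    rw [← h1]
    push_cast
    ring
  rw [hc, Finset.mul_sum, Finset.sum_congr rfl fun e _ => hone e, Finset.sum_const, nsmul_eq_mul]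
  ring

/-- Backwards analysis of a randomized incremental construction: if the costs of removing the single
elements of `R` sum up to at most `c + d |R ∩ K|`, then the expected total cost is at most
`c (1 + log n) + d |K|`. -/
theorem sum_perm_cost_le {n : ℕ} (hn : 0 < n) (g : Finset (Fin n) → Fin n → ℝ) {c d : ℝ}
    (hc : 0 ≤ c) (K : Finset (Fin n))
    (hg : ∀ R, ∑ e ∈ R, g R e ≤ c + d * (R.filter (· ∈ K)).card) :
    ∑ π : Equiv.Perm (Fin n), ∑ e, g (insert e (insertedBefore π e)) e ≤
      Fintype.card (Equiv.Perm (Fin n)) * (c * (1 + Real.log n) + d * K.card) := by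
  have hn' : (0 : ℝ) < n := by exact_mod_cast hn
  set N := (Fintype.card (Equiv.Perm (Fin n)) : ℝ) with hN
  have hN0 : 0 ≤ N := by positivity
  have h1 : ∀ π : Equiv.Perm (Fin n), ∑ e, g (insert e (insertedBefore π e)) e =
      ∑ j, g (insertedUpTo π j) (π.symm j) := by
    intro π
    rw [← Equiv.sum_comp π fun j => g (insertedUpTo π j) (π.symm j)]
    refine Finset.sum_congr rfl fun e _ => ?_
    rw [insert_insertedBefore, Equiv.symm_apply_apply]
  -- Averaging over the last element divides by `j + 1`. This cancels against the expected size of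
  -- the prefix within `K`, so the second term does not depend on `j`.
  have h2 : ∀ j : Fin n, ∑ π : Equiv.Perm (Fin n), g (insertedUpTo π j) (π.symm j) ≤
      N * c * ((j : ℝ) + 1)⁻¹ + N * d * K.card / n := by
    intro j
    have hj : (0 : ℝ) < (j : ℝ) + 1 := by positivity
    have h3 : ∑ π : Equiv.Perm (Fin n), ∑ e ∈ insertedUpTo π j, g (insertedUpTo π j) e ≤
        N * c + d * (((j : ℝ) + 1) * K.card * N / n) := by
      refine (Finset.sum_le_sum fun π _ => hg (insertedUpTo π j)).trans_eq ?_
      rw [Finset.sum_add_distrib, ← Finset.mul_sum, Finset.sum_const, nsmul_eq_mul,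
        ← sum_card_filter_insertedUpTo K j, Finset.card_univ]
      field_simp
      rw [hN]
      ring
    rw [← sum_last_eq, mul_comm, ← le_div_iff₀ hj] at h3
    refine h3.trans_eq ?_
    field_simp
  simp only [h1]
  rw [Finset.sum_comm]
  refine (Finset.sum_le_sum fun j _ => h2 j).trans ?_
  rw [Finset.sum_add_distrib, ← Finset.mul_sum, Finset.sum_const, Finset.card_univ,
    Fintype.card_fin, nsmul_eq_mul]
  have h4 : ∑ j : Fin n, ((j : ℝ) + 1)⁻¹ ≤ 1 + Real.log n := by
    rw [Fin.sum_univ_eq_sum_range fun j : ℕ => ((j : ℝ) + 1)⁻¹]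
    refine le_trans (le_of_eq ?_) (harmonic_le_one_add_log n)
    simp [harmonic]
  have h5 := mul_le_mul_of_nonneg_left h4 (mul_nonneg hN0 hc)
  have h6 : (n : ℝ) * (N * d * K.card / n) = N * d * K.card := by field_simp
  rw [h6]
  linarith

/-! ### The expected number of search nodes on a vertical segment. -/

namespace Drawing

variable {m n : ℕ} {G : Drawing m n}

/-- A face disappears only upon the removal of one of at most five edges. -/
theorem card_defining_le {R : Finset (Fin n)} {Δ : Trapezoid m n} (h : G.IsFace R Δ) :
    (R.filter fun e => ¬ G.IsFace (R.erase e) Δ).card ≤ 5 := by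
  have hw : ∀ s, ∀ v ∈ Δ.wall s, (∃ e ∈ R, G.Incident v e) := by
    rintro (_ | _) v hv
    · exact (h.left v hv).1
    · exact (h.right v hv).1
  -- Four kinds: a floor, or the only edge of `R` at a wall vertex. A wall vertex with several edges
  -- survives each single removal.
  refine card_le_of_kinds (κ := Bool ⊕ Bool) _ ({()} : Finset Unit) (fun _ => False)
    (fun k _ e => match k with
      | .inl u => e ∈ Δ.floor u
      | .inr s => ∃ v ∈ Δ.wall s, ∀ f ∈ R, G.Incident v f → f = e) (by simp) ?_ ?_
  · rintro (u | s) - e - f - he hf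
    · exact Option.mem_unique he hf
    · obtain ⟨v, hv, h1⟩ := he
      obtain ⟨w, hw', h2⟩ := hf
      obtain ⟨g, hg, hgv⟩ := hw s v hv
      rw [← Option.mem_unique hv hw'] at h2
      exact (h1 g hg hgv).symm.trans (h2 g hg hgv)
  · intro e he
    rw [Finset.mem_filter] at he
    by_contra! hc
    obtain ⟨-, hc⟩ := hc
    have hf : ∀ u, e ∉ Δ.floor u := fun u => hc (.inl u) () (by simp)
    have hw' : ∀ s, ∀ v ∈ Δ.wall s, ∃ f ∈ R.erase e, G.Incident v f := by
      intro s v hv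
      have := hc (.inr s) () (by simp)
      push Not at this
      obtain ⟨f, hf, hvf, hne⟩ := this v hv
      exact ⟨f, Finset.mem_erase.2 ⟨hne, hf⟩, hvf⟩
    refine he.2 ⟨h.walls, fun f hf' => ⟨Finset.mem_erase.2 ⟨?_, (h.bottom f hf').1⟩, (h.bottom f hf').2⟩,
      fun f hf' => ⟨Finset.mem_erase.2 ⟨?_, (h.top f hf').1⟩, (h.top f hf').2⟩, h.bottom_below_top,
      fun v hv => ⟨hw' false v hv, (h.left v hv).2⟩,
      fun v hv => ⟨hw' true v hv, (h.right v hv).2⟩, fun f hf' => h.empty f (Finset.mem_of_mem_erase hf')⟩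
    · rintro rfl
      exact hf false hf'
    · rintro rfl
      exact hf true hf'

/-- The nodes of the search DAG. -/
def history (G : Drawing m n) (π : Equiv.Perm (Fin n)) : Finset (Trapezoid m n) :=
  Finset.univ.filter fun Δ =>
    Δ = ⟨none, none, none, none⟩ ∨ ∃ e, Δ ∈ G.created (insertedBefore π e) e

/-- The expected number of nodes met by a vertical query segment. -/
theorem sum_card_history_le (hG : G.IsConnectedPlanarSubdivision) (hn : 0 < n) {a b c : ℝ}
    (hbc : b ≤ c) :
    ∑ π : Equiv.Perm (Fin n),
      (((G.history π).filter fun Δ => (G.region Δ ∩ {a} ×ˢ Icc b c).Nonempty).card : ℝ) ≤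
      Fintype.card (Equiv.Perm (Fin n)) * (1 + (5 * (1 + Real.log n) + 70 *
        (Finset.univ.filter fun e => (G.seg e ∩ {a} ×ˢ Icc b c).Nonempty).card)) := by
  set q : Set Pt := {a} ×ˢ Icc b c with hq
  -- The cost is the number of faces on the query that removing `e` would undo. Summed over `R`,
  -- each face counts at most five times, whence 5 and 70 = 5 · 14.
  let g : Finset (Fin n) → Fin n → ℝ := fun R e =>
    (((G.created (R.erase e) e).filter fun Δ => (G.region Δ ∩ q).Nonempty).card : ℝ)
  have hg : ∀ R, ∑ e ∈ R, g R e ≤ 5 + 70 *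
      ((R.filter (· ∈ Finset.univ.filter fun e => (G.seg e ∩ q).Nonempty)).card : ℝ) := by
    intro R
    have h1 : ∑ e ∈ R, ((G.created (R.erase e) e).filter fun Δ => (G.region Δ ∩ q).Nonempty).card ≤
        ((G.trapezoidation R).filter fun Δ => (G.region Δ ∩ q).Nonempty).card * 5 := by
      rw [← smul_eq_mul]
      calc _ ≤ ∑ e ∈ R, (((G.trapezoidation R).filter fun Δ => (G.region Δ ∩ q).Nonempty).filter
            fun Δ => ¬ G.IsFace (R.erase e) Δ).card := by
            refine Finset.sum_le_sum fun e he => Finset.card_le_card fun Δ hΔ => ?_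
            simp only [Finset.mem_filter, mem_created, mem_trapezoidation,
              Finset.insert_erase he] at hΔ ⊢
            exact ⟨⟨hΔ.1.1, hΔ.2⟩, hΔ.1.2⟩
        _ = ∑ Δ ∈ (G.trapezoidation R).filter fun Δ => (G.region Δ ∩ q).Nonempty,
            (R.filter fun e => ¬ G.IsFace (R.erase e) Δ).card :=
            Finset.sum_card_bipartiteAbove_eq_sum_card_bipartiteBelow _
        _ ≤ _ := Finset.sum_le_card_nsmul _ _ _ fun Δ hΔ =>
            card_defining_le (mem_trapezoidation.1 (Finset.mem_filter.1 hΔ).1)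
    have h2 := card_zone_le hG R (a := a) hbc
    have h3 : R.filter (· ∈ Finset.univ.filter fun e => (G.seg e ∩ q).Nonempty) =
        R.filter fun e => (G.seg e ∩ q).Nonempty := by
      ext
      simp
    rw [h3]
    have h4 := h1.trans (Nat.mul_le_mul_right 5 h2)
    have h5 : ((∑ e ∈ R, ((G.created (R.erase e) e).filter fun Δ =>
        (G.region Δ ∩ q).Nonempty).card : ℕ) : ℝ) ≤ _ := Nat.cast_le.2 h4
    push_cast at h5
    simp only [g]
    linarith
  have key := sum_perm_cost_le hn g (by norm_num) _ hg
  have hπ : ∀ π : Equiv.Perm (Fin n),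
      (((G.history π).filter fun Δ => (G.region Δ ∩ q).Nonempty).card : ℝ) ≤
        1 + ∑ e, g (insert e (insertedBefore π e)) e := by
    intro π
    have hsub : (G.history π).filter (fun Δ => (G.region Δ ∩ q).Nonempty) ⊆
        {⟨none, none, none, none⟩} ∪ Finset.univ.biUnion fun e =>
          (G.created (insertedBefore π e) e).filter fun Δ => (G.region Δ ∩ q).Nonempty := by
      intro Δ hΔ
      simp only [history, Finset.mem_filter, Finset.mem_univ, true_and, Finset.mem_union,
        Finset.mem_singleton, Finset.mem_biUnion] at hΔ ⊢
      obtain ⟨h | ⟨e, he⟩, h'⟩ := hΔ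
      · exact .inl h
      · exact .inr ⟨e, he, h'⟩
    have h1 := (Finset.card_le_card hsub).trans ((Finset.card_union_le _ _).trans
      (Nat.add_le_add_left Finset.card_biUnion_le _))
    rw [Finset.card_singleton] at h1
    have h2 : (((G.history π).filter fun Δ => (G.region Δ ∩ q).Nonempty).card : ℝ) ≤
      ((1 + ∑ e, ((G.created (insertedBefore π e) e).filter fun Δ =>
        (G.region Δ ∩ q).Nonempty).card : ℕ) : ℝ) := by exact_mod_cast h1
    refine h2.trans_eq ?_
    push_cast
    congr 1
    refine Finset.sum_congr rfl fun e _ => ?_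
    simp only [g]
    rw [Finset.erase_insert (by simp [mem_insertedBefore])]
  refine (Finset.sum_le_sum fun π _ => hπ π).trans ?_
  rw [Finset.sum_add_distrib, Finset.sum_const, nsmul_eq_mul, mul_one, Finset.card_univ]
  linarith

end Drawing

/-! ### Degrees and reachability in the search DAG. -/

namespace Drawing

variable {m n : ℕ} {G : Drawing m n}

/-- A face of `R` is cut by no edge of `R`, but a destroyed face is cut by the new edge. -/
theorem not_mem_destroyed_of_isFace {R R' : Finset (Fin n)} {e : Fin n} {Δ : Trapezoid m n}
    (h : G.IsFace R Δ) (he : e ∈ R) : Δ ∉ G.destroyed R' e :=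
  fun h' => h.empty e he (cuts_of_mem_destroyed h')

/-- Nodes are named by trapezoids alone. This ensures that all children of a node come from one
insertion, so the bound per insertion bounds the degree. -/
theorem destroyed_unique {π : Equiv.Perm (Fin n)} {Δ : Trapezoid m n} {e e' : Fin n}
    (h : Δ ∈ G.destroyed (insertedBefore π e) e)
    (h' : Δ ∈ G.destroyed (insertedBefore π e') e') : e = e' := by
  rcases lt_trichotomy (π e) (π e') with hlt | heq | hlt
  · exact absurd h (not_mem_destroyed_of_isFace (mem_destroyed.1 h').1 (mem_insertedBefore.2 hlt))
  · exact π.injective heq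
  · exact absurd h' (not_mem_destroyed_of_isFace (mem_destroyed.1 h).1 (mem_insertedBefore.2 hlt))

theorem mem_children {π : Equiv.Perm (Fin n)} {Δ Δ' : Trapezoid m n} :
    Δ' ∈ (G.tsd π).children Δ ↔ ∃ e, Δ ∈ G.destroyed (insertedBefore π e) e ∧
      Δ' ∈ G.created (insertedBefore π e) e ∧ G.Overlap Δ Δ' := by
  simp [tsd]

theorem length_children_le (hG : G.IsConnectedPlanarSubdivision) (π : Equiv.Perm (Fin n))
    (Δ : Trapezoid m n) : ((G.tsd π).children Δ).length ≤ 7 := by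
  by_cases h : ∃ e, Δ ∈ G.destroyed (insertedBefore π e) e
  · obtain ⟨e, he⟩ := h
    refine le_trans ?_ (card_created_overlap_le hG he)
    simp only [tsd, Finset.length_toList]
    refine Finset.card_le_card fun Δ' hΔ' => ?_
    simp only [Finset.mem_filter, Finset.mem_univ, true_and] at hΔ' ⊢
    obtain ⟨e', h1, h2⟩ := hΔ'
    rw [destroyed_unique he h1]
    exact h2
  · have : (G.tsd π).children Δ = [] := by
      refine List.eq_nil_iff_forall_not_mem.2 fun Δ' hΔ' => ?_
      obtain ⟨e, he, -⟩ := mem_children.1 hΔ'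
      exact h ⟨e, he⟩
    simp [this]

theorem children_eq_nil {π : Equiv.Perm (Fin n)} {Δ : Trapezoid m n}
    (h : G.IsFace Finset.univ Δ) : (G.tsd π).children Δ = [] := by
  refine List.eq_nil_iff_forall_not_mem.2 fun Δ' hΔ' => ?_
  obtain ⟨e, he, -⟩ := mem_children.1 hΔ'
  exact not_mem_destroyed_of_isFace h (Finset.mem_univ e) he

theorem root_mem_history (π : Equiv.Perm (Fin n)) : (G.tsd π).root ∈ G.history π := by
  simp [history, tsd]

theorem children_mem_history {π : Equiv.Perm (Fin n)} {Δ Δ' : Trapezoid m n}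
    (h : Δ' ∈ (G.tsd π).children Δ) : Δ' ∈ G.history π := by
  obtain ⟨e, -, he, -⟩ := mem_children.1 h
  simp only [history, Finset.mem_filter, Finset.mem_univ, true_and]
  exact .inr ⟨e, he⟩

theorem eq_root_of_isFace_empty {Δ : Trapezoid m n} (h : G.IsFace ∅ Δ) :
    Δ = ⟨none, none, none, none⟩ := by
  obtain ⟨b, t, l, r⟩ := Δ
  rw [Trapezoid.mk.injEq]
  refine ⟨?_, ?_, ?_, ?_⟩ <;> refine Option.eq_none_iff_forall_not_mem.2 fun x hx => ?_
  · exact absurd (h.bottom x hx).1 (Finset.notMem_empty _)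
  · exact absurd (h.top x hx).1 (Finset.notMem_empty _)
  · obtain ⟨⟨e, he, -⟩, -⟩ := h.left x hx
    exact absurd he (Finset.notMem_empty _)
  · obtain ⟨⟨e, he, -⟩, -⟩ := h.right x hx
    exact absurd he (Finset.notMem_empty _)

/-- A set of nodes which contains the root and, with a node, all its children that contain one of
the points in `q`, contains all nodes of the search DAG that meet `q`. -/
theorem face_mem_of_closed (hG : G.IsConnectedPlanarSubdivision) (π : Equiv.Perm (Fin n))
    {q : Set Pt} {M : Trapezoid m n → Prop}
    (hroot : (G.region (G.tsd π).root ∩ q).Nonempty → M (G.tsd π).root)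
    (hchild : ∀ Δ, M Δ → ∀ Δ' ∈ (G.tsd π).children Δ, (G.region Δ' ∩ q).Nonempty → M Δ')
    (r : ℕ) : ∀ Δ, G.IsFace (Finset.univ.filter fun f => (π f : ℕ) < r) Δ →
      (G.region Δ ∩ q).Nonempty → M Δ := by
  induction r with
  | zero =>
    intro Δ hΔ hq
    have : Δ = (G.tsd π).root := eq_root_of_isFace_empty (by simpa using hΔ)
    subst this
    exact hroot hq
  | succ r ih =>
    intro Δ hΔ hq
    by_cases hΔ' : G.IsFace (Finset.univ.filter fun f => (π f : ℕ) < r) Δ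
    · exact ih Δ hΔ' hq
    by_cases hr : r < n
    · obtain ⟨e, he⟩ : ∃ e, π e = ⟨r, hr⟩ := π.surjective _
      have hb : (Finset.univ.filter fun f => (π f : ℕ) < r) = insertedBefore π e := by
        ext f
        simp [mem_insertedBefore, he, Fin.lt_def]
      have hb' : (Finset.univ.filter fun f => (π f : ℕ) < r + 1) = insert e (insertedBefore π e) := by
        rw [insert_insertedBefore]
        ext f
        simp [mem_insertedUpTo, he, Fin.le_def]
      rw [hb] at hΔ' ih
      rw [hb'] at hΔ
      obtain ⟨p, hp, hpq⟩ := hq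
      have hc : Δ ∈ G.created (insertedBefore π e) e := mem_created.2 ⟨hΔ, hΔ'⟩
      -- The parent contains the same point of `q`, so the search is not cut off there.
      obtain ⟨Δ₀, h1, h2, h3⟩ := exists_destroyed hG hc hp
      exact hchild Δ₀ (ih Δ₀ (mem_destroyed.1 h1).1 ⟨p, h3, hpq⟩) Δ
        (mem_children.2 ⟨e, h1, hc, h2⟩) ⟨p, hp, hpq⟩
    · have hb : (Finset.univ.filter fun f => (π f : ℕ) < r) =
          Finset.univ.filter fun f => (π f : ℕ) < r + 1 := by
        refine Finset.filter_congr fun f _ => ?_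
        have := (π f).2
        omega
      rw [hb] at hΔ'
      exact absurd hΔ hΔ'

end Drawing

/-! ### A potential that bounds the running time. -/

namespace State

variable {m n : ℕ} (G : Drawing m n) (W : Window) (D : Side → SearchDag m n)

theorem enqueue_stack (v : Fin m) (s : State m n) : (enqueue G W v s).stack = s.stack := by
  unfold enqueue; split_ifs <;> rfl
theorem enqueue_nodeMarks (v : Fin m) (s : State m n) :
    (enqueue G W v s).nodeMarks = s.nodeMarks := by
  unfold enqueue; split_ifs <;> rfl
theorem enqueue_scan (v : Fin m) (s : State m n) : (enqueue G W v s).scan = s.scan := by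
  unfold enqueue; split_ifs <;> rfl
theorem enqueue_edgeMarks (v : Fin m) (s : State m n) :
    (enqueue G W v s).edgeMarks = s.edgeMarks := by
  unfold enqueue; split_ifs <;> rfl
theorem enqueue_output (v : Fin m) (s : State m n) : (enqueue G W v s).output = s.output := by
  unfold enqueue; split_ifs <;> rfl

theorem checkEdge_stack (e : Fin n) (s : State m n) : (checkEdge G W e s).stack = s.stack := by
  unfold checkEdge; split_ifs <;> simp [enqueue_stack]
theorem checkEdge_nodeMarks (e : Fin n) (s : State m n) :
    (checkEdge G W e s).nodeMarks = s.nodeMarks := by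
  unfold checkEdge; split_ifs <;> simp [enqueue_nodeMarks]
theorem checkEdge_scan (e : Fin n) (s : State m n) : (checkEdge G W e s).scan = s.scan := by
  unfold checkEdge; split_ifs <;> simp [enqueue_scan]

theorem checkBoundary_stack (o : Option (Fin n)) (s : State m n) :
    (checkBoundary G W o s).stack = s.stack := by
  cases o
  · rfl
  · exact checkEdge_stack G W _ s
theorem checkBoundary_nodeMarks (o : Option (Fin n)) (s : State m n) :
    (checkBoundary G W o s).nodeMarks = s.nodeMarks := by
  cases o
  · rfl
  · exact checkEdge_nodeMarks G W _ s
theorem checkBoundary_scan (o : Option (Fin n)) (s : State m n) :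
    (checkBoundary G W o s).scan = s.scan := by
  cases o
  · rfl
  · exact checkEdge_scan G W _ s

/-- The vertices inside the window that have an edge. -/
def windowVertices : Finset (Fin m) :=
  Finset.univ.filter fun v => G.pos v ∈ W.toSet ∧ ∃ e, G.Incident v e

/-- The work left in the queue and at unmarked vertices. -/
def vertexWork (s : State m n) : ℕ :=
  (s.queue.map fun v => (G.incidenceList v).length + 1).sum +
    ∑ v ∈ windowVertices G W \ s.vertexMarks, ((G.incidenceList v).length + 1)

/-- Marking moves the summand of `v` from the unmarked vertices to the queue; incidence with `e`
guarantees that `v` was counted there. -/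
theorem vertexWork_enqueue {v : Fin m} {e : Fin n} (h : G.Incident v e) (s : State m n) :
    vertexWork G W (enqueue G W v s) = vertexWork G W s := by
  unfold enqueue
  split_ifs with hv
  · have hmem : v ∈ windowVertices G W \ s.vertexMarks := by
      simp only [windowVertices, Finset.mem_sdiff, Finset.mem_filter, Finset.mem_univ, true_and]
      exact ⟨⟨hv.1, e, h⟩, hv.2⟩
    unfold vertexWork
    simp only [List.map_append, List.map_cons, List.map_nil, List.sum_append, List.sum_cons,
      List.sum_nil]
    rw [Finset.sdiff_insert, ← Finset.add_sum_erase _ _ hmem]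
    omega
  · rfl

theorem vertexWork_checkEdge (e : Fin n) (s : State m n) :
    vertexWork G W (checkEdge G W e s) = vertexWork G W s := by
  unfold checkEdge
  split_ifs
  · rw [vertexWork_enqueue (e := e) G W (Or.inr rfl), vertexWork_enqueue (e := e) G W (Or.inl rfl)]
    rfl
  · rfl

theorem vertexWork_checkBoundary (o : Option (Fin n)) (s : State m n) :
    vertexWork G W (checkBoundary G W o s) = vertexWork G W s := by
  cases o
  · rfl
  · exact vertexWork_checkEdge G W _ s

/-- The nodes from `H` whose regions meet the query segments. -/
def queryNodes (H : Finset (Side × Trapezoid m n)) : Finset (Side × Trapezoid m n) :=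
  H.filter fun x => ((D x.1).region x.2 ∩ W.query x.1).Nonempty

/-- The work left on the stack and at unmarked nodes. -/
def nodeWork (H : Finset (Side × Trapezoid m n)) (s : State m n) : ℕ :=
  (s.stack.map fun x => x.2.length + 1).sum +
    ∑ x ∈ queryNodes W D H \ s.nodeMarks, (((D x.1).children x.2).length + 1)

/-- An upper bound for the number of transitions left. -/
def work (H : Finset (Side × Trapezoid m n)) (s : State m n) : ℕ :=
  nodeWork W D H s + s.scan.length + vertexWork G W s

/-- The stack contains nodes in `H` only. -/
def StackIn (H : Finset (Side × Trapezoid m n)) (s : State m n) : Prop :=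
  ∀ x ∈ s.stack, ∀ Δ ∈ x.2, (x.1, Δ) ∈ H

variable {G W D}

/-- The summand released by marking a node pays exactly for the list of children pushed onto the
stack. -/
theorem work_visitNode {H : Finset (Side × Trapezoid m n)} {σ : Side} {Δ : Trapezoid m n}
    (hΔ : (σ, Δ) ∈ H) (s : State m n) : work G W D H (visitNode G W D σ Δ s) ≤ work G W D H s := by
  unfold visitNode
  split_ifs with h
  · have hmem : (σ, Δ) ∈ queryNodes W D H \ s.nodeMarks := by
      simp only [queryNodes, Finset.mem_sdiff, Finset.mem_filter]
      exact ⟨⟨hΔ, h.2⟩, h.1⟩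
    simp only
    split
    · next hc =>
      unfold work nodeWork
      rw [vertexWork_checkBoundary, vertexWork_checkBoundary]
      simp only [checkBoundary_stack, checkBoundary_nodeMarks, checkBoundary_scan]
      rw [Finset.sdiff_insert, ← Finset.add_sum_erase _ _ hmem]
      have : vertexWork G W { s with nodeMarks := insert (σ, Δ) s.nodeMarks } = vertexWork G W s :=
        rfl
      omega
    · next c cs hc =>
      unfold work nodeWork
      simp only [List.map_cons, List.sum_cons]
      rw [Finset.sdiff_insert, ← Finset.add_sum_erase _ _ hmem]
      simp only [hc]
      have : vertexWork G W { s with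
        nodeMarks := insert (σ, Δ) s.nodeMarks, stack := (σ, c :: cs) :: s.stack } =
          vertexWork G W s := rfl
      omega
  · exact le_rfl

theorem stackIn_visitNode {H : Finset (Side × Trapezoid m n)}
    (hH : ∀ σ Δ, ∀ Δ' ∈ (D σ).children Δ, (σ, Δ') ∈ H) {σ : Side} {Δ : Trapezoid m n}
    {s : State m n} (hs : StackIn H s) : StackIn H (visitNode G W D σ Δ s) := by
  unfold visitNode
  split_ifs with h
  · simp only
    split
    · unfold StackIn
      rw [checkBoundary_stack, checkBoundary_stack]
      exact hs
    · next c cs hc =>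
      intro x hx Δ' hΔ'
      rcases List.mem_cons.1 hx with rfl | hx
      · exact hH σ Δ Δ' (hc ▸ hΔ')
      · exact hs x hx Δ' hΔ'
  · exact hs

/-- Every transition reduces the work left. -/
theorem work_step {H : Finset (Side × Trapezoid m n)}
    (hH : ∀ σ Δ, ∀ Δ' ∈ (D σ).children Δ, (σ, Δ') ∈ H) {s : State m n} (hs : StackIn H s)
    (hh : ¬ s.Halted) :
    StackIn H (step G W D s) ∧ work G W D H (step G W D s) + 1 ≤ work G W D H s := by
  obtain ⟨stack, nodeMarks, scan, queue, vertexMarks, edgeMarks, output⟩ := s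
  rcases stack with _ | ⟨⟨σ, _ | ⟨Δ, rest⟩⟩, st⟩
  · rcases scan with _ | ⟨e, es⟩
    · rcases queue with _ | ⟨v, vs⟩
      · exact absurd ⟨rfl, rfl, rfl⟩ hh
      · refine ⟨fun x hx => absurd hx List.not_mem_nil, ?_⟩
        simp only [step, work, nodeWork, vertexWork, List.map_cons, List.sum_cons, List.length_nil]
        omega
    · refine ⟨?_, ?_⟩
      · simp only [step, StackIn, checkEdge_stack]
        exact hs
      · simp only [step, work, nodeWork, checkEdge_stack, checkEdge_nodeMarks, checkEdge_scan,
          vertexWork_checkEdge, List.length_cons]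
        have : vertexWork G W ⟨[], nodeMarks, es, queue, vertexMarks, edgeMarks, output⟩ =
          vertexWork G W ⟨[], nodeMarks, e :: es, queue, vertexMarks, edgeMarks, output⟩ := rfl
        omega
  · refine ⟨fun x hx => hs x (List.mem_cons_of_mem _ hx), ?_⟩
    simp only [step, work, nodeWork, List.map_cons, List.sum_cons, List.length_nil]
    have : vertexWork G W ⟨st, nodeMarks, scan, queue, vertexMarks, edgeMarks, output⟩ =
      vertexWork G W ⟨(σ, []) :: st, nodeMarks, scan, queue, vertexMarks, edgeMarks, output⟩ := rfl
    omega
  · have hΔ : (σ, Δ) ∈ H := hs (σ, Δ :: rest) (by simp) Δ (by simp)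
    refine ⟨?_, ?_⟩
    · refine stackIn_visitNode hH ?_
      intro x hx Δ' hΔ'
      rcases List.mem_cons.1 hx with rfl | hx
      · exact hs (σ, Δ :: rest) (by simp) Δ' (List.mem_cons_of_mem _ hΔ')
      · exact hs x (List.mem_cons_of_mem _ hx) Δ' hΔ'
    -- The transition itself is paid for by removing `Δ` from the list on top of the stack.
    · refine (Nat.add_le_add_right (work_visitNode hΔ _) 1).trans ?_
      simp only [work, nodeWork, List.map_cons, List.sum_cons, List.length_cons]
      have : vertexWork G W ⟨(σ, rest) :: st, nodeMarks, scan, queue, vertexMarks, edgeMarks,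
          output⟩ = vertexWork G W ⟨(σ, Δ :: rest) :: st, nodeMarks, scan, queue, vertexMarks,
            edgeMarks, output⟩ := rfl
      omega

theorem exists_halted {H : Finset (Side × Trapezoid m n)}
    (hH : ∀ σ Δ, ∀ Δ' ∈ (D σ).children Δ, (σ, Δ') ∈ H) (N : ℕ) (s : State m n)
    (hs : StackIn H s) (hN : work G W D H s ≤ N) :
    ∃ t ≤ N, ((step G W D)^[t] s).Halted := by
  induction N generalizing s with
  | zero =>
    refine ⟨0, le_rfl, ?_⟩
    by_contra hh
    have := (work_step (G := G) (W := W) hH hs hh).2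
    omega
  | succ N ih =>
    by_cases hh : s.Halted
    · exact ⟨0, Nat.zero_le _, hh⟩
    · obtain ⟨h1, h2⟩ := work_step (G := G) (W := W) hH hs hh
      obtain ⟨t, ht, h⟩ := ih (step G W D s) h1 (by omega)
      exact ⟨t + 1, by omega, h⟩

/-- All edges at a vertex in the window meet the window, and there is at least one, so degree plus
one is at most twice the degree. Two ends per edge give the factor four. -/
theorem sum_windowVertices_le :
    ∑ v ∈ windowVertices G W, ((G.incidenceList v).length + 1) ≤
      4 * (Finset.univ.filter fun e => Meets G W e).card := by
  have h1 : ∀ v ∈ windowVertices G W, (G.incidenceList v).length + 1 ≤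
      2 * ((Finset.univ.filter fun e => Meets G W e).filter fun e => G.Incident v e).card := by
    intro v hv
    simp only [windowVertices, Finset.mem_filter, Finset.mem_univ, true_and] at hv
    obtain ⟨hvW, e, he⟩ := hv
    have hmeet : ∀ f, G.Incident v f → Meets G W f := by
      rintro f (rfl | rfl)
      · exact ⟨_, left_mem_segment ℝ _ _, hvW⟩
      · exact ⟨_, right_mem_segment ℝ _ _, hvW⟩
    have h2 : (Finset.univ.filter fun e => Meets G W e).filter (fun e => G.Incident v e) =
        Finset.univ.filter fun e => G.Incident v e := by
      ext f
      simp only [Finset.mem_filter, Finset.mem_univ, true_and]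
      exact ⟨fun h => h.2, fun h => ⟨hmeet f h, h⟩⟩
    have h3 : 0 < (Finset.univ.filter fun e => G.Incident v e).card :=
      Finset.card_pos.2 ⟨e, by simpa using he⟩
    rw [h2, Drawing.incidenceList, Finset.length_toList]
    omega
  refine (Finset.sum_le_sum h1).trans ?_
  have h3 := Finset.sum_card_bipartiteAbove_eq_sum_card_bipartiteBelow G.Incident
    (s := windowVertices G W) (t := Finset.univ.filter fun e => Meets G W e)
  unfold Finset.bipartiteAbove Finset.bipartiteBelow at h3
  rw [← Finset.mul_sum, h3]
  have h4 : ∀ e ∈ Finset.univ.filter (fun e => Meets G W e),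
      ((windowVertices G W).filter fun v => G.Incident v e).card ≤ 2 := by
    intro e _
    refine (Finset.card_le_card (t := {(G.ends e).1, (G.ends e).2}) fun v hv => ?_).trans
      Finset.card_le_two
    simpa [Drawing.Incident] using (Finset.mem_filter.1 hv).2
  have := Finset.sum_le_card_nsmul _ _ _ h4
  rw [smul_eq_mul] at this
  omega

/-- The four stack entries with one root each count 2 apiece, and the fixed edge counts 1, together
9; an unmarked node counts at most 7 + 1. -/
theorem work_init_le (e₀ : Fin n) {H : Finset (Side × Trapezoid m n)} (hlen : ∀ σ Δ, ((D σ).children Δ).length ≤ 7) :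
    work G W D H (init D e₀) ≤ 9 + 8 * (queryNodes W D H).card +
      4 * (Finset.univ.filter fun e => Meets G W e).card := by
  have h1 := sum_windowVertices_le (G := G) (W := W)
  have h2 := Finset.sum_le_card_nsmul (queryNodes W D H)
    (fun x => ((D x.1).children x.2).length + 1) 8 fun x _ => Nat.succ_le_succ (hlen x.1 x.2)
  simp only [work, nodeWork, vertexWork, init, List.map_cons, List.map_nil, List.sum_cons,
    List.sum_nil, List.length_cons, List.length_nil, Finset.sdiff_empty, smul_eq_mul] at h2 ⊢
  omega

end State

/-! ### Invariants of the two searches. -/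

namespace State

variable {m n : ℕ} (G : Drawing m n) (W : Window) (D : Side → SearchDag m n) (e₀ : Fin n)

/-- If `e` is to be reported, this has happened. -/
def Handled (e : Fin n) (s : State m n) : Prop := Meets G W e → e ∈ s.edgeMarks

/-- The invariant of the breadth-first search, where the edges in `P` are still to be checked. -/
structure EdgeInv (P : Set (Fin n)) (s : State m n) : Prop where
  nodup : s.output.Nodup
  mem_output : ∀ e, e ∈ s.output ↔ e ∈ s.edgeMarks
  meets : ∀ e ∈ s.edgeMarks, Meets G W e
  ends : ∀ e ∈ s.edgeMarks, ∀ v, G.Incident v e → G.pos v ∈ W.toSet → v ∈ s.vertexMarks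
  vertex : ∀ v ∈ s.vertexMarks, v ∈ s.queue ∨ ∀ e, G.Incident v e → e ∈ P ∨ Handled G W e s
  fixed : e₀ ∈ P ∨ Handled G W e₀ s

/-- The invariant of the depth-first searches, where the nodes in `P` are still to be visited. -/
structure NodeInv (P : Set (Side × Trapezoid m n)) (s : State m n) : Prop where
  leaf : ∀ x ∈ s.nodeMarks, (D x.1).children x.2 = [] →
    (∀ e ∈ x.2.bottom, Handled G W e s) ∧ ∀ e ∈ x.2.top, Handled G W e s
  child : ∀ x ∈ s.nodeMarks, ∀ Δ ∈ (D x.1).children x.2,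
    ((D x.1).region Δ ∩ W.query x.1).Nonempty → (x.1, Δ) ∈ s.nodeMarks ∨ (x.1, Δ) ∈ P
  root : ∀ σ, ((D σ).region (D σ).root ∩ W.query σ).Nonempty →
    (σ, (D σ).root) ∈ s.nodeMarks ∨ (σ, (D σ).root) ∈ P

/-- The nodes on the stack. -/
def pending (s : State m n) : Set (Side × Trapezoid m n) :=
  {x | ∃ l, (x.1, l) ∈ s.stack ∧ x.2 ∈ l}

variable {G W D e₀}

theorem EdgeInv.mono {P P' : Set (Fin n)} {s : State m n} (h : EdgeInv G W e₀ P s) (hP : P ⊆ P') :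
    EdgeInv G W e₀ P' s :=
  ⟨h.nodup, h.mem_output, h.meets, h.ends,
    fun v hv => (h.vertex v hv).imp_right fun h' e he => (h' e he).imp_left (@hP e),
    h.fixed.imp_left (@hP e₀)⟩

theorem vertexMarks_subset_enqueue (v : Fin m) (s : State m n) :
    s.vertexMarks ⊆ (enqueue G W v s).vertexMarks := by
  unfold enqueue
  split_ifs
  · exact Finset.subset_insert _ _
  · exact Finset.Subset.refl _

theorem mem_vertexMarks_enqueue {v : Fin m} (hv : G.pos v ∈ W.toSet) (s : State m n) :
    v ∈ (enqueue G W v s).vertexMarks := by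
  unfold enqueue
  split_ifs with h
  · exact Finset.mem_insert_self _ _
  · by_contra h'
    exact h ⟨hv, h'⟩

theorem queue_subset_enqueue (v : Fin m) (s : State m n) : s.queue ⊆ (enqueue G W v s).queue := by
  unfold enqueue
  split_ifs
  · exact List.subset_append_left _ _
  · exact List.Subset.refl _

theorem mem_queue_of_mem_vertexMarks_enqueue {u v : Fin m} {s : State m n}
    (h : u ∈ (enqueue G W v s).vertexMarks) :
    u ∈ s.vertexMarks ∨ u ∈ (enqueue G W v s).queue := by
  unfold enqueue at h ⊢
  split_ifs at h ⊢
  · rcases Finset.mem_insert.1 h with rfl | h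
    · exact .inr (by simp)
    · exact .inl h
  · exact .inl h

theorem edgeMarks_subset_checkEdge (e : Fin n) (s : State m n) :
    s.edgeMarks ⊆ (checkEdge G W e s).edgeMarks := by
  unfold checkEdge
  split_ifs
  · rw [enqueue_edgeMarks, enqueue_edgeMarks]
    exact Finset.subset_insert _ _
  · exact Finset.Subset.refl _

theorem handled_checkEdge (e : Fin n) (s : State m n) : Handled G W e (checkEdge G W e s) := by
  intro he
  unfold checkEdge
  split_ifs with h
  · rw [enqueue_edgeMarks, enqueue_edgeMarks]
    exact Finset.mem_insert_self _ _
  · by_contra h'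
    exact h ⟨he, h'⟩

theorem edgeMarks_subset_checkBoundary (o : Option (Fin n)) (s : State m n) :
    s.edgeMarks ⊆ (checkBoundary G W o s).edgeMarks := by
  cases o
  · exact Finset.Subset.refl _
  · exact edgeMarks_subset_checkEdge _ s

theorem handled_checkBoundary {o : Option (Fin n)} {e : Fin n} (he : e ∈ o) (s : State m n) :
    Handled G W e (checkBoundary G W o s) := by
  cases he
  exact handled_checkEdge e s

/-- After its check an edge is no longer to be checked. -/
theorem EdgeInv.checkEdge {P : Set (Fin n)} {e : Fin n} {s : State m n}
    (h : EdgeInv G W e₀ (insert e P) s) : EdgeInv G W e₀ P (checkEdge G W e s) := by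
  have handled : ∀ f, f ∈ insert e P ∨ Handled G W f s →
      f ∈ P ∨ Handled G W f (State.checkEdge G W e s) := by
    rintro f ((rfl | hf) | hf)
    · exact .inr (handled_checkEdge _ _)
    · exact .inl hf
    · exact .inr fun hm => edgeMarks_subset_checkEdge _ _ (hf hm)
  have fixed := handled _ h.fixed
  have vertex : ∀ v, (v ∈ s.queue ∨ ∀ f, G.Incident v f → f ∈ insert e P ∨ Handled G W f s) →
      v ∈ s.queue ∨ ∀ f, G.Incident v f → f ∈ P ∨ Handled G W f (State.checkEdge G W e s) :=
    fun v hv => hv.imp_right fun h' f hf => handled f (h' f hf)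
  unfold State.checkEdge at *
  split_ifs at * with hc
  · refine ⟨?_, ?_, ?_, ?_, ?_, fixed⟩
    · rw [enqueue_output, enqueue_output]
      exact List.nodup_cons.2 ⟨fun h' => hc.2 ((h.mem_output e).1 h'), h.nodup⟩
    · intro f
      rw [enqueue_output, enqueue_output, enqueue_edgeMarks, enqueue_edgeMarks]
      simp [h.mem_output]
    · intro f hf
      rw [enqueue_edgeMarks, enqueue_edgeMarks] at hf
      rcases Finset.mem_insert.1 hf with rfl | hf
      · exact hc.1
      · exact h.meets f hf
    · intro f hf v hv hvW
      rw [enqueue_edgeMarks, enqueue_edgeMarks] at hf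
      rcases Finset.mem_insert.1 hf with rfl | hf
      · rcases hv with rfl | rfl
        · exact vertexMarks_subset_enqueue _ _ (mem_vertexMarks_enqueue hvW _)
        · exact mem_vertexMarks_enqueue hvW _
      · exact vertexMarks_subset_enqueue _ _ (vertexMarks_subset_enqueue _ _
          (h.ends f hf v hv hvW))
    · intro v hv
      rcases mem_queue_of_mem_vertexMarks_enqueue hv with hv | hv
      · rcases mem_queue_of_mem_vertexMarks_enqueue hv with hv | hv
        · exact (vertex v (h.vertex v hv)).imp_left fun h' =>
            queue_subset_enqueue _ _ (queue_subset_enqueue _ _ h')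
        · exact .inl (queue_subset_enqueue _ _ hv)
      · exact .inl hv
  · exact ⟨h.nodup, h.mem_output, h.meets, h.ends, fun v hv => vertex v (h.vertex v hv), fixed⟩

theorem EdgeInv.checkBoundary {P : Set (Fin n)} {o : Option (Fin n)} {s : State m n}
    (h : EdgeInv G W e₀ P s) : EdgeInv G W e₀ P (checkBoundary G W o s) := by
  cases o
  · exact h
  · exact (h.mono (Set.subset_insert _ _)).checkEdge

theorem EdgeInv.congr {P : Set (Fin n)} {s s' : State m n} (h : EdgeInv G W e₀ P s)
    (h1 : s'.output = s.output) (h2 : s'.edgeMarks = s.edgeMarks)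
    (h3 : s'.vertexMarks = s.vertexMarks) (h4 : s'.queue = s.queue) : EdgeInv G W e₀ P s' := by
  obtain ⟨a, b, c, d, e, f⟩ := h
  unfold Handled at *
  exact ⟨by rwa [h1], by rwa [h1, h2], by rwa [h2], by rwa [h2, h3],
    by unfold Handled; rwa [h2, h3, h4], by unfold Handled; rwa [h2]⟩

theorem EdgeInv.visitNode {P : Set (Fin n)} {σ : Side} {Δ : Trapezoid m n} {s : State m n}
    (h : EdgeInv G W e₀ P s) : EdgeInv G W e₀ P (visitNode G W D σ Δ s) := by
  unfold State.visitNode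
  split_ifs
  · simp only
    split
    · exact EdgeInv.checkBoundary (EdgeInv.checkBoundary (h.congr rfl rfl rfl rfl))
    · exact h.congr rfl rfl rfl rfl
  · exact h

theorem NodeInv.mono {P P' : Set (Side × Trapezoid m n)} {s s' : State m n}
    (h : NodeInv G W D P s) (h1 : s'.nodeMarks = s.nodeMarks) (h2 : s.edgeMarks ⊆ s'.edgeMarks)
    (h3 : P ⊆ P') : NodeInv G W D P' s' := by
  refine ⟨?_, ?_, ?_⟩
  · rw [h1]
    exact fun x hx hc => ⟨fun e he hm => h2 ((h.leaf x hx hc).1 e he hm),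
      fun e he hm => h2 ((h.leaf x hx hc).2 e he hm)⟩
  · rw [h1]
    exact fun x hx Δ hΔ hq => (h.child x hx Δ hΔ hq).imp_right (@h3 _)
  · rw [h1]
    exact fun σ hq => (h.root σ hq).imp_right (@h3 _)

/-- After its visit a node is no longer to be visited. -/
theorem NodeInv.visitNode {σ : Side} {Δ : Trapezoid m n} {s : State m n}
    (h : NodeInv G W D (insert (σ, Δ) (pending s)) s) :
    NodeInv G W D (pending (visitNode G W D σ Δ s)) (visitNode G W D σ Δ s) := by
  unfold State.visitNode
  split_ifs with hc
  · have hmarks : ∀ x, x ∈ s.nodeMarks ∨ x ∈ insert (σ, Δ) (pending s) →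
        x ∈ insert (σ, Δ) s.nodeMarks ∨ x ∈ pending s := by
      rintro x (hx | rfl | hx)
      · exact .inl (Finset.mem_insert_of_mem hx)
      · exact .inl (Finset.mem_insert_self _ _)
      · exact .inr hx
    simp only
    split
    · next hnil =>
      set s' : State m n := { s with nodeMarks := insert (σ, Δ) s.nodeMarks } with hs'
      have hsub : s.edgeMarks ⊆
          (checkBoundary G W Δ.top (checkBoundary G W Δ.bottom s')).edgeMarks :=
        fun f hf => edgeMarks_subset_checkBoundary _ _ (edgeMarks_subset_checkBoundary _ s' hf)
      have hpend : pending (checkBoundary G W Δ.top (checkBoundary G W Δ.bottom s')) =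
          pending s := by
        unfold pending
        rw [checkBoundary_stack, checkBoundary_stack]
      rw [hpend]
      refine ⟨?_, ?_, ?_⟩ <;> simp only [checkBoundary_nodeMarks]
      · intro x hx hxc
        rcases Finset.mem_insert.1 hx with rfl | hx
        · exact ⟨fun e he hm => edgeMarks_subset_checkBoundary _ _ (handled_checkBoundary he _ hm),
            fun e he => handled_checkBoundary he _⟩
        · exact ⟨fun e he hm => hsub ((h.leaf x hx hxc).1 e he hm),
            fun e he hm => hsub ((h.leaf x hx hxc).2 e he hm)⟩
      · intro x hx Δ' hΔ' hq
        rcases Finset.mem_insert.1 hx with rfl | hx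
        · simp [hnil] at hΔ'
        · exact hmarks _ (h.child x hx Δ' hΔ' hq)
      · exact fun τ hq => hmarks _ (h.root τ hq)
    · next c cs hcons =>
      have hpend : ∀ x, x ∈ pending s →
          x ∈ pending { s with nodeMarks := insert (σ, Δ) s.nodeMarks,
                               stack := (σ, c :: cs) :: s.stack } :=
        fun x ⟨l, hl, hx⟩ => ⟨l, List.mem_cons_of_mem _ hl, hx⟩
      refine ⟨?_, ?_, ?_⟩
      · intro x hx hxc
        rcases Finset.mem_insert.1 hx with rfl | hx
        · simp [hcons] at hxc
        · exact h.leaf x hx hxc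
      · intro x hx Δ' hΔ' hq
        rcases Finset.mem_insert.1 hx with rfl | hx
        · rw [hcons] at hΔ'
          exact .inr ⟨c :: cs, List.mem_cons_self, hΔ'⟩
        · exact (hmarks _ (h.child x hx Δ' hΔ' hq)).imp_right (hpend _)
      · exact fun τ hq => (hmarks _ (h.root τ hq)).imp_right (hpend _)
  -- A skipped node is marked already or misses the query, and the invariant concerns only nodes
  -- that meet the query.
  · have hmarks : ∀ x : Side × Trapezoid m n, ((D x.1).region x.2 ∩ W.query x.1).Nonempty →
        x ∈ s.nodeMarks ∨ x ∈ insert (σ, Δ) (pending s) → x ∈ s.nodeMarks ∨ x ∈ pending s := by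
      rintro x hq (hx | rfl | hx)
      · exact .inl hx
      · by_contra! h'
        exact hc ⟨h'.1, hq⟩
      · exact .inr hx
    exact ⟨h.leaf, fun x hx Δ' hΔ' hq => hmarks _ hq (h.child x hx Δ' hΔ' hq),
      fun τ hq => hmarks _ hq (h.root τ hq)⟩

/-- The invariant of the algorithm. -/
def Inv (G : Drawing m n) (W : Window) (D : Side → SearchDag m n) (e₀ : Fin n)
    (s : State m n) : Prop :=
  EdgeInv G W e₀ {e | e ∈ s.scan} s ∧ NodeInv G W D (pending s) s

theorem inv_init : Inv G W D e₀ (init D e₀) := by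
  refine ⟨⟨by simp [init], by simp [init], by simp [init], by simp [init], by simp [init],
    .inl (by simp [init])⟩, ⟨by simp [init], by simp [init], fun σ _ => .inr ?_⟩⟩
  refine ⟨[(D σ).root], ?_, by simp⟩
  cases σ <;> simp [init]

theorem visitNode_scan (σ : Side) (Δ : Trapezoid m n) (s : State m n) :
    (visitNode G W D σ Δ s).scan = s.scan := by
  unfold visitNode
  split_ifs
  · simp only
    split
    · rw [checkBoundary_scan, checkBoundary_scan]
    · rfl
  · rfl

theorem inv_step {s : State m n} (h : Inv G W D e₀ s) : Inv G W D e₀ (step G W D s) := by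
  obtain ⟨stack, nodeMarks, scan, queue, vertexMarks, edgeMarks, output⟩ := s
  obtain ⟨h1, h2⟩ := h
  rcases stack with _ | ⟨⟨σ, _ | ⟨Δ, rest⟩⟩, st⟩
  · rcases scan with _ | ⟨e, es⟩
    · rcases queue with _ | ⟨v, vs⟩
      · exact ⟨h1, h2⟩
      -- The vertex gives up its place in the queue, and its edges become the pending ones; the scan
      -- list was empty, so nothing pending is lost.
      · refine ⟨⟨h1.nodup, h1.mem_output, h1.meets, h1.ends, fun u hu => ?_, ?_⟩,
          h2.mono rfl (Finset.Subset.refl _) (Set.Subset.refl _)⟩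
        · rcases h1.vertex u hu with hq | hi
          · rcases List.mem_cons.1 hq with rfl | hq
            · refine .inr fun e he => .inl ?_
              simpa [step, Drawing.incidenceList] using he
            · exact .inl hq
          · exact .inr fun e he => (hi e he).imp_left fun h' => absurd h' List.not_mem_nil
        · exact h1.fixed.imp_left fun h' => absurd h' List.not_mem_nil
    · refine ⟨?_, ?_⟩
      · simp only [step, checkEdge_scan]
        refine EdgeInv.checkEdge ?_
        refine EdgeInv.mono (P := {f | f ∈ e :: es}) (h1.congr rfl rfl rfl rfl) fun f hf => ?_
        exact List.mem_cons.1 hf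
      · have hp : pending (step G W D ⟨[], nodeMarks, e :: es, queue, vertexMarks, edgeMarks,
            output⟩) = pending ⟨[], nodeMarks, e :: es, queue, vertexMarks, edgeMarks, output⟩ := by
          simp only [pending, step, checkEdge_stack]
        rw [hp]
        refine h2.mono ?_ ?_ (Set.Subset.refl _)
        · simp only [step, checkEdge_nodeMarks]
        · exact edgeMarks_subset_checkEdge e
            ⟨[], nodeMarks, es, queue, vertexMarks, edgeMarks, output⟩
  · refine ⟨h1.congr rfl rfl rfl rfl, h2.mono rfl (Finset.Subset.refl _) ?_⟩
    rintro x ⟨l, hl, hx⟩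
    rcases List.mem_cons.1 hl with h | h
    · rw [(Prod.mk.inj h).2] at hx
      exact absurd hx List.not_mem_nil
    · exact ⟨l, h, hx⟩
  · refine ⟨?_, ?_⟩
    · simp only [step, visitNode_scan]
      exact EdgeInv.visitNode (h1.congr rfl rfl rfl rfl)
    · refine NodeInv.visitNode (h2.mono rfl (Finset.Subset.refl _) ?_)
      rintro x ⟨l, hl, hx⟩
      rcases List.mem_cons.1 hl with h | h
      · obtain ⟨h3, rfl⟩ := Prod.mk.inj h
        rcases List.mem_cons.1 hx with h4 | h4
        · exact .inl (Prod.ext h3 h4)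
        · exact .inr ⟨rest, by rw [h3]; exact List.mem_cons_self, h4⟩
      · exact .inr ⟨l, List.mem_cons_of_mem _ h, hx⟩

theorem inv_iterate (t : ℕ) : Inv G W D e₀ ((step G W D)^[t] (init D e₀)) := by
  induction t with
  | zero => exact inv_init
  | succ t ih =>
    rw [Function.iterate_succ_apply']
    exact inv_step ih

end State

/-! ### The four sides of the window and completeness of the report. -/

/-- The drawing on which the search DAG for a side is built. -/
def sideDrawing {m n : ℕ} (G : Drawing m n) : Side → Drawing m n
  | Side.left => G
  | Side.right => G
  | Side.bottom => G.rotate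
  | Side.top => G.rotate

/-- The insertion order of the search DAG for a side. -/
def sideOrder {n : ℕ} (π π' : Equiv.Perm (Fin n)) : Side → Equiv.Perm (Fin n)
  | Side.left => π
  | Side.right => π
  | Side.bottom => π'
  | Side.top => π'

theorem dags_eq {m n : ℕ} (G : Drawing m n) (π π' : Equiv.Perm (Fin n)) (σ : Side) :
    dags G π π' σ = (sideDrawing G σ).tsd (sideOrder π π' σ) := by
  cases σ <;> rfl

namespace Drawing

variable {m n : ℕ} {G : Drawing m n}

theorem rot_injective : Function.Injective rot := by
  rintro ⟨a, b⟩ ⟨c, d⟩ h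
  simp only [rot, Prod.mk.injEq, neg_inj] at h
  exact Prod.ext h.2 h.1

theorem rotate_seg (e : Fin n) : G.rotate.seg e = rot '' G.seg e := by
  let f : Pt →ₗ[ℝ] Pt :=
    { toFun := rot
      map_add' := fun p q => by ext <;> simp [rot]; ring
      map_smul' := fun c p => by ext <;> simp [rot] }
  exact (image_segment ℝ f.toAffineMap (G.pos (G.ends e).1) (G.pos (G.ends e).2)).symm

theorem mem_rotate_seg {e : Fin n} {p : Pt} : rot p ∈ G.rotate.seg e ↔ p ∈ G.seg e := by
  rw [rotate_seg, rot_injective.mem_set_image]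

theorem IsConnectedPlanarSubdivision.rotate (hG : G.IsConnectedPlanarSubdivision) :
    G.rotate.IsConnectedPlanarSubdivision where
  pos_injective := rot_injective.comp hG.pos_injective
  ends_ne := hG.ends_ne
  noncrossing e f hef p hp := by
    rw [rotate_seg, rotate_seg] at hp
    obtain ⟨⟨q, hq, rfl⟩, hq'⟩ := hp
    rw [rot_injective.mem_set_image] at hq'
    obtain ⟨v, h1, h2, h3⟩ := hG.noncrossing e f hef q ⟨hq, hq'⟩
    exact ⟨v, h1, h2, congrArg rot h3⟩
  vertex_on_edge v e h := hG.vertex_on_edge v e (mem_rotate_seg.1 h)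
  connected := hG.connected

end Drawing

variable {m n : ℕ} {G : Drawing m n} {W : Window}

theorem planar_sideDrawing (hG : G.IsConnectedPlanarSubdivision) (σ : Side) :
    (sideDrawing G σ).IsConnectedPlanarSubdivision := by
  cases σ
  exacts [hG, hG, hG.rotate, hG.rotate]

theorem query_eq (W : Window) (σ : Side) : ∃ a b c, b ≤ c ∧ W.query σ = {a} ×ˢ Icc b c := by
  have hrot : ∀ y, Drawing.rot '' (Icc W.x₀ W.x₁ ×ˢ {y}) = {-y} ×ˢ Icc W.x₀ W.x₁ := by
    intro y
    ext ⟨u, v⟩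
    simp only [mem_image, mem_prod, mem_singleton_iff, Drawing.rot, Prod.exists, Prod.mk.injEq]
    constructor
    · rintro ⟨p, q, ⟨h1, rfl⟩, rfl, rfl⟩
      exact ⟨rfl, h1⟩
    · rintro ⟨rfl, h⟩
      exact ⟨v, y, ⟨h, rfl⟩, rfl, rfl⟩
  cases σ
  · exact ⟨_, _, _, W.y_le, rfl⟩
  · exact ⟨_, _, _, W.y_le, rfl⟩
  · exact ⟨_, _, _, W.x_le, hrot _⟩
  · exact ⟨_, _, _, W.x_le, hrot _⟩

/-- The side `σ` of the window. -/
def Window.sideSet (W : Window) : Side → Set Pt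
  | Side.left => {W.x₀} ×ˢ Icc W.y₀ W.y₁
  | Side.right => {W.x₁} ×ˢ Icc W.y₀ W.y₁
  | Side.bottom => Icc W.x₀ W.x₁ ×ˢ {W.y₀}
  | Side.top => Icc W.x₀ W.x₁ ×ˢ {W.y₁}

theorem seg_inter_query {e : Fin n} {σ : Side} :
    ((sideDrawing G σ).seg e ∩ W.query σ).Nonempty ↔ (G.seg e ∩ W.sideSet σ).Nonempty := by
  cases σ
  · rfl
  · rfl
  · change (G.rotate.seg e ∩ Drawing.rot '' _).Nonempty ↔ _
    rw [Drawing.rotate_seg, ← image_inter Drawing.rot_injective, image_nonempty]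
    rfl
  · change (G.rotate.seg e ∩ Drawing.rot '' _).Nonempty ↔ _
    rw [Drawing.rotate_seg, ← image_inter Drawing.rot_injective, image_nonempty]
    rfl

theorem sideSet_subset (σ : Side) : W.sideSet σ ⊆ W.toSet := by
  have hx := W.x_le
  have hy := W.y_le
  cases σ
  · exact prod_mono (by simpa using hx) Subset.rfl
  · exact prod_mono (by simpa using hx) Subset.rfl
  · exact prod_mono Subset.rfl (by simpa using hy)
  · exact prod_mono Subset.rfl (by simpa using hy)

theorem frontier_toSet_subset : frontier W.toSet ⊆ ⋃ σ, W.sideSet σ := by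
  have hf : ∀ a b : ℝ, frontier (Icc a b) ⊆ {a, b} := by
    intro a b x hx
    rw [frontier, isClosed_Icc.closure_eq, interior_Icc] at hx
    obtain ⟨⟨h1, h2⟩, h3⟩ := hx
    by_contra hne
    simp only [mem_insert_iff, mem_singleton_iff, not_or] at hne
    exact h3 ⟨lt_of_le_of_ne h1 (Ne.symm hne.1), lt_of_le_of_ne h2 hne.2⟩
  rintro ⟨x, y⟩ h
  rw [Window.toSet, frontier_prod_eq, isClosed_Icc.closure_eq, isClosed_Icc.closure_eq] at h
  rw [mem_iUnion]
  rcases h with ⟨h1, h2⟩ | ⟨h1, h2⟩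
  · rcases hf _ _ h2 with h2 | h2
    · exact ⟨Side.bottom, h1, h2⟩
    · exact ⟨Side.top, h1, h2⟩
  · rcases hf _ _ h1 with h1 | h1
    · exact ⟨Side.left, h1, h2⟩
    · exact ⟨Side.right, h1, h2⟩

/-- An edge that meets the window crosses one of its sides or lies inside. -/
theorem crosses_side_or_subset {e : Fin n} (h : Meets G W e) :
    (∃ σ, (G.seg e ∩ W.sideSet σ).Nonempty) ∨ G.seg e ⊆ W.toSet := by
  by_cases hsub : G.seg e ⊆ W.toSet
  · exact .inr hsub
  · left
    obtain ⟨p, hp, hpW⟩ := not_subset.1 hsub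
    have hclosed : IsClosed W.toSet := isClosed_Icc.prod isClosed_Icc
    obtain ⟨z, hz, hzf⟩ : ∃ z ∈ G.seg e, z ∈ frontier W.toSet := by
      by_contra! hc
      have hint : ∀ z ∈ G.seg e, z ∈ W.toSet → z ∈ interior W.toSet := fun z hz hzW => by
        by_contra h'
        exact hc z hz ⟨subset_closure hzW, h'⟩
      obtain ⟨q, hq, hqW⟩ := h
      obtain ⟨z, -, hz, hz'⟩ := (convex_segment (𝕜 := ℝ) (G.pos (G.ends e).1)
        (G.pos (G.ends e).2)).isPreconnected (interior W.toSet) W.toSetᶜ isOpen_interior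
        hclosed.isOpen_compl
        (fun z hz => (Classical.em (z ∈ W.toSet)).imp (hint z hz) id) ⟨q, hq, hint q hq hqW⟩
        ⟨p, hp, hpW⟩
      exact hz' (interior_subset hz)
    obtain ⟨σ, hσ⟩ := mem_iUnion.1 (frontier_toSet_subset hzf)
    exact ⟨σ, z, hz, hσ⟩

/-- The depth-first searches find all edges that cross a side of the window. -/
theorem handled_of_crosses_side (hG : G.IsConnectedPlanarSubdivision) {π π' : Equiv.Perm (Fin n)}
    {s : State m n} (h : State.NodeInv G W (dags G π π') ∅ s) {e : Fin n} {σ : Side}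
    (he : (G.seg e ∩ W.sideSet σ).Nonempty) : State.Handled G W e s := by
  have hGσ := planar_sideDrawing hG σ
  obtain ⟨p, hp, hpq⟩ := seg_inter_query.2 he
  obtain ⟨Δ, hΔ, ht, hr⟩ := Drawing.exists_face_of_mem_seg hGσ (Finset.mem_univ e) hp
  have hmark : (σ, Δ) ∈ s.nodeMarks := by
    -- With nothing pending, the marked nodes are closed under children that meet the query. All
    -- ranks are below `n`, so the last prefix is the full edge set.
    refine Drawing.face_mem_of_closed hGσ (sideOrder π π' σ) (q := W.query σ)
      (M := fun Δ => (σ, Δ) ∈ s.nodeMarks) ?_ ?_ n Δ ?_ ⟨p, hr, hpq⟩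
    · intro hq
      have := h.root σ
      rw [dags_eq] at this
      exact (this hq).resolve_right (notMem_empty _)
    · intro Δ₁ h1 Δ₂ h2 hq
      have := h.child _ h1 Δ₂
      simp only [dags_eq] at this
      exact (this h2 hq).resolve_right (notMem_empty _)
    · simpa using hΔ
  have := h.leaf _ hmark
  simp only [dags_eq] at this
  exact (this (Drawing.children_eq_nil hΔ)).2 e ht

/-- When the work lists are empty, all edges that meet the window have been reported. -/
theorem handled_of_halted (hG : G.IsConnectedPlanarSubdivision) {π π' : Equiv.Perm (Fin n)}
    {e₀ : Fin n} {s : State m n} (h : State.Inv G W (dags G π π') e₀ s) (hs : s.Halted)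
    (e : Fin n) : State.Handled G W e s := by
  obtain ⟨hE, hN⟩ := h
  obtain ⟨hs1, hs2, hs3⟩ := hs
  have hpend : State.pending s = ∅ := by
    refine eq_empty_of_forall_notMem fun x hx => ?_
    obtain ⟨l, hl, -⟩ := hx
    rw [hs1] at hl
    exact List.not_mem_nil hl
  rw [hpend] at hN
  have hvertex : ∀ v ∈ s.vertexMarks, ∀ f, G.Incident v f → State.Handled G W f s := by
    intro v hv f hf
    rcases hE.vertex v hv with h | h
    · rw [hs3] at h
      exact absurd h List.not_mem_nil
    · refine (h f hf).resolve_left fun h' => ?_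
      rw [mem_ofPred_eq, hs2] at h'
      exact List.not_mem_nil h'
  have hfixed : State.Handled G W e₀ s := hE.fixed.resolve_left fun h' => by
    rw [mem_ofPred_eq, hs2] at h'
    exact List.not_mem_nil h'
  intro he
  rcases crosses_side_or_subset he with ⟨σ, hσ⟩ | hsub
  · exact handled_of_crosses_side hG hN hσ he
  by_contra hne
  have hmeets : ∀ v, G.pos v ∈ W.toSet → ∀ f, G.Incident v f → Meets G W f := by
    rintro v hv f (rfl | rfl)
    · exact ⟨_, left_mem_segment ℝ _ _, hv⟩
    · exact ⟨_, right_mem_segment ℝ _ _, hv⟩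
  -- Being unmarked inside the window passes along `f`. A report of `f` would have marked `v`, so
  -- `f` crosses no side and `w` is inside; a mark on `w` would have led to a report of `f`.
  have hincident : ∀ {v w f}, G.Incident v f → G.Incident w f →
      G.pos v ∈ W.toSet ∧ v ∉ s.vertexMarks → G.pos w ∈ W.toSet ∧ w ∉ s.vertexMarks := by
    rintro v w f hv hw ⟨hvW, hvm⟩
    have hf := hmeets v hvW f hv
    have hfm : f ∉ s.edgeMarks := fun h' => hvm (hE.ends f h' v hv hvW)
    refine ⟨?_, fun hwm => hfm (hvertex w hwm f hw hf)⟩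
    rcases crosses_side_or_subset hf with ⟨σ, hσ⟩ | hsub'
    · exact absurd (handled_of_crosses_side hG hN hσ hf) hfm
    · rcases hw with rfl | rfl
      · exact hsub' (left_mem_segment ℝ _ _)
      · exact hsub' (right_mem_segment ℝ _ _)
  have hstart : G.pos (G.ends e).1 ∈ W.toSet ∧ (G.ends e).1 ∉ s.vertexMarks :=
    ⟨hsub (left_mem_segment ℝ _ _), fun h' => hne (hvertex _ h' e (.inl rfl) he)⟩
  have hall : ∀ v w, G.graph.Walk v w → G.pos v ∈ W.toSet ∧ v ∉ s.vertexMarks →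
      G.pos w ∈ W.toSet ∧ w ∉ s.vertexMarks := by
    intro v w p
    induction p with
    | nil => exact id
    | cons hadj _ ih =>
      intro hv
      refine ih ?_
      rw [Drawing.graph, SimpleGraph.fromRel_adj] at hadj
      rcases hadj.2 with ⟨f, hf⟩ | ⟨f, hf⟩
      · exact hincident (f := f) (.inl (by rw [hf])) (.inr (by rw [hf])) hv
      · exact hincident (f := f) (.inr (by rw [hf])) (.inl (by rw [hf])) hv
  obtain ⟨p⟩ := hG.connected.preconnected (G.ends e).1 (G.ends e₀).1
  -- The walk ends at an end of `e₀` inside the window. Hence `e₀` meets the window, was reported by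
  -- its own check, and marked this end: a contradiction.
  have hend := hall _ _ p hstart
  exact hend.2 (hE.ends e₀ (hfixed (hmeets _ hend.1 e₀ (.inl rfl))) _ (.inl rfl) hend.1)

/-! ### The expected running time. -/

/-- The nodes of the four search DAGs. -/
def allNodes (G : Drawing m n) (π π' : Equiv.Perm (Fin n)) : Finset (Side × Trapezoid m n) :=
  ({Side.left, Side.right, Side.bottom, Side.top} : Finset Side).biUnion fun σ =>
    ((sideDrawing G σ).history (sideOrder π π' σ)).map ⟨fun Δ => (σ, Δ), fun _ _ h => (Prod.mk.inj h).2⟩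

theorem mem_allNodes {π π' : Equiv.Perm (Fin n)} {σ : Side} {Δ : Trapezoid m n} :
    (σ, Δ) ∈ allNodes G π π' ↔ Δ ∈ (sideDrawing G σ).history (sideOrder π π' σ) := by
  rw [allNodes, Finset.mem_biUnion]
  constructor
  · rintro ⟨τ, -, h⟩
    obtain ⟨Δ', hΔ', h⟩ := Finset.mem_map.1 h
    obtain ⟨rfl, rfl⟩ := Prod.mk.inj h
    exact hΔ'
  · exact fun h => ⟨σ, by cases σ <;> simp, Finset.mem_map.2 ⟨Δ, h, rfl⟩⟩

/-- The number of nodes that meet a side of the window. -/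
def visits (G : Drawing m n) (W : Window) (π : Equiv.Perm (Fin n)) (σ : Side) : ℕ :=
  (((sideDrawing G σ).history π).filter fun Δ =>
    ((sideDrawing G σ).region Δ ∩ W.query σ).Nonempty).card

theorem card_queryNodes_le (π π' : Equiv.Perm (Fin n)) :
    (State.queryNodes W (dags G π π') (allNodes G π π')).card ≤
      (visits G W π Side.left + visits G W π Side.right) +
        (visits G W π' Side.bottom + visits G W π' Side.top) := by
  have hsub : State.queryNodes W (dags G π π') (allNodes G π π') ⊆
      ({Side.left, Side.right, Side.bottom, Side.top} : Finset Side).biUnion fun σ =>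
        (((sideDrawing G σ).history (sideOrder π π' σ)).filter fun Δ =>
          ((sideDrawing G σ).region Δ ∩ W.query σ).Nonempty).map
            ⟨fun Δ => (σ, Δ), fun _ _ h => (Prod.mk.inj h).2⟩ := by
    rintro ⟨σ, Δ⟩ h
    rw [State.queryNodes, Finset.mem_filter, mem_allNodes] at h
    simp only [dags_eq] at h
    rw [Finset.mem_biUnion]
    refine ⟨σ, by cases σ <;> simp, Finset.mem_map.2 ⟨Δ, Finset.mem_filter.2 ⟨h.1, h.2⟩, rfl⟩⟩
  refine (Finset.card_le_card hsub).trans (Finset.card_biUnion_le.trans ?_)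
  simp only [Finset.card_map]
  rw [Finset.sum_insert (by simp), Finset.sum_insert (by simp), Finset.sum_insert (by simp),
    Finset.sum_singleton]
  simp only [visits, sideOrder]
  omega

theorem exists_halted_run (hG : G.IsConnectedPlanarSubdivision) (e₀ : Fin n)
    (π π' : Equiv.Perm (Fin n)) :
    ∃ t ≤ 9 + 8 * ((visits G W π Side.left + visits G W π Side.right) +
        (visits G W π' Side.bottom + visits G W π' Side.top)) +
        4 * (Finset.univ.filter fun e => Meets G W e).card, (run G W e₀ π π' t).Halted := by
  have hlen : ∀ σ Δ, ((dags G π π' σ).children Δ).length ≤ 7 := by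
    intro σ Δ
    rw [dags_eq]
    exact Drawing.length_children_le (planar_sideDrawing hG σ) _ Δ
  have hH : ∀ σ Δ, ∀ Δ' ∈ (dags G π π' σ).children Δ, (σ, Δ') ∈ allNodes G π π' := by
    intro σ Δ Δ' h
    rw [dags_eq] at h
    rw [mem_allNodes]
    exact Drawing.children_mem_history h
  refine State.exists_halted (G := G) (W := W) hH _ _ ?_ ?_
  · have hroot : ∀ σ, (σ, (dags G π π' σ).root) ∈ allNodes G π π' := by
      intro σ
      rw [mem_allNodes, dags_eq]
      exact Drawing.root_mem_history _
    intro x hx Δ hΔ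
    simp only [State.init, List.mem_cons, List.not_mem_nil, or_false] at hx
    rcases hx with rfl | rfl | rfl | rfl <;>
    · obtain rfl := List.mem_singleton.1 hΔ
      exact hroot _
  · have h1 := State.work_init_le (G := G) (W := W) e₀ (H := allNodes G π π') hlen
    have h2 := card_queryNodes_le (G := G) (W := W) π π'
    omega

theorem halted_runTime (hG : G.IsConnectedPlanarSubdivision) (e₀ : Fin n)
    (π π' : Equiv.Perm (Fin n)) : (run G W e₀ π π' (runTime G W e₀ π π')).Halted := by
  obtain ⟨t, -, ht⟩ := exists_halted_run (W := W) hG e₀ π π'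
  exact Nat.sInf_mem (s := {t | (run G W e₀ π π' t).Halted}) ⟨t, ht⟩

theorem runTime_le (hG : G.IsConnectedPlanarSubdivision) (e₀ : Fin n)
    (π π' : Equiv.Perm (Fin n)) :
    runTime G W e₀ π π' ≤ 9 + 8 * ((visits G W π Side.left + visits G W π Side.right) +
        (visits G W π' Side.bottom + visits G W π' Side.top)) +
        4 * (Finset.univ.filter fun e => Meets G W e).card := by
  obtain ⟨t, h, ht⟩ := exists_halted_run (W := W) hG e₀ π π'
  exact (Nat.sInf_le (s := {t | (run G W e₀ π π' t).Halted}) ht).trans h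

theorem sum_visits_le (hG : G.IsConnectedPlanarSubdivision) (hn : 0 < n) (σ : Side) :
    ∑ π : Equiv.Perm (Fin n), (visits G W π σ : ℝ) ≤
      Fintype.card (Equiv.Perm (Fin n)) * (1 + (5 * (1 + Real.log n) + 70 *
        (Finset.univ.filter fun e => Meets G W e).card)) := by
  obtain ⟨a, b, c, hbc, hq⟩ := query_eq W σ
  have h := Drawing.sum_card_history_le (planar_sideDrawing hG σ) hn (a := a) hbc
  rw [← hq] at h
  refine h.trans (mul_le_mul_of_nonneg_left ?_ (by positivity))
  have hsub : (Finset.univ.filter fun e => ((sideDrawing G σ).seg e ∩ W.query σ).Nonempty) ⊆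
      Finset.univ.filter fun e => Meets G W e := by
    intro e he
    simp only [Finset.mem_filter, Finset.mem_univ, true_and, seg_inter_query] at he ⊢
    exact he.mono (inter_subset_inter_right _ (sideSet_subset σ))
  have : ((Finset.univ.filter fun e => ((sideDrawing G σ).seg e ∩ W.query σ).Nonempty).card : ℝ) ≤
      (Finset.univ.filter fun e => Meets G W e).card := by
    exact_mod_cast Finset.card_le_card hsub
  linarith

/-- The expected running time of the window query. -/
theorem expect_runTime_le (hG : G.IsConnectedPlanarSubdivision) (hn : 2 ≤ n) (e₀ : Fin n) :
    Finset.expect Finset.univ (fun ω : Equiv.Perm (Fin n) × Equiv.Perm (Fin n) =>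
      (runTime G W e₀ ω.1 ω.2 : ℝ)) ≤
      2244 * (((Finset.univ.filter fun e => Meets G W e).card : ℝ) + Real.log n) := by
  set k := ((Finset.univ.filter fun e => Meets G W e).card : ℝ) with hk
  set N := (Fintype.card (Equiv.Perm (Fin n)) : ℝ) with hN
  have hNpos : 0 < N := by
    rw [hN]
    exact_mod_cast Fintype.card_pos
  -- This absorbs the additive constants into the logarithm and is where `2 ≤ n` enters.
  have hlog : (1 / 2 : ℝ) ≤ Real.log n := by
    have h1 : Real.log 2 ≤ Real.log n :=
      Real.log_le_log (by norm_num) (by exact_mod_cast hn)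
    have := Real.log_two_gt_d9
    linarith
  have hk0 : 0 ≤ k := by positivity
  have hv := fun σ => sum_visits_le (W := W) hG (by omega : 0 < n) σ
  have h1 : ∑ ω : Equiv.Perm (Fin n) × Equiv.Perm (Fin n), (runTime G W e₀ ω.1 ω.2 : ℝ) ≤
      ∑ ω : Equiv.Perm (Fin n) × Equiv.Perm (Fin n),
        (9 + 8 * (((visits G W ω.1 Side.left : ℝ) + visits G W ω.1 Side.right) +
          ((visits G W ω.2 Side.bottom : ℝ) + visits G W ω.2 Side.top)) + 4 * k) := by
    refine Finset.sum_le_sum fun ω _ => ?_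
    rw [hk]
    exact_mod_cast runTime_le (W := W) hG e₀ ω.1 ω.2
  -- Each count depends on one order only, so the sum over the other order contributes a factor `N`.
  have h2 : ∑ ω : Equiv.Perm (Fin n) × Equiv.Perm (Fin n),
        (9 + 8 * (((visits G W ω.1 Side.left : ℝ) + visits G W ω.1 Side.right) +
          ((visits G W ω.2 Side.bottom : ℝ) + visits G W ω.2 Side.top)) + 4 * k) =
      N * (N * (9 + 4 * k) + 8 * ((∑ π, (visits G W π Side.left : ℝ) +
        ∑ π, (visits G W π Side.right : ℝ)) + (∑ π, (visits G W π Side.bottom : ℝ) +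
          ∑ π, (visits G W π Side.top : ℝ)))) := by
    rw [Fintype.sum_prod_type]
    simp only [Finset.sum_add_distrib, Finset.sum_const, ← Finset.mul_sum, Finset.card_univ,
      nsmul_eq_mul, ← hN]
    ring
  rw [Finset.expect_eq_sum_div_card, Finset.card_univ, Fintype.card_prod, Nat.cast_mul, ← hN,
    div_le_iff₀ (by positivity)]
  rw [h2] at h1
  refine h1.trans ?_
  rw [show 2244 * (k + Real.log n) * (N * N) = N * (N * (2244 * (k + Real.log n))) by ring]
  refine mul_le_mul_of_nonneg_left ?_ hNpos.le
  have h3 := hv Side.left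
  have h4 := hv Side.right
  have h5 := hv Side.bottom
  have h6 := hv Side.top
  -- Four sides at 8 per node give 32. The coefficient of `k` is 4 + 32 · 70 = 2244, and the rest,
  -- 201 + 160 log n, is at most 562 log n.
  have h7 : N * (9 + 4 * k + 32 * (1 + (5 * (1 + Real.log n) + 70 * k))) ≤
      N * (2244 * (k + Real.log n)) := by
    refine mul_le_mul_of_nonneg_left ?_ hNpos.le
    linarith
  linarith

end WindowQuery

end

theorem corollary1 :
    ∃ C : ℝ, ∀ (m n : ℕ) (G : WindowQuery.Drawing m n),
      G.IsConnectedPlanarSubdivision → 2 ≤ n →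
      ∀ (e₀ : Fin n) (W : WindowQuery.Window),
        (∀ π π' : Equiv.Perm (Fin n),
          (WindowQuery.run G W e₀ π π' (WindowQuery.runTime G W e₀ π π')).Halted ∧
          (WindowQuery.run G W e₀ π π' (WindowQuery.runTime G W e₀ π π')).output.Nodup ∧
          ∀ e : Fin n,
            e ∈ (WindowQuery.run G W e₀ π π' (WindowQuery.runTime G W e₀ π π')).output ↔
              WindowQuery.Meets G W e) ∧
        Finset.expect Finset.univ (fun ω : Equiv.Perm (Fin n) × Equiv.Perm (Fin n) =>
            (WindowQuery.runTime G W e₀ ω.1 ω.2 : ℝ)) ≤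
          C * ((Set.ncard {e : Fin n | WindowQuery.Meets G W e} : ℝ) + Real.log n) := by
  classical
  refine ⟨2244, fun m n G hG hn e₀ W => ⟨fun π π' => ?_, ?_⟩⟩
  · have hh := WindowQuery.halted_runTime (W := W) hG e₀ π π'
    have hi : WindowQuery.State.Inv G W (WindowQuery.dags G π π') e₀
        (WindowQuery.run G W e₀ π π' (WindowQuery.runTime G W e₀ π π')) :=
      WindowQuery.State.inv_iterate _
    refine ⟨hh, hi.1.nodup, fun e => ?_⟩
    rw [hi.1.mem_output]
    exact ⟨hi.1.meets e, WindowQuery.handled_of_halted hG hi hh e⟩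
  · refine (WindowQuery.expect_runTime_le hG hn e₀).trans_eq ?_
    rw [Set.ncard_eq_toFinset_card', Set.toFinset_ofPred]
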